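/- Let $Y=\,]-\tfrac12,\tfrac12[^3$, let $\Sigma\subset Y$ be compact and connected with Lipschitz boundary, and assume that $\Sigma^*:=Y\setminus\Sigma$ is simply connected. Put $\Sigma^*_\sharp:=\mathbb R^3\setminus\bigcup_{k\in\mathbb Z^3}(k+\Sigma)$, the periodic version of $\Sigma^*$. Let $L^2_\sharp(Y)$ be the space of $\mathbb Z^3$-periodic functions in $L^2_{loc}(\mathbb R^3)$, let $W^{1,2}_\sharp(Y)$ be the space of complex-valued functions in $L^2_\sharp(Y)$ whose distributional first derivatives on $\mathbb R^3$ belong to $L^2_\sharp(Y)$, and let $W^{1,2}_\sharp(\Sigma^*)$ be the space of restrictions to $\Sigma^*$ of functions in $W^{1,2}_\sharp(Y)$. For $a,b\in\mathbb C^3$ write $a\cdot b=\sum_i a_ib_i$. There is a constant $C>0$, depending only on $\Sigma$, such that the following holds for every $u\in L^2_\sharp(Y;\mathbb C^3)$ with $\operatorname{curl}u=0$ in the sense of periodic distributions in $\Sigma^*$, i.e. in $\mathcal D'(\Sigma^*_\sharp)$. There exist a unique vector $\oint u\in\mathbb C^3$ and a function $\psi\in W^{1,2}_\sharp(\Sigma^*)$,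 unique up to an additive constant, such that $$u=\nabla\psi+\oint u\quad\text{in }\Sigma^*.$$ Moreover: (i) for every $f\in L^2_\sharp(Y;\mathbb C^3)$ with $\operatorname{div}f=0$ in the sense of periodic distributions (i.e. in $\mathcal D'(\mathbb R^3)$) and $f=0$ a.e. in $\Sigma$, $$\int_Y u\cdot f\,dy=\Big(\oint u\Big)\cdot\int_Y f\,dy;$$ (ii) if $u$ is continuous on $\Sigma^*_\sharp$, then for every $k\in\{1,2,3\}$ and every $\gamma\in C^1([0,1];\Sigma^*_\sharp)$ with $\gamma(1)-\gamma(0)=e_k$, $$\Big(\oint u\Big)\cdot e_k=\int_0^1 u(\gamma(s))\cdot\gamma'(s)\,ds;$$ (iii) $\displaystyle\Big|\oint u\Big|\le C\,\|u\|_{L^2(Y;\mathbb C^3)}$. -/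

import Mathlib

open MeasureTheory Set

/-- Euclidean space `ℝ³`. -/
abbrev E3 : Type := EuclideanSpace ℝ (Fin 3)

/-- The Hermitian space `ℂ³`. -/
abbrev C3 : Type := EuclideanSpace ℂ (Fin 3)

/-- The open unit cell `Y = ]-1/2, 1/2[³`. -/
def unitCell : Set E3 := {y | ∀ i, y i ∈ Ioo (-(1 / 2) : ℝ) (1 / 2)}

/-- The point of the lattice `ℤ³ ⊂ ℝ³` with integer coordinates `k`. -/
noncomputable def latticeVec (k : Fin 3 → ℤ) : E3 := WithLp.toLp 2 (fun i => (k i : ℝ))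

/-- `Σ* = Y \ Σ`. -/
def cellComplement (S : Set E3) : Set E3 := unitCell \ S

/-- The periodic matrix `ℝ³ \ ⋃_{k ∈ ℤ³} (k + Σ)`, that is `Σ*` seen in the torus `ℝ³/ℤ³`. -/
def periodicComplement (S : Set E3) : Set E3 := {y | ∀ k : Fin 3 → ℤ, y + latticeVec k ∉ S}

/-- `S` has a Lipschitz boundary: near each boundary point, `S` is, in suitable orthonormal
coordinates, the set of points lying on or below the graph of a Lipschitz function. -/
def HasLipschitzBoundary (S : Set E3) : Prop :=
  ∀ x ∈ frontier S, ∃ r > 0, ∃ L : E3 ≃ₗᵢ[ℝ] E3, ∃ g : EuclideanSpace ℝ (Fin 2) → ℝ,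
    (∃ K : NNReal, LipschitzWith K g) ∧
      ∀ y ∈ Metric.ball x r, y ∈ S ↔ L y 2 ≤ g !₂[L y 0, L y 1]

/-- The standing geometric assumptions on the inclusion `Σ`. -/
structure IsInclusion (S : Set E3) : Prop where
  subset_cell : S ⊆ unitCell
  isCompact : IsCompact S
  isConnected : IsConnected S
  lipschitz : HasLipschitzBoundary S
  simplyConnected : IsSimplyConnected (cellComplement S)

/-- `L²_♯(Y; F)`: locally square integrable functions on `ℝ³` that are `Y`-periodic
(up to null sets). -/
structure MemL2per {F : Type*} [NormedAddCommGroup F] (f : E3 → F) : Prop where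
  memLp : ∀ K : Set E3, IsCompact K → MemLp f 2 (volume.restrict K)
  periodic : ∀ k : Fin 3 → ℤ, ∀ᵐ y, f (y + latticeVec k) = f y

/-- Real test functions: `φ ∈ C_c^∞(U)`. -/
structure IsTest (U : Set E3) (φ : E3 → ℝ) : Prop where
  smooth : ContDiff ℝ (⊤ : ℕ∞) φ
  compact : HasCompactSupport φ
  support_subset : tsupport φ ⊆ U

/-- The classical partial derivative `∂_i φ`. -/
noncomputable def partialDeriv (i : Fin 3) (φ : E3 → ℝ) (y : E3) : ℝ :=
  fderiv ℝ φ y (EuclideanSpace.single i 1)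

/-- `∂_i ψ = g` in `𝒟'(U)`. -/
def HasWeakPartial (U : Set E3) (i : Fin 3) (ψ g : E3 → ℂ) : Prop :=
  ∀ φ : E3 → ℝ, IsTest U φ →
    ∫ y, (partialDeriv i φ y : ℂ) * ψ y = -∫ y, (φ y : ℂ) * g y

/-- `rot u = 0` in `𝒟'(U)`: `∂_i u_j - ∂_j u_i = 0` for all `i, j`. -/
def IsCurlFreeOn (U : Set E3) (u : E3 → C3) : Prop :=
  ∀ i j : Fin 3, ∀ φ : E3 → ℝ, IsTest U φ →
    ∫ y, ((partialDeriv j φ y : ℂ) * u y i - (partialDeriv i φ y : ℂ) * u y j) = 0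

/-- `div f = 0` in `𝒟'(U)`. -/
def IsDivFreeOn (U : Set E3) (f : E3 → C3) : Prop :=
  ∀ φ : E3 → ℝ, IsTest U φ → ∫ y, ∑ i, (partialDeriv i φ y : ℂ) * f y i = 0

/-- `W^{1,2}_♯(Y)`: functions of `L²_♯(Y)` whose distributional partial derivatives on `ℝ³`
belong to `L²_♯(Y)`. -/
def MemW12per (ψ : E3 → ℂ) : Prop :=
  MemL2per ψ ∧ ∀ i : Fin 3, ∃ g : E3 → ℂ, MemL2per g ∧ HasWeakPartial univ i ψ g

/-- `W^{1,2}_♯(Σ*)`: restrictions to `Σ*` of functions of `W^{1,2}_♯(Y)`. Only the values of `ψ`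
on `Σ*` matter, up to null sets. -/
def MemW12perRestrict (S : Set E3) (ψ : E3 → ℂ) : Prop :=
  ∃ Ψ : E3 → ℂ, MemW12per Ψ ∧ ψ =ᵐ[volume.restrict (cellComplement S)] Ψ

/-- `u = ∇ψ + z` in `Σ*` with `ψ ∈ W^{1,2}_♯(Σ*)` and a constant vector `z`. -/
def IsCirculationSplitting (S : Set E3) (u : E3 → C3) (z : C3) (ψ : E3 → ℂ) : Prop :=
  MemW12perRestrict S ψ ∧
    ∀ i : Fin 3, HasWeakPartial (cellComplement S) i ψ (fun y => u y i - z i)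

open scoped Manifold ContDiff Topology ENNReal

/-! The vector ∮u is the period of a potential. If `u` were curl free on all of ℝ³, it would be ∇p,
and p(y + k) - p(y) would be a constant for each lattice vector k. These increments are additive in
k, hence of the form k·z, so ψ = p - z·y is periodic and ∮u = z. Everything therefore rests on
changing `u` inside the translates of Σ so that it becomes a periodic curl free field on ℝ³, leaving
it untouched on the periodic matrix (`IsInclusion.exists_hasGrad_univ`).

Since Σ* is simply connected, u = ∇ψ there (`exists_hasGrad_of_isSimplyConnected`): local potentials
come from mollification and the Poincaré inequality, and their constants are matched by a section of
a covering. Next, ψ is extended to the whole cell (`IsInclusion.exists_hasGrad_unitCell`). No bound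
on ψ up to the boundary of Σ is known at this stage, so it is not ψ but the square integrable 1-form
`u` that is reflected. Near a boundary point, the pullback of `u` by the folding onto the exterior
side is curl free (`IsHeight.curlFree_pullForm`), so it has a potential on a full ball, and on a
smaller ball this potential differs from ψ outside Σ by a constant (`IsHeight.exists_extension`). A
partition of unity glues these extensions, and the gradient of the result is copied into every
translate of Σ.

For (i), gradients of periodic functions are orthogonal to periodic divergence free fields
(`integral_unitCell_grad_mul_divFree`), and the change made inside Σ is invisible to fields that
vanish there. For (ii), p is mollified and the fundamental theorem of calculus is applied along the
curve, whose endpoints differ by a period (`HasGrad.eq_integral_path`). For (iii) and the uniqueness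
of z, Σ stays away from the faces of the cell, so some field η(y_j) e_k with j ≠ k vanishes on Σ and
has positive mean (`IsInclusion.exists_crossing_field`). Inserted in (i), it expresses z_k as a
weighted mean of u_k. The potential is unique up to a constant because Σ* is connected. -/

/-- Functions which are square integrable on the compact subsets of `U`. -/
def LocL2 (U : Set E3) (v : E3 → ℂ) : Prop :=
  ∀ K : Set E3, K ⊆ U → IsCompact K → MemLp v 2 (volume.restrict K)

/-- `∇ψ = g` in `𝒟'(U)`, with `ψ` and `g` locally square integrable in `U`. -/
structure HasGrad (U : Set E3) (ψ : E3 → ℂ) (g : Fin 3 → E3 → ℂ) : Prop where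
  locL2 : LocL2 U ψ
  grad_locL2 : ∀ i, LocL2 U (g i)
  weak : ∀ i, HasWeakPartial U i ψ (g i)

/-- `∂_i u_j = ∂_j u_i` in `𝒟'(U)`, for a field given by its components. -/
def CurlFree (U : Set E3) (u : Fin 3 → E3 → ℂ) : Prop :=
  ∀ i j : Fin 3, ∀ φ : E3 → ℝ, IsTest U φ →
    ∫ y, ((partialDeriv j φ y : ℂ) * u i y - (partialDeriv i φ y : ℂ) * u j y) = 0

/-! ### Test functions and localisation by partitions of unity. -/

section Test

lemma IsTest.mono {U V : Set E3} {φ : E3 → ℝ} (h : IsTest U φ) (hUV : U ⊆ V) : IsTest V φ :=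
  ⟨h.smooth, h.compact, h.support_subset.trans hUV⟩

lemma IsTest.continuous {U : Set E3} {φ : E3 → ℝ} (h : IsTest U φ) : Continuous φ :=
  h.smooth.continuous

lemma IsTest.differentiable {U : Set E3} {φ : E3 → ℝ} (h : IsTest U φ) : Differentiable ℝ φ :=
  h.smooth.differentiable (by simp)

lemma isTest_zero (U : Set E3) : IsTest U (fun _ => 0) :=
  ⟨contDiff_const, HasCompactSupport.zero, by
    have : tsupport (fun _ : E3 => (0 : ℝ)) = ∅ := by
      simp
    simp [this]⟩

lemma IsTest.add {U : Set E3} {φ χ : E3 → ℝ} (h : IsTest U φ) (h' : IsTest U χ) :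
    IsTest U (fun y => φ y + χ y) :=
  ⟨h.smooth.add h'.smooth, h.compact.add h'.compact,
    (tsupport_add φ χ).trans (union_subset h.support_subset h'.support_subset)⟩

lemma IsTest.mul_left {U V : Set E3} {φ χ : E3 → ℝ} (h : IsTest U φ) (hχ : ContDiff ℝ ∞ χ)
    (hV : tsupport χ ⊆ V) : IsTest (U ∩ V) (fun y => χ y * φ y) :=
  ⟨hχ.mul h.smooth, h.compact.mul_left,
    subset_inter ((tsupport_mul_subset_right (f := χ) (g := φ)).trans h.support_subset)
      ((tsupport_mul_subset_left (f := χ) (g := φ)).trans hV)⟩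

lemma contDiff_partialDeriv {φ : E3 → ℝ} (h : ContDiff ℝ ∞ φ) (i : Fin 3) :
    ContDiff ℝ ∞ (partialDeriv i φ) :=
  (h.fderiv_right (m := ∞) (by simp)).clm_apply contDiff_const

lemma tsupport_partialDeriv_subset (φ : E3 → ℝ) (i : Fin 3) :
    tsupport (partialDeriv i φ) ⊆ tsupport φ :=
  (closure_mono (fun y hy => by
    contrapose hy
    simp only [Function.mem_support, not_not] at hy
    simp [partialDeriv, hy])).trans (tsupport_fderiv_subset ℝ (f := φ))

lemma IsTest.partialDeriv {U : Set E3} {φ : E3 → ℝ} (h : IsTest U φ) (i : Fin 3) :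
    IsTest U (partialDeriv i φ) :=
  ⟨contDiff_partialDeriv h.smooth i,
    h.compact.of_isClosed_subset (isClosed_tsupport _) (tsupport_partialDeriv_subset φ i),
    (tsupport_partialDeriv_subset φ i).trans h.support_subset⟩

lemma partialDeriv_add {φ χ : E3 → ℝ} (h : Differentiable ℝ φ) (h' : Differentiable ℝ χ)
    (i : Fin 3) (y : E3) :
    partialDeriv i (fun y => φ y + χ y) y = partialDeriv i φ y + partialDeriv i χ y := by
  simp only [partialDeriv]
  rw [fderiv_fun_add (h y) (h' y)]; rfl

lemma partialDeriv_mul {φ χ : E3 → ℝ} (h : Differentiable ℝ φ) (h' : Differentiable ℝ χ)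
    (i : Fin 3) (y : E3) :
    partialDeriv i (fun y => φ y * χ y) y
      = φ y * partialDeriv i χ y + χ y * partialDeriv i φ y := by
  simp only [partialDeriv]
  rw [fderiv_fun_mul (h y) (h' y)]; rfl

lemma partialDeriv_comm {φ : E3 → ℝ} (h : ContDiff ℝ ∞ φ) (i j : Fin 3) (y : E3) :
    partialDeriv i (partialDeriv j φ) y = partialDeriv j (partialDeriv i φ) y := by
  have hd : DifferentiableAt ℝ (fderiv ℝ φ) y :=
    ((h.fderiv_right (m := ∞) (by simp)).differentiable (by simp)) y
  have key (a b : E3) : fderiv ℝ (fun z => fderiv ℝ φ z a) y b = fderiv ℝ (fderiv ℝ φ) y b a := by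
    rw [fderiv_clm_apply hd (differentiableAt_const a)]
    simp
  have hs : IsSymmSndFDerivAt ℝ φ y := (h.contDiffAt).isSymmSndFDerivAt
    (by simp only [minSmoothness_of_isRCLikeNormedField]; exact WithTop.coe_le_coe.2 (le_top (a := (2 : ℕ∞))))
  change fderiv ℝ (fun z => fderiv ℝ φ z _) y _ = fderiv ℝ (fun z => fderiv ℝ φ z _) y _
  rw [key, key]
  exact hs _ _

/-- A linear functional on `C_c^∞(U)` which vanishes locally vanishes. -/
theorem IsTest.eq_zero_of_local {U : Set E3} {T : (E3 → ℝ) → ℂ}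
    (hadd : ∀ φ χ, IsTest U φ → IsTest U χ → T (fun y => φ y + χ y) = T φ + T χ)
    (hloc : ∀ x ∈ U, ∃ V, IsOpen V ∧ x ∈ V ∧ ∀ φ, IsTest (U ∩ V) φ → T φ = 0)
    {φ : E3 → ℝ} (hφ : IsTest U φ) : T φ = 0 := by
  choose! V hVo hVx hV using hloc
  have h0 : T (fun _ => 0) = 0 := by
    have := hadd _ _ (isTest_zero U) (isTest_zero U)
    simpa using this
  -- Only finitely many members of the partition meet the compact support of `φ`, so additivity of
  -- `T` suffices and no continuity is needed.
  obtain ⟨f, hf⟩ := SmoothPartitionOfUnity.exists_isSubordinate 𝓘(ℝ, E3)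
    (isClosed_tsupport φ) (fun x : U => V x) (fun x => hVo x x.2)
    (fun y hy => mem_iUnion.2 ⟨⟨y, hφ.support_subset hy⟩, hVx y (hφ.support_subset hy)⟩)
  have hfin := f.locallyFinite.finite_nonempty_inter_compact hφ.compact
  set I := hfin.toFinset with hI
  have hsm (i : U) : ContDiff ℝ ∞ (f i) := (f i).contMDiff.contDiff
  have hsum : φ = fun y => ∑ i ∈ I, f i y * φ y := by
    funext y
    by_cases hy : y ∈ tsupport φ
    · have h1 : ∑ᶠ i, f i y = 1 := f.sum_eq_one hy
      rw [finsum_eq_sum_of_support_subset (s := I)] at h1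
      · rw [← Finset.sum_mul, h1, one_mul]
      · intro i hi
        rw [hI, Finset.mem_coe, Set.Finite.mem_toFinset]
        exact ⟨y, hi, hy⟩
    · simp [image_eq_zero_of_notMem_tsupport hy]
  have htest (i : U) : IsTest (U ∩ V i) (fun y => f i y * φ y) :=
    hφ.mul_left (hsm i) (hf i)
  have main : ∀ J : Finset U, IsTest U (fun y => ∑ i ∈ J, f i y * φ y) ∧
      T (fun y => ∑ i ∈ J, f i y * φ y) = 0 := by
    classical
    intro J
    induction J using Finset.induction_on with
    | empty => simpa using ⟨isTest_zero U, h0⟩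
    | insert a J ha ih =>
      simp only [Finset.sum_insert ha]
      have ht := (htest a).mono inter_subset_left
      refine ⟨ht.add ih.1, ?_⟩
      rw [hadd _ _ ht ih.1, ih.2, hV a a.2 _ (htest a), add_zero]
  rw [hsum]
  exact (main I).2

end Test

/-! ### Locally square integrable functions. -/

section LocL2

lemma LocL2.mono {U V : Set E3} {v : E3 → ℂ} (h : LocL2 V v) (hUV : U ⊆ V) : LocL2 U v :=
  fun K hK hc => h K (hK.trans hUV) hc

lemma memLp_restrict_union {s t : Set E3} {v : E3 → ℂ} (hs : MemLp v 2 (volume.restrict s))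
    (ht : MemLp v 2 (volume.restrict t)) : MemLp v 2 (volume.restrict (s ∪ t)) := by
  refine MemLp.mono_measure (Measure.restrict_union_le s t) ?_
  have hm : AEStronglyMeasurable v (volume.restrict s + volume.restrict t) :=
    hs.1.add_measure ht.1
  rw [memLp_two_iff_integrable_sq_norm hm]
  exact ((memLp_two_iff_integrable_sq_norm hs.1).1 hs).add_measure
    ((memLp_two_iff_integrable_sq_norm ht.1).1 ht)

/-- Local square integrability is a local property. -/
lemma LocL2.of_local {U : Set E3} {v : E3 → ℂ}
    (h : ∀ x ∈ U, ∃ V, IsOpen V ∧ x ∈ V ∧ LocL2 (U ∩ V) v) : LocL2 U v := by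
  intro K hK hc
  refine hc.induction_on (p := fun s => MemLp v 2 (volume.restrict (s ∩ K))) ?_ ?_ ?_ ?_ |>.mono_measure
    (by rw [inter_self])
  · simp
  · intro s t hst ht
    exact ht.mono_measure (Measure.restrict_mono (inter_subset_inter_left _ hst) le_rfl)
  · intro s t hs ht
    rw [union_inter_distrib_right]
    exact memLp_restrict_union hs ht
  · intro x hx
    obtain ⟨V, hVo, hxV, hV⟩ := h x (hK hx)
    obtain ⟨r, hr, hrV⟩ := Metric.nhds_basis_closedBall.mem_iff.1 (hVo.mem_nhds hxV)
    refine ⟨Metric.closedBall x r, mem_nhdsWithin_of_mem_nhds (Metric.closedBall_mem_nhds x hr), ?_⟩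
    refine hV _ ?_ ((isCompact_closedBall x r).inter_right hc.isClosed)
    exact fun y hy => ⟨hK hy.2, hrV hy.1⟩

lemma LocL2.congr {U : Set E3} {v w : E3 → ℂ} (h : LocL2 U v)
    (hvw : v =ᵐ[volume.restrict U] w) : LocL2 U w := fun K hK hc =>
  (h K hK hc).ae_eq (ae_restrict_of_ae_restrict_of_subset hK hvw)

lemma LocL2.add {U : Set E3} {v w : E3 → ℂ} (h : LocL2 U v) (h' : LocL2 U w) :
    LocL2 U (fun y => v y + w y) := fun K hK hc => (h K hK hc).add (h' K hK hc)

lemma LocL2.sub {U : Set E3} {v w : E3 → ℂ} (h : LocL2 U v) (h' : LocL2 U w) :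
    LocL2 U (fun y => v y - w y) := fun K hK hc => (h K hK hc).sub (h' K hK hc)

lemma LocL2.of_continuous {U : Set E3} {v : E3 → ℂ} (h : Continuous v) : LocL2 U v := by
  intro K _ hc
  have : IsFiniteMeasure (volume.restrict K) :=
    ⟨by rw [Measure.restrict_apply_univ]; exact hc.measure_lt_top⟩
  obtain ⟨C, hC⟩ := (hc.image h).isBounded.exists_norm_le
  refine MemLp.of_bound h.aestronglyMeasurable C ?_
  filter_upwards [ae_restrict_mem hc.measurableSet] with y hy
  exact hC _ (mem_image_of_mem _ hy)

lemma LocL2.mul_continuous {U : Set E3} {v : E3 → ℂ} (h : LocL2 U v) {χ : E3 → ℝ}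
    (hχ : Continuous χ) : LocL2 U (fun y => (χ y : ℂ) * v y) := by
  intro K hK hc
  obtain ⟨C, hC⟩ := (hc.image hχ).isBounded.exists_norm_le
  refine (h K hK hc).of_le_mul (c := C)
    ((Complex.continuous_ofReal.comp hχ).aestronglyMeasurable.mul (h K hK hc).1) ?_
  filter_upwards [ae_restrict_mem hc.measurableSet] with y hy
  rw [norm_mul, Complex.norm_real]
  exact mul_le_mul_of_nonneg_right (hC _ (mem_image_of_mem _ hy)) (norm_nonneg _)

lemma LocL2.integrableOn {U : Set E3} {v : E3 → ℂ} (h : LocL2 U v) {K : Set E3} (hK : K ⊆ U)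
    (hc : IsCompact K) : IntegrableOn v K := by
  have : IsFiniteMeasure (volume.restrict K) :=
    ⟨by rw [Measure.restrict_apply_univ]; exact hc.measure_lt_top⟩
  exact (h K hK hc).integrable (by norm_num)

lemma LocL2.integrable_mul {U : Set E3} {v : E3 → ℂ} (h : LocL2 U v) {φ : E3 → ℝ}
    (hφ : Continuous φ) (hc : HasCompactSupport φ) (hs : tsupport φ ⊆ U) :
    Integrable (fun y => (φ y : ℂ) * v y) := by
  have h1 : IntegrableOn (fun y => (φ y : ℂ) * v y) (tsupport φ) :=
    (h.mul_continuous hφ).integrableOn hs hc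
  refine (integrableOn_iff_integrable_of_support_subset ?_).1 h1
  intro y hy
  by_contra hn
  simp [image_eq_zero_of_notMem_tsupport hn] at hy

lemma LocL2.integrable_test {U : Set E3} {v : E3 → ℂ} (h : LocL2 U v) {φ : E3 → ℝ}
    (hφ : IsTest U φ) : Integrable (fun y => (φ y : ℂ) * v y) :=
  h.integrable_mul hφ.continuous hφ.compact hφ.support_subset

lemma LocL2.locallyIntegrable {v : E3 → ℂ} (h : LocL2 univ v) : LocallyIntegrable v :=
  locallyIntegrable_iff.2 fun _ hK => h.integrableOn (subset_univ _) hK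

lemma LocL2.locallyIntegrableOn {U : Set E3} (hU : IsOpen U) {v : E3 → ℂ} (h : LocL2 U v) :
    LocallyIntegrableOn v U :=
  (locallyIntegrableOn_iff hU.isLocallyClosed).2 fun _ hK hc => h.integrableOn hK hc

end LocL2

/-! ### Calculus of weak gradients and curl free fields. -/

section HasGrad

variable {U V : Set E3} {ψ ψ' : E3 → ℂ} {g g' : Fin 3 → E3 → ℂ}

lemma HasGrad.mono (h : HasGrad V ψ g) (hUV : U ⊆ V) : HasGrad U ψ g :=
  ⟨h.locL2.mono hUV, fun i => (h.grad_locL2 i).mono hUV, fun i φ hφ => h.weak i φ (hφ.mono hUV)⟩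

/-- A product with a test function only depends on the values in `U` up to null sets. -/
lemma integral_mul_congr {φ : E3 → ℝ} (hs : tsupport φ ⊆ U) (hU : IsOpen U) {v w : E3 → ℂ}
    (h : v =ᵐ[volume.restrict U] w) :
    ∫ y, (φ y : ℂ) * v y = ∫ y, (φ y : ℂ) * w y := by
  refine integral_congr_ae ?_
  filter_upwards [(ae_restrict_iff' hU.measurableSet).1 h] with y hy
  by_cases hyU : y ∈ U
  · rw [hy hyU]
  · rw [image_eq_zero_of_notMem_tsupport (fun h => hyU (hs h))]; simp

lemma HasWeakPartial.congr (hU : IsOpen U) {i : Fin 3} {v w : E3 → ℂ}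
    (h : HasWeakPartial U i ψ v) (h1 : ψ =ᵐ[volume.restrict U] ψ')
    (h2 : v =ᵐ[volume.restrict U] w) : HasWeakPartial U i ψ' w := fun φ hφ => by
  rw [← integral_mul_congr (hφ.partialDeriv i).support_subset hU h1,
    ← integral_mul_congr hφ.support_subset hU h2]
  exact h φ hφ

lemma HasGrad.congr (hU : IsOpen U) (h : HasGrad U ψ g) (h1 : ψ =ᵐ[volume.restrict U] ψ')
    (h2 : ∀ i, g i =ᵐ[volume.restrict U] g' i) : HasGrad U ψ' g' :=
  ⟨h.locL2.congr h1, fun i => (h.grad_locL2 i).congr (h2 i),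
    fun i => (h.weak i).congr hU h1 (h2 i)⟩

lemma HasGrad.add (h : HasGrad U ψ g) (h' : HasGrad U ψ' g') :
    HasGrad U (fun y => ψ y + ψ' y) (fun i y => g i y + g' i y) := by
  refine ⟨h.locL2.add h'.locL2, fun i => (h.grad_locL2 i).add (h'.grad_locL2 i),
    fun i φ hφ => ?_⟩
  simp only [mul_add]
  rw [integral_add (h.locL2.integrable_test (hφ.partialDeriv i))
    (h'.locL2.integrable_test (hφ.partialDeriv i)), h.weak i φ hφ, h'.weak i φ hφ,
    integral_add ((h.grad_locL2 i).integrable_test hφ) ((h'.grad_locL2 i).integrable_test hφ)]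
  ring

lemma HasGrad.sub (h : HasGrad U ψ g) (h' : HasGrad U ψ' g') :
    HasGrad U (fun y => ψ y - ψ' y) (fun i y => g i y - g' i y) := by
  refine ⟨h.locL2.sub h'.locL2, fun i => (h.grad_locL2 i).sub (h'.grad_locL2 i),
    fun i φ hφ => ?_⟩
  simp only [mul_sub]
  rw [integral_sub (h.locL2.integrable_test (hφ.partialDeriv i))
    (h'.locL2.integrable_test (hφ.partialDeriv i)), h.weak i φ hφ, h'.weak i φ hφ,
    integral_sub ((h.grad_locL2 i).integrable_test hφ) ((h'.grad_locL2 i).integrable_test hφ)]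
  ring

lemma HasGrad.zero (U : Set E3) : HasGrad U (fun _ => 0) (fun _ _ => 0) :=
  ⟨LocL2.of_continuous continuous_const, fun _ => LocL2.of_continuous continuous_const,
    fun i φ _ => by simp⟩

/-- The defect ∫ ∂ᵢφ ψ + ∫ φ gᵢ is additive in the test function, so it vanishes once it vanishes
locally. Local square integrability is settled first because additivity needs convergent integrals.
-/
lemma HasGrad.of_local
    (h : ∀ x ∈ U, ∃ V, IsOpen V ∧ x ∈ V ∧ HasGrad (U ∩ V) ψ g) : HasGrad U ψ g := by
  have hψ : LocL2 U ψ := LocL2.of_local fun x hx => by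
    obtain ⟨V, h1, h2, h3⟩ := h x hx
    exact ⟨V, h1, h2, h3.locL2⟩
  have hg (i : Fin 3) : LocL2 U (g i) := LocL2.of_local fun x hx => by
    obtain ⟨V, h1, h2, h3⟩ := h x hx
    exact ⟨V, h1, h2, h3.grad_locL2 i⟩
  refine ⟨hψ, hg, fun i φ hφ => ?_⟩
  rw [eq_neg_iff_add_eq_zero]
  refine IsTest.eq_zero_of_local (T := fun φ => (∫ y, (partialDeriv i φ y : ℂ) * ψ y)
    + ∫ y, (φ y : ℂ) * g i y) ?_ ?_ hφ
  · intro φ χ hφ hχ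
    simp only [partialDeriv_add hφ.differentiable hχ.differentiable, Complex.ofReal_add, add_mul]
    rw [integral_add (hψ.integrable_test (hφ.partialDeriv i))
      (hψ.integrable_test (hχ.partialDeriv i)),
      integral_add ((hg i).integrable_test hφ) ((hg i).integrable_test hχ)]
    ring
  · intro x hx
    obtain ⟨V, h1, h2, h3⟩ := h x hx
    refine ⟨V, h1, h2, fun φ hφ => ?_⟩
    rw [h3.weak i φ hφ]; ring

lemma CurlFree.mono {u : Fin 3 → E3 → ℂ} (h : CurlFree V u) (hUV : U ⊆ V) : CurlFree U u :=
  fun i j φ hφ => h i j φ (hφ.mono hUV)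

lemma CurlFree.congr (hU : IsOpen U) {u u' : Fin 3 → E3 → ℂ} (h : CurlFree U u)
    (hl : ∀ i, LocL2 U (u i)) (h2 : ∀ i, u i =ᵐ[volume.restrict U] u' i) : CurlFree U u' := by
  intro i j φ hφ
  have hl' i : LocL2 U (u' i) := (hl i).congr (h2 i)
  have := h i j φ hφ
  rw [integral_sub ((hl i).integrable_test (hφ.partialDeriv j))
    ((hl j).integrable_test (hφ.partialDeriv i)),
    integral_mul_congr (hφ.partialDeriv j).support_subset hU (h2 i),
    integral_mul_congr (hφ.partialDeriv i).support_subset hU (h2 j)] at this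
  rwa [integral_sub ((hl' i).integrable_test (hφ.partialDeriv j))
    ((hl' j).integrable_test (hφ.partialDeriv i))]

lemma CurlFree.of_local {u : Fin 3 → E3 → ℂ} (hu : ∀ i, LocL2 U (u i))
    (h : ∀ x ∈ U, ∃ V, IsOpen V ∧ x ∈ V ∧ CurlFree (U ∩ V) u) : CurlFree U u := by
  intro i j φ hφ
  refine IsTest.eq_zero_of_local (T := fun φ => ∫ y, ((partialDeriv j φ y : ℂ) * u i y -
    (partialDeriv i φ y : ℂ) * u j y)) ?_ ?_ hφ
  · intro φ χ hφ hχ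
    have hint {φ : E3 → ℝ} (hφ : IsTest U φ) : Integrable
        (fun y => ((partialDeriv j φ y : ℂ) * u i y - (partialDeriv i φ y : ℂ) * u j y)) :=
      ((hu i).integrable_test (hφ.partialDeriv j)).sub ((hu j).integrable_test (hφ.partialDeriv i))
    rw [← integral_add (hint hφ) (hint hχ)]
    refine integral_congr_ae (.of_forall fun y => ?_)
    simp only [partialDeriv_add hφ.differentiable hχ.differentiable, Complex.ofReal_add]
    ring
  · intro x hx
    obtain ⟨V, h1, h2, h3⟩ := h x hx
    exact ⟨V, h1, h2, fun φ hφ => h3 i j φ hφ⟩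

/-- Test the i-th weak derivative with ∂ⱼφ and the j-th with ∂ᵢφ; second derivatives of φ commute.
-/
lemma HasGrad.curlFree (h : HasGrad U ψ g) : CurlFree U g := by
  intro i j φ hφ
  rw [integral_sub ((h.grad_locL2 i).integrable_test (hφ.partialDeriv j))
    ((h.grad_locL2 j).integrable_test (hφ.partialDeriv i)), sub_eq_zero]
  have h1 := h.weak i _ (hφ.partialDeriv j)
  have h2 := h.weak j _ (hφ.partialDeriv i)
  simp only [partialDeriv_comm hφ.smooth i j] at h1
  rw [h1] at h2
  exact neg_inj.1 h2

/-- The product rule is applied to the smooth function χφ, which is then used to test ψ. -/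
lemma HasGrad.smul {χ : E3 → ℝ} (h : HasGrad U ψ g) (hχ : ContDiff ℝ ∞ χ) :
    HasGrad U (fun y => (χ y : ℂ) * ψ y)
      (fun i y => (χ y : ℂ) * g i y + (partialDeriv i χ y : ℂ) * ψ y) := by
  have hp i := (contDiff_partialDeriv hχ i).continuous
  refine ⟨h.locL2.mul_continuous hχ.continuous, fun i =>
    ((h.grad_locL2 i).mul_continuous hχ.continuous).add (h.locL2.mul_continuous (hp i)),
    fun i φ hφ => ?_⟩
  have ht : IsTest U (fun y => χ y * φ y) :=
    (hφ.mul_left hχ (subset_univ _)).mono inter_subset_left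
  have hw := h.weak i _ ht
  have hd := hχ.differentiable (by simp)
  have i1 := (h.grad_locL2 i).integrable_test ht
  have i2 := (h.locL2.mul_continuous (hp i)).integrable_test hφ
  have i3 := (h.locL2.mul_continuous hχ.continuous).integrable_test (hφ.partialDeriv i)
  have e1 : ∫ y, ((partialDeriv i (fun y => χ y * φ y) y : ℝ) : ℂ) * ψ y
      = (∫ y, (partialDeriv i φ y : ℂ) * ((χ y : ℂ) * ψ y))
        + ∫ y, (φ y : ℂ) * ((partialDeriv i χ y : ℂ) * ψ y) := by
    rw [← integral_add i3 i2]
    refine integral_congr_ae (.of_forall fun y => ?_)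
    simp only [partialDeriv_mul hd hφ.differentiable, Complex.ofReal_add, Complex.ofReal_mul]
    ring
  have e2 : ∫ y, (φ y : ℂ) * ((χ y : ℂ) * g i y + (partialDeriv i χ y : ℂ) * ψ y)
      = (∫ y, ((χ y * φ y : ℝ) : ℂ) * g i y)
        + ∫ y, (φ y : ℂ) * ((partialDeriv i χ y : ℂ) * ψ y) := by
    rw [← integral_add i1 i2]
    refine integral_congr_ae (.of_forall fun y => ?_)
    simp only [Complex.ofReal_mul]
    ring
  rw [e2]
  rw [e1] at hw
  linear_combination hw

/-- Weak gradients are unique. -/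
lemma HasGrad.ae_eq (hU : IsOpen U) (h : HasGrad U ψ g) (h' : HasGrad U ψ' g')
    (hψ : ψ =ᵐ[volume.restrict U] ψ') (i : Fin 3) : g i =ᵐ[volume.restrict U] g' i := by
  have h'' : HasGrad U ψ g' := h'.congr hU hψ.symm fun i => Filter.EventuallyEq.rfl
  have hl := (h.grad_locL2 i).sub (h'.grad_locL2 i)
  have := hU.ae_eq_zero_of_integral_contDiff_smul_eq_zero (hl.locallyIntegrableOn hU)
    (fun φ h1 h2 h3 => by
      have hφ : IsTest U φ := ⟨h1, h2, h3⟩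
      simp only [Complex.real_smul, mul_sub]
      rw [integral_sub ((h.grad_locL2 i).integrable_test hφ)
        ((h'.grad_locL2 i).integrable_test hφ), sub_eq_zero]
      have := (h.weak i φ hφ).symm.trans (h''.weak i φ hφ)
      exact neg_inj.1 this)
  rw [Filter.EventuallyEq, ae_restrict_iff' hU.measurableSet]
  filter_upwards [this] with y hy hyU
  exact sub_eq_zero.1 (hy hyU)

end HasGrad

/-! ### Cauchy–Schwarz inequalities for the Lebesgue integral. -/

section CauchySchwarz

variable {α : Type*} [MeasurableSpace α] {μ : Measure α}

lemma eLpNorm_two_sq {F : Type*} [NormedAddCommGroup F] (f : α → F) (μ : Measure α) :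
    eLpNorm f 2 μ ^ 2 = ∫⁻ x, ‖f x‖ₑ ^ 2 ∂μ := by
  rw [eLpNorm_eq_lintegral_rpow_enorm_toReal (by simp) (by simp), ← ENNReal.rpow_natCast,
    ← ENNReal.rpow_mul]
  simp

lemma lintegral_sq_le {f : α → ℝ≥0∞} (hf : AEMeasurable f μ) :
    (∫⁻ x, f x ∂μ) ^ 2 ≤ μ univ * ∫⁻ x, f x ^ 2 ∂μ := by
  have h := ENNReal.lintegral_mul_le_Lp_mul_Lq μ (p := 2) (q := 2)
    (Real.HolderConjugate.two_two) hf (aemeasurable_const (b := (1 : ℝ≥0∞)))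
  simp only [Pi.mul_apply, mul_one, ENNReal.rpow_two, one_pow, lintegral_one] at h
  calc (∫⁻ x, f x ∂μ) ^ 2 ≤ ((∫⁻ x, f x ^ 2 ∂μ) ^ (1 / 2 : ℝ) * μ univ ^ (1 / 2 : ℝ)) ^ 2 := by
        gcongr
    _ = μ univ * ∫⁻ x, f x ^ 2 ∂μ := by
        rw [mul_pow, ← ENNReal.rpow_natCast, ← ENNReal.rpow_natCast, ← ENNReal.rpow_mul,
          ← ENNReal.rpow_mul]
        norm_num [mul_comm]

/-- This is Cauchy–Schwarz for the measure with density `a`. When `a` is a probability density it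
becomes Jensen's inequality for the square. -/
lemma lintegral_mul_sq_le {a f : α → ℝ≥0∞} (ha : AEMeasurable a μ) (hf : AEMeasurable f μ) :
    (∫⁻ x, a x * f x ∂μ) ^ 2 ≤ (∫⁻ x, a x ∂μ) * ∫⁻ x, a x * f x ^ 2 ∂μ := by
  have h := lintegral_sq_le (μ := μ.withDensity a) (hf.mono_ac (withDensity_absolutelyContinuous _ _))
  rw [lintegral_withDensity_eq_lintegral_mul₀ ha hf,
    lintegral_withDensity_eq_lintegral_mul₀ ha (hf.pow_const 2), withDensity_apply _ .univ] at h
  simpa using h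

end CauchySchwarz

/-! ### Mollifiers and derivatives of mollified functions. -/

section Mollifier

/-- A smooth probability density supported in the closed ball of centre `c` and radius `r`. -/
structure IsMollifier (c : E3) (r : ℝ) (θ : E3 → ℝ) : Prop where
  smooth : ContDiff ℝ ∞ θ
  nonneg : ∀ y, 0 ≤ θ y
  integral_eq : ∫ y, θ y = 1
  tsupport_subset : tsupport θ ⊆ Metric.closedBall c r

lemma exists_isMollifier (c : E3) {r : ℝ} (hr : 0 < r) : ∃ θ, IsMollifier c r θ := by
  let b : ContDiffBump c := ⟨r / 2, r, by positivity, by linarith⟩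
  exact ⟨b.normed volume, b.contDiff_normed, b.nonneg_normed, b.integral_normed,
    b.tsupport_normed_eq.subset⟩

variable {c : E3} {r : ℝ} {θ : E3 → ℝ} {v : E3 → ℂ}

lemma IsMollifier.compact (h : IsMollifier c r θ) : HasCompactSupport θ :=
  (isCompact_closedBall c r).of_isClosed_subset (isClosed_tsupport θ) h.tsupport_subset

lemma IsMollifier.eq_zero (h : IsMollifier c r θ) {y : E3} (hy : r < dist y c) : θ y = 0 :=
  image_eq_zero_of_notMem_tsupport fun hn => not_le.2 hy (h.tsupport_subset hn)

lemma IsMollifier.mono (h : IsMollifier c r θ) {c' : E3} {r' : ℝ}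
    (hs : Metric.closedBall c r ⊆ Metric.closedBall c' r') : IsMollifier c' r' θ :=
  ⟨h.smooth, h.nonneg, h.integral_eq, h.tsupport_subset.trans hs⟩

lemma IsMollifier.integrable (h : IsMollifier c r θ) : Integrable θ :=
  h.smooth.continuous.integrable_of_hasCompactSupport h.compact

lemma IsMollifier.lintegral_eq (h : IsMollifier c r θ) : ∫⁻ y, ENNReal.ofReal (θ y) = 1 := by
  rw [← ofReal_integral_eq_lintegral_ofReal h.integrable (.of_forall h.nonneg), h.integral_eq,
    ENNReal.ofReal_one]

/-- The convolution `θ ⋆ v`. -/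
noncomputable def mollify (θ : E3 → ℝ) (v : E3 → ℂ) : E3 → ℂ :=
  convolution θ v (ContinuousLinearMap.lsmul ℝ ℝ) volume

lemma mollify_apply (θ : E3 → ℝ) (v : E3 → ℂ) (y : E3) :
    mollify θ v y = ∫ w, (θ (y - w) : ℂ) * v w := by
  rw [mollify, convolution_eq_swap]
  simp

lemma mollify_apply' (θ : E3 → ℝ) (v : E3 → ℂ) (y : E3) :
    mollify θ v y = ∫ w, (θ w : ℂ) * v (y - w) := by
  simp [mollify, convolution]

lemma contDiff_mollify (hθ : ContDiff ℝ ∞ θ) (hc : HasCompactSupport θ)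
    (hv : LocallyIntegrable v) : ContDiff ℝ ∞ (mollify θ v) :=
  hc.contDiff_convolution_left _ hθ hv

lemma fderiv_mollify (hθ : ContDiff ℝ ∞ θ) (hc : HasCompactSupport θ)
    (hv : LocallyIntegrable v) (i : Fin 3) (y : E3) :
    fderiv ℝ (mollify θ v) y (EuclideanSpace.single i 1)
      = ∫ w, (partialDeriv i θ (y - w) : ℂ) * v w := by
  have h := (hc.hasFDerivAt_convolution_left (ContinuousLinearMap.lsmul ℝ ℝ)
    (hθ.of_le (by simp)) hv y).fderiv
  rw [mollify, h, convolution_eq_swap]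
  have hce := (hc.fderiv (𝕜 := ℝ)).convolutionExists_left
    ((ContinuousLinearMap.lsmul ℝ ℝ : ℝ →L[ℝ] ℂ →L[ℝ] ℂ).precompL E3)
    (hθ.continuous_fderiv (by simp)) hv y
  rw [ContinuousLinearMap.integral_apply hce.integrable_swap]
  refine integral_congr_ae (.of_forall fun w => ?_)
  simp [partialDeriv]

lemma integrable_mollify (hθ : Continuous θ) (hc : HasCompactSupport θ)
    (hv : LocallyIntegrable v) (y : E3) : Integrable fun w => (θ w : ℂ) * v (y - w) := by
  have := hc.convolutionExists_left (ContinuousLinearMap.lsmul ℝ ℝ) hθ hv y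
  simpa [ConvolutionExistsAt] using this

lemma integrable_mollify_swap (hθ : Continuous θ) (hc : HasCompactSupport θ)
    (hv : LocallyIntegrable v) (y : E3) : Integrable fun w => (θ (y - w) : ℂ) * v w := by
  have := (hc.convolutionExists_left (ContinuousLinearMap.lsmul ℝ ℝ) hθ hv y).integrable_swap
  simpa using this

/-- The reflected translate `w ↦ θ (y - w)`, against which mollification integrates. -/
lemma partialDeriv_reflect (hθ : ContDiff ℝ ∞ θ) (i : Fin 3) (y w : E3) :
    partialDeriv i (fun w => θ (y - w)) w = - partialDeriv i θ (y - w) := by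
  have h1 : HasFDerivAt θ (fderiv ℝ θ (y - w)) (y - w) :=
    ((hθ.differentiable (by simp)) _).hasFDerivAt
  have h2 : HasFDerivAt (fun w : E3 => y - w) (-(ContinuousLinearMap.id ℝ E3)) w :=
    (hasFDerivAt_id w).const_sub y
  have := (h1.comp w h2).fderiv
  simp only [partialDeriv]
  change fderiv ℝ (θ ∘ fun w => y - w) w _ = _
  rw [this]; simp

lemma tsupport_reflect (θ : E3 → ℝ) (y : E3) :
    tsupport (fun w => θ (y - w)) = (fun w => y - w) ⁻¹' tsupport θ :=
  tsupport_comp_eq_preimage θ (Homeomorph.subLeft y)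

lemma isTest_reflect (hθ : ContDiff ℝ ∞ θ) (hc : HasCompactSupport θ) {U : Set E3} {y : E3}
    (hU : ∀ w, y - w ∈ tsupport θ → w ∈ U) : IsTest U (fun w => θ (y - w)) :=
  ⟨hθ.comp (contDiff_const.sub contDiff_id), hc.comp_homeomorph (Homeomorph.subLeft y), by
    rw [tsupport_reflect]; exact fun w hw => hU w hw⟩

/-- Mollification only sees the values near the point. -/
lemma mollify_congr {v' : E3 → ℂ} {y : E3} (h : ∀ w, y - w ∈ tsupport θ → v w = v' w) :
    mollify θ v y = mollify θ v' y := by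
  simp only [mollify_apply]
  refine integral_congr_ae (.of_forall fun w => ?_)
  by_cases hw : y - w ∈ tsupport θ
  · simp only [h w hw]
  · simp [image_eq_zero_of_notMem_tsupport hw]

/-- The derivative falls on the kernel, and w ↦ θ(y - w) is an admissible test function when its
support lies in `U`. Only the values of `v` on that support matter, so `v` may be a truncation of
`ψ` that is integrable on all of ℝ³. -/
lemma fderiv_mollify_of_hasWeakPartial (hθ : ContDiff ℝ ∞ θ) (hc : HasCompactSupport θ)
    (hv : LocallyIntegrable v) {U : Set E3} {ψ g : E3 → ℂ} {i : Fin 3} {y : E3}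
    (h : HasWeakPartial U i ψ g) (hU : ∀ w, y - w ∈ tsupport θ → w ∈ U)
    (hvψ : ∀ w, y - w ∈ tsupport θ → v w = ψ w) :
    fderiv ℝ (mollify θ v) y (EuclideanSpace.single i 1) = mollify θ g y := by
  have := h _ (isTest_reflect hθ hc hU)
  rw [fderiv_mollify hθ hc hv, mollify_apply]
  simp only [partialDeriv_reflect hθ, Complex.ofReal_neg, neg_mul, integral_neg, neg_inj] at this
  rw [← this]
  refine integral_congr_ae (.of_forall fun w => ?_)
  by_cases hw : y - w ∈ tsupport θ
  · simp only [hvψ w hw]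
  · have hw' : y - w ∉ tsupport (partialDeriv i θ) :=
      fun hn => hw (tsupport_partialDeriv_subset θ i hn)
    simp [image_eq_zero_of_notMem_tsupport hw']

lemma fderiv_mollify_curlFree (hθ : ContDiff ℝ ∞ θ) (hc : HasCompactSupport θ)
    {u v : Fin 3 → E3 → ℂ} (hv : ∀ i, LocallyIntegrable (v i)) {U : Set E3} {y : E3}
    (h : CurlFree U u) (hU : ∀ w, y - w ∈ tsupport θ → w ∈ U)
    (hvu : ∀ i w, y - w ∈ tsupport θ → v i w = u i w) (i j : Fin 3) :
    fderiv ℝ (mollify θ (v i)) y (EuclideanSpace.single j 1)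
      = fderiv ℝ (mollify θ (v j)) y (EuclideanSpace.single i 1) := by
  have := h i j _ (isTest_reflect hθ hc hU)
  rw [fderiv_mollify hθ hc (hv i), fderiv_mollify hθ hc (hv j), ← sub_eq_zero]
  have hp (k : Fin 3) : Continuous (partialDeriv k θ) := (contDiff_partialDeriv hθ k).continuous
  have hpc (k : Fin 3) : HasCompactSupport (partialDeriv k θ) :=
    hc.of_isClosed_subset (isClosed_tsupport _) (tsupport_partialDeriv_subset θ k)
  rw [← integral_sub (integrable_mollify_swap (hp j) (hpc j) (hv i) y)
    (integrable_mollify_swap (hp i) (hpc i) (hv j) y)]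
  rw [← neg_eq_zero, ← integral_neg] at this
  rw [← this]
  refine integral_congr_ae (.of_forall fun w => ?_)
  by_cases hw : y - w ∈ tsupport θ
  · simp only [hvu _ w hw, partialDeriv_reflect hθ, Complex.ofReal_neg]; ring
  · have hw' k : y - w ∉ tsupport (partialDeriv k θ) :=
      fun hn => hw (tsupport_partialDeriv_subset θ k hn)
    simp [partialDeriv_reflect hθ, image_eq_zero_of_notMem_tsupport (hw' _)]

end Mollifier

/-! ### Convergence of mollifications in L². -/

section Approximation

lemma measurePreserving_sub (w : E3) :
    MeasurePreserving (fun y : E3 => y - w) volume volume :=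
  measurePreserving_sub_right volume w

/-- Translations act continuously on `L²`. -/
lemma exists_eLpNorm_translate_sub_le {v : E3 → ℂ} (hv : MemLp v 2) {ε : ℝ≥0∞} (hε : ε ≠ 0) :
    ∃ δ > 0, ∀ w : E3, ‖w‖ ≤ δ → eLpNorm (fun y => v (y - w) - v y) 2 volume ≤ ε := by
  -- By currying, translations depend continuously on `w` in the compact-open topology, which is
  -- what continuity of composition on L² requires.
  let g : E3 → C(E3, E3) := fun w => ⟨fun y => y - w, by fun_prop⟩
  have hg : Continuous g := by
    have : Continuous fun p : E3 × E3 => p.2 - p.1 := by fun_prop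
    exact (ContinuousMap.curry ⟨_, this⟩).continuous
  have hmp (w : E3) : MeasurePreserving (g w) volume volume := measurePreserving_sub w
  have hcont := Continuous.compMeasurePreservingLp (f := fun _ : E3 => hv.toLp v) (p := 2)
    continuous_const hg hmp (by simp)
  have h0 := Metric.continuous_iff'.1 hcont 0
  obtain ⟨ε', hε'0, hε'⟩ : ∃ ε' : ℝ, 0 < ε' ∧ ENNReal.ofReal ε' ≤ ε := by
    by_cases ht : ε = ⊤
    · exact ⟨1, one_pos, by simp [ht]⟩
    · exact ⟨ε.toReal, ENNReal.toReal_pos hε ht, by rw [ENNReal.ofReal_toReal ht]⟩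
  obtain ⟨δ, hδ, h⟩ := Metric.eventually_nhds_iff.1 (h0 ε' hε'0)
  refine ⟨δ / 2, by positivity, fun w hw => ?_⟩
  have hd := h (y := w) (by rw [dist_zero_right]; linarith)
  refine le_trans ?_ hε'
  have e1 : ∀ w, Lp.compMeasurePreserving (g w) (hmp w) (hv.toLp v)
      = (hv.comp_measurePreserving (hmp w)).toLp (v ∘ g w) := fun w =>
    Lp.toLp_compMeasurePreserving hv (hmp w)
  rw [e1, e1, dist_edist, Lp.edist_toLp_toLp] at hd
  have hfin : eLpNorm (v ∘ g w - v ∘ g 0) 2 volume ≠ ⊤ :=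
    ((hv.comp_measurePreserving (hmp w)).sub (hv.comp_measurePreserving (hmp 0))).2.ne
  have := ENNReal.ofReal_le_ofReal hd.le
  rw [ENNReal.ofReal_toReal hfin] at this
  have e2 : (fun y => v (y - w) - v y) = v ∘ g w - v ∘ g 0 := by
    funext y
    simp [g]
  rwa [e2]

lemma mollify_sub_self {c : E3} {r : ℝ} {θ : E3 → ℝ} {v : E3 → ℂ} (hθ : IsMollifier c r θ)
    (hv : LocallyIntegrable v) (y : E3) :
    mollify θ v y - v y = ∫ w, (θ w : ℂ) * (v (y - w) - v y) := by
  have h1 : ∫ w, (θ w : ℂ) * v y = v y := by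
    rw [integral_mul_const, integral_complex_ofReal, hθ.integral_eq]; simp
  have h2 : Integrable fun w => (θ w : ℂ) * v y := hθ.integrable.ofReal.mul_const _
  simp only [mul_sub]
  rw [integral_sub (integrable_mollify hθ.smooth.continuous hθ.compact hv y) h2, h1,
    mollify_apply']

/-- Mollification converges in `L²`. -/
lemma exists_eLpNorm_mollify_sub_le {v : E3 → ℂ} (hv : MemLp v 2) {ε : ℝ≥0∞} (hε : ε ≠ 0) :
    ∃ δ > 0, ∀ θ, IsMollifier 0 δ θ → eLpNorm (fun y => mollify θ v y - v y) 2 volume ≤ ε := by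
  obtain ⟨δ, hδ, h⟩ := exists_eLpNorm_translate_sub_le hv hε
  refine ⟨δ, hδ, fun θ hθ => ?_⟩
  have hloc : LocallyIntegrable v := hv.locallyIntegrable (by norm_num)
  have hmeas : AEStronglyMeasurable (fun p : E3 × E3 => v (p.1 - p.2) - v p.1)
      (volume.prod volume) := by
    refine AEStronglyMeasurable.sub ?_ hv.1.comp_fst
    exact hv.1.comp_quasiMeasurePreserving
      (quasiMeasurePreserving_sub_of_right_invariant volume volume)
  have hmy (y : E3) : AEStronglyMeasurable (fun w => v (y - w) - v y) volume :=
    (hv.1.comp_measurePreserving (Measure.measurePreserving_sub_left volume y)).sub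
      aestronglyMeasurable_const
  have hθm : Measurable fun w => ENNReal.ofReal (θ w) :=
    hθ.smooth.continuous.measurable.ennreal_ofReal
  -- Jensen for the density θ bounds the left side by an average over w of |v(y - w) - v(y)|². After
  -- exchanging the integrals, each w with norm at most δ contributes at most ε², and θ vanishes at
  -- the others.
  have hsq : eLpNorm (fun y => mollify θ v y - v y) 2 volume ^ 2 ≤ ε ^ 2 := by
    rw [eLpNorm_two_sq]
    calc ∫⁻ y, ‖mollify θ v y - v y‖ₑ ^ 2
        ≤ ∫⁻ y, ∫⁻ w, ENNReal.ofReal (θ w) * ‖v (y - w) - v y‖ₑ ^ 2 := by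
          refine lintegral_mono fun y => ?_
          rw [mollify_sub_self hθ hloc]
          calc _ ≤ (∫⁻ w, ENNReal.ofReal (θ w) * ‖v (y - w) - v y‖ₑ) ^ 2 := by
                gcongr
                refine (enorm_integral_le_lintegral_enorm _).trans_eq ?_
                refine lintegral_congr fun w => ?_
                rw [enorm_mul, ← ofReal_norm, Complex.norm_real,
                  Real.norm_of_nonneg (hθ.nonneg w)]
            _ ≤ _ := lintegral_mul_sq_le hθm.aemeasurable (hmy y).enorm
            _ = _ := by rw [hθ.lintegral_eq, one_mul]
      _ = ∫⁻ w, ∫⁻ y, ENNReal.ofReal (θ w) * ‖v (y - w) - v y‖ₑ ^ 2 := by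
          refine lintegral_lintegral_swap ?_
          exact ((hθm.comp measurable_snd).aemeasurable).mul (hmeas.enorm.pow_const 2)
      _ ≤ ∫⁻ w, ENNReal.ofReal (θ w) * ε ^ 2 := by
          refine lintegral_mono fun w => ?_
          simp only
          rw [lintegral_const_mul' _ _ ENNReal.ofReal_ne_top]
          by_cases hw : ‖w‖ ≤ δ
          · gcongr
            rw [← eLpNorm_two_sq]
            gcongr
            exact h w hw
          · rw [hθ.eq_zero (by rw [dist_zero_right]; exact not_le.1 hw)]
            simp
      _ = ε ^ 2 := by
          rw [lintegral_mul_const _ hθm, hθ.lintegral_eq, one_mul]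
  exact (ENNReal.pow_le_pow_left_iff (by norm_num)).1 hsq

end Approximation

/-! ### Stability of weak equations under L² limits. -/

section Limits

open Filter

lemma tendsto_mollify {θ : ℕ → E3 → ℝ} {δ : ℕ → ℝ} (hθ : ∀ n, IsMollifier 0 (δ n) (θ n))
    (hδ : Tendsto δ atTop (𝓝 0)) {v : E3 → ℂ} (hv : MemLp v 2) :
    Tendsto (fun n => eLpNorm (fun y => mollify (θ n) v y - v y) 2 volume) atTop (𝓝 0) := by
  rw [ENNReal.tendsto_nhds_zero]
  intro ε hε
  obtain ⟨d, hd, h⟩ := exists_eLpNorm_mollify_sub_le hv hε.ne'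
  filter_upwards [hδ.eventually (gt_mem_nhds hd)] with n hn
  exact h _ ((hθ n).mono (Metric.closedBall_subset_closedBall hn.le))

/-- Strong `L²` convergence implies convergence of the pairings with square integrable functions. -/
lemma tendsto_integral_mul_of_memLp {ι : Type*} {l : Filter ι} {μ : Measure E3} {h : E3 → ℂ}
    (hh : MemLp h 2 μ) {v : ι → E3 → ℂ} {w : E3 → ℂ} (hv : ∀ n, MemLp (v n) 2 μ) (hw : MemLp w 2 μ)
    (ht : Tendsto (fun n => eLpNorm (fun y => v n y - w y) 2 μ) l (𝓝 0)) :
    Tendsto (fun n => ∫ y, h y * v n y ∂μ) l (𝓝 (∫ y, h y * w y ∂μ)) := by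
  have hint (f : E3 → ℂ) (hf : MemLp f 2 μ) : Integrable (fun y => h y * f y) μ :=
    hh.integrable_mul hf
  refine tendsto_integral_of_L1' _ (hint w hw).1 (.of_forall fun n => hint _ (hv n)) ?_
  have hle (n : ι) : eLpNorm ((fun y => h y * v n y) - fun y => h y * w y) 1 μ
      ≤ eLpNorm h 2 μ * eLpNorm (fun y => v n y - w y) 2 μ := by
    have := eLpNorm_smul_le_mul_eLpNorm (p := 2) (q := 2) (r := 1) ((hv n).sub hw).1 hh.1
    refine le_trans (le_of_eq ?_) this
    congr 1
    funext y
    simp [mul_sub]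
  refine tendsto_of_tendsto_of_tendsto_of_le_of_le tendsto_const_nhds ?_ (fun _ => zero_le) hle
  have := ENNReal.Tendsto.const_mul (a := eLpNorm h 2 μ) ht (.inr hh.2.ne)
  simpa using this

/-- Strong `L²` convergence near the support of `φ` implies convergence of the pairing. -/
lemma tendsto_integral_mul {ι : Type*} {l : Filter ι} {φ : E3 → ℝ} (hφ : Continuous φ)
    (hc : HasCompactSupport φ) {B : Set E3} (hB : tsupport φ ⊆ B) {v : ι → E3 → ℂ} {w : E3 → ℂ}
    (hv : ∀ n, MemLp (v n) 2 (volume.restrict B)) (hw : MemLp w 2 (volume.restrict B))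
    (h : Tendsto (fun n => eLpNorm (fun y => v n y - w y) 2 (volume.restrict B)) l (𝓝 0)) :
    Tendsto (fun n => ∫ y, (φ y : ℂ) * v n y) l (𝓝 (∫ y, (φ y : ℂ) * w y)) := by
  have hset (f : E3 → ℂ) : ∫ y, (φ y : ℂ) * f y = ∫ y in B, (φ y : ℂ) * f y := by
    refine (setIntegral_eq_integral_of_forall_compl_eq_zero fun y hy => ?_).symm
    rw [image_eq_zero_of_notMem_tsupport fun hn => hy (hB hn)]; simp
  simp only [hset]
  have hφ2 : MemLp (fun y => (φ y : ℂ)) 2 (volume.restrict B) :=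
    ((Complex.continuous_ofReal.comp hφ).memLp_of_hasCompactSupport
      (hc.comp_left (g := fun x : ℝ => (x : ℂ)) (by simp))).restrict B
  exact tendsto_integral_mul_of_memLp hφ2 hv hw h

lemma tendsto_eLpNorm_restrict {ι : Type*} {l : Filter ι} {v : ι → E3 → ℂ}
    {B : Set E3} {μ : Measure E3} (hμ : volume.restrict B ≤ μ)
    (h : Tendsto (fun n => eLpNorm (v n) 2 μ) l (𝓝 0)) :
    Tendsto (fun n => eLpNorm (v n) 2 (volume.restrict B)) l (𝓝 0) :=
  tendsto_of_tendsto_of_tendsto_of_le_of_le tendsto_const_nhds h (fun _ => zero_le)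
    fun _ => eLpNorm_mono_measure _ hμ

lemma eLpNorm_sub_congr {B : Set E3} (hB : MeasurableSet B) {a b b' : E3 → ℂ}
    (h : ∀ y ∈ B, b y = b' y) :
    eLpNorm (fun y => a y - b y) 2 (volume.restrict B)
      = eLpNorm (fun y => a y - b' y) 2 (volume.restrict B) := by
  refine eLpNorm_congr_ae ?_
  filter_upwards [ae_restrict_mem hB] with y hy
  simp only [h y hy]

/-- Both sides of the weak equation are pairings with a fixed continuous function of compact
support, hence continuous for L² convergence. -/
lemma HasWeakPartial.of_tendsto {U : Set E3} {i : Fin 3} {ψ g : E3 → ℂ}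
    {ψn gn : ℕ → E3 → ℂ} (h : ∀ n, HasWeakPartial U i (ψn n) (gn n))
    (hψ : MemLp ψ 2 (volume.restrict U)) (hg : MemLp g 2 (volume.restrict U))
    (hψn : ∀ n, MemLp (ψn n) 2 (volume.restrict U)) (hgn : ∀ n, MemLp (gn n) 2 (volume.restrict U))
    (tψ : Tendsto (fun n => eLpNorm (fun y => ψn n y - ψ y) 2 (volume.restrict U)) atTop (𝓝 0))
    (tg : Tendsto (fun n => eLpNorm (fun y => gn n y - g y) 2 (volume.restrict U)) atTop (𝓝 0)) :
    HasWeakPartial U i ψ g := by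
  intro φ hφ
  have hp := hφ.partialDeriv i
  have t1 := tendsto_integral_mul hp.continuous hp.compact hp.support_subset hψn hψ tψ
  have t2 := tendsto_integral_mul hφ.continuous hφ.compact hφ.support_subset hgn hg tg
  refine tendsto_nhds_unique t1 ?_
  refine t2.neg.congr fun n => ?_
  rw [h n φ hφ]

lemma CurlFree.of_tendsto {U : Set E3} {u : Fin 3 → E3 → ℂ} {un : ℕ → Fin 3 → E3 → ℂ}
    (h : ∀ n, CurlFree U (un n)) (hu : ∀ i, MemLp (u i) 2 (volume.restrict U))
    (hun : ∀ n i, MemLp (un n i) 2 (volume.restrict U))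
    (t : ∀ i, Tendsto (fun n => eLpNorm (fun y => un n i y - u i y) 2 (volume.restrict U))
      atTop (𝓝 0)) : CurlFree U u := by
  have hl {v : E3 → ℂ} (hv : MemLp v 2 (volume.restrict U)) : LocL2 U v :=
    fun K hK _ => hv.mono_measure (Measure.restrict_mono hK le_rfl)
  intro i j φ hφ
  have hi := hφ.partialDeriv i
  have hj := hφ.partialDeriv j
  have t1 := tendsto_integral_mul hj.continuous hj.compact hj.support_subset
    (fun n => hun n i) (hu i) (t i)
  have t2 := tendsto_integral_mul hi.continuous hi.compact hi.support_subset
    (fun n => hun n j) (hu j) (t j)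
  rw [integral_sub ((hl (hu i)).integrable_test hj) ((hl (hu j)).integrable_test hi)]
  refine tendsto_nhds_unique (t1.sub t2) ?_
  refine tendsto_const_nhds.congr fun n => ?_
  rw [← integral_sub ((hl (hun n i)).integrable_test hj) ((hl (hun n j)).integrable_test hi),
    h n i j φ hφ]

end Limits

/-! ### Functions with zero weak gradient. -/

section ZeroGrad

open Filter

lemma memLp_indicator_of_locL2 {U K : Set E3} {v : E3 → ℂ} (h : LocL2 U v) (hK : K ⊆ U)
    (hc : IsCompact K) : MemLp (K.indicator v) 2 volume :=
  (memLp_indicator_iff_restrict hc.measurableSet).2 (h K hK hc)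

lemma clm_ext_single {F : Type*} [NormedAddCommGroup F] [NormedSpace ℝ F] {A B : E3 →L[ℝ] F}
    (h : ∀ i, A (EuclideanSpace.single i 1) = B (EuclideanSpace.single i 1)) : A = B := by
  refine ContinuousLinearMap.coe_injective ?_
  refine (EuclideanSpace.basisFun (Fin 3) ℝ).toBasis.ext fun i => ?_
  simpa using h i

lemma mem_closedBall_of_sub_mem {c y w : E3} {r δ : ℝ} (hy : y ∈ Metric.ball c r)
    (hw : y - w ∈ Metric.closedBall (0 : E3) δ) : w ∈ Metric.closedBall c (r + δ) := by
  rw [Metric.mem_closedBall, dist_zero_right] at hw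
  rw [Metric.mem_ball] at hy
  rw [Metric.mem_closedBall]
  have h1 : dist w y = ‖y - w‖ := by rw [dist_comm, dist_eq_norm]
  linarith [dist_triangle w y c]

lemma exists_mollifier_seq {d : ℝ} (hd : 0 < d) : ∃ θ : ℕ → E3 → ℝ,
    (∀ n : ℕ, IsMollifier 0 (d / (n + 1)) (θ n)) ∧
    (∀ n, IsMollifier 0 d (θ n)) ∧ Tendsto (fun n : ℕ => d / (n + 1)) atTop (𝓝 0) := by
  have h (n : ℕ) := exists_isMollifier 0 (r := d / (n + 1)) (by positivity)
  choose θ hθ using h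
  refine ⟨θ, hθ, fun n => (hθ n).mono (Metric.closedBall_subset_closedBall ?_), ?_⟩
  · exact div_le_self hd.le (by simp)
  · exact tendsto_const_div_atTop_nhds_zero_nat d |>.comp (tendsto_add_atTop_nat 1) |>.congr
      fun n => by simp

lemma ae_restrict_of_local {U : Set E3} (hU : IsOpen U) {p : E3 → Prop}
    (h : ∀ x ∈ U, ∃ V, IsOpen V ∧ x ∈ V ∧ ∀ᵐ y ∂(volume.restrict (U ∩ V)), p y) :
    ∀ᵐ y ∂(volume.restrict U), p y := by
  rw [ae_restrict_iff' hU.measurableSet, ae_iff]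
  refine measure_null_of_locally_null _ fun x hx => ?_
  simp only [Classical.not_imp, mem_ofPred_eq] at hx
  obtain ⟨V, hV, hxV, hp⟩ := h x hx.1
  rw [ae_restrict_iff' (hU.inter hV).measurableSet, ae_iff] at hp
  refine ⟨_, inter_mem self_mem_nhdsWithin (mem_nhdsWithin_of_mem_nhds (hV.mem_nhds hxV)), ?_⟩
  refine measure_mono_null (fun y hy => ?_) hp
  simp only [Classical.not_imp, mem_inter_iff, mem_ofPred_eq] at hy ⊢
  exact ⟨⟨hy.1.1, hy.2⟩, hy.1.2⟩

/-- The mollifications have zero derivative on the smaller ball, so they are constants there; the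
gap between the radii accommodates the kernels. A subsequence converges almost everywhere, which
makes ψ the limit of a sequence of constants. -/
lemma ae_const_ball_of_zero_grad {c : E3} {r R : ℝ} (hr : 0 < r) (hrR : r < R) {ψ : E3 → ℂ}
    (h : HasGrad (Metric.ball c R) ψ fun _ _ => 0) :
    ∃ k, ∀ᵐ y ∂(volume.restrict (Metric.ball c r)), ψ y = k := by
  set d := (R - r) / 2 with hd
  have hd0 : 0 < d := by rw [hd]; linarith
  obtain ⟨θ, hθ, hθd, hlim⟩ := exists_mollifier_seq hd0
  set K := Metric.closedBall c (r + d)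
  have hK : K ⊆ Metric.ball c R := Metric.closedBall_subset_ball (by rw [hd]; linarith)
  have hv := memLp_indicator_of_locL2 h.locL2 hK (isCompact_closedBall _ _)
  set v := K.indicator ψ
  have hvl : LocallyIntegrable v := hv.locallyIntegrable (by norm_num)
  have hmem (n : ℕ) {y w : E3} (hy : y ∈ Metric.ball c r) (hw : y - w ∈ tsupport (θ n)) :
      w ∈ K := mem_closedBall_of_sub_mem hy ((hθd n).tsupport_subset hw)
  have hzero (n : ℕ) : ∀ y ∈ Metric.ball c r, fderiv ℝ (mollify (θ n) v) y = 0 := by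
    intro y hy
    refine clm_ext_single fun i => ?_
    rw [fderiv_mollify_of_hasWeakPartial (hθ n).smooth (hθ n).compact hvl (h.weak i)
      (fun w hw => hK (hmem n hy hw)) (fun w hw => indicator_of_mem (hmem n hy hw) _)]
    simp [mollify_apply]
  have hconst (n : ℕ) : ∃ a, ∀ y ∈ Metric.ball c r, mollify (θ n) v y = a := by
    refine Metric.isOpen_ball.exists_is_const_of_fderiv_eq_zero
      (convex_ball c r).isPreconnected ?_ (hzero n)
    exact ((contDiff_mollify (hθ n).smooth (hθ n).compact hvl).differentiable
      (by simp)).differentiableOn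
  choose a ha using hconst
  have ht := tendsto_mollify hθ hlim hv
  have hm := tendstoInMeasure_of_tendsto_eLpNorm (p := 2) (by simp)
    (f := fun n => mollify (θ n) v) (g := v)
    (fun n => (contDiff_mollify (hθ n).smooth (hθ n).compact hvl).continuous.aestronglyMeasurable)
    hv.1 ht
  obtain ⟨ns, -, hns⟩ := hm.exists_seq_tendsto_ae
  have hns' : ∀ᵐ y ∂(volume.restrict (Metric.ball c r)),
      Tendsto (fun n => a (ns n)) atTop (𝓝 (ψ y)) := by
    filter_upwards [ae_restrict_of_ae hns, ae_restrict_mem measurableSet_ball] with y hy hyb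
    have : v y = ψ y := indicator_of_mem (Metric.ball_subset_closedBall.trans
      (Metric.closedBall_subset_closedBall (by linarith)) hyb) _
    rw [← this]
    exact hy.congr fun n => ha _ y hyb
  have : (ae (volume.restrict (Metric.ball c r))).NeBot := by
    rw [ae_neBot, Ne, Measure.restrict_eq_zero]
    exact (Metric.measure_ball_pos volume c hr).ne'
  obtain ⟨y0, hy0⟩ := hns'.exists
  exact ⟨ψ y0, hns'.mono fun y hy => tendsto_nhds_unique hy hy0⟩

/-- If two constants agree a.e. on a nonempty open set, they are equal. -/
lemma eq_of_ae_eq_of_isOpen {V : Set E3} (hV : IsOpen V) (hne : V.Nonempty) {a b : ℂ}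
    (h : ∀ᵐ _y ∂(volume.restrict V), a = b) : a = b := by
  have : (ae (volume.restrict V)).NeBot := by
    rw [ae_neBot, Ne, Measure.restrict_eq_zero]
    exact (hV.measure_pos volume hne).ne'
  exact h.exists.choose_spec

/-- A function with vanishing weak gradient on a connected open set is constant. -/
theorem ae_const_of_zero_grad {U : Set E3} (hU : IsOpen U) (hc : IsPreconnected U) {ψ : E3 → ℂ}
    (h : HasGrad U ψ fun _ _ => 0) : ∃ k, ∀ᵐ y ∂(volume.restrict U), ψ y = k := by
  rcases U.eq_empty_or_nonempty with rfl | ⟨x0, hx0⟩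
  · exact ⟨0, by simp⟩
  have hloc (x : U) : ∃ r > 0, Metric.ball (x : E3) r ⊆ U ∧
      ∃ k, ∀ᵐ y ∂(volume.restrict (Metric.ball (x : E3) r)), ψ y = k := by
    obtain ⟨R, hR, hRU⟩ := Metric.isOpen_iff.1 hU x x.2
    exact ⟨R / 2, by positivity, (Metric.ball_subset_ball (by linarith)).trans hRU,
      ae_const_ball_of_zero_grad (by positivity) (by linarith) (h.mono hRU)⟩
  choose r hr hrU k hk using hloc
  have : PreconnectedSpace U := isPreconnected_iff_preconnectedSpace.1 hc
  -- The constants of two overlapping balls agree because the overlap is open and nonempty;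
  -- connectedness then propagates a single value.
  have hlc : IsLocallyConstant k := by
    rw [IsLocallyConstant.iff_exists_open]
    intro x
    refine ⟨{y : U | (y : E3) ∈ Metric.ball (x : E3) (r x)},
      Metric.isOpen_ball.preimage continuous_subtype_val, Metric.mem_ball_self (hr x),
      fun y hy => ?_⟩
    refine eq_of_ae_eq_of_isOpen (V := Metric.ball (x : E3) (r x) ∩ Metric.ball (y : E3) (r y))
      (Metric.isOpen_ball.inter Metric.isOpen_ball) ⟨y, hy, Metric.mem_ball_self (hr y)⟩ ?_
    filter_upwards [ae_restrict_of_ae_restrict_of_subset inter_subset_left (hk x),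
      ae_restrict_of_ae_restrict_of_subset inter_subset_right (hk y)] with z h1 h2
    rw [← h1, ← h2]
  refine ⟨k ⟨x0, hx0⟩, ae_restrict_of_local hU fun x hx => ⟨_, Metric.isOpen_ball,
    Metric.mem_ball_self (hr ⟨x, hx⟩), ?_⟩⟩
  rw [hlc.apply_eq_of_preconnectedSpace ⟨x0, hx0⟩ ⟨x, hx⟩]
  exact ae_restrict_of_ae_restrict_of_subset inter_subset_right (hk ⟨x, hx⟩)

end ZeroGrad

/-! ### The Poincaré inequality on balls. -/

section Poincare

/-- The 1-form `∑ gᵢ dyᵢ`. -/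
noncomputable def oneForm (g : Fin 3 → E3 → ℂ) (y : E3) : E3 →L[ℝ] ℂ :=
  ∑ i, (EuclideanSpace.proj i : E3 →L[ℝ] ℝ).smulRight (g i y)

lemma oneForm_apply (g : Fin 3 → E3 → ℂ) (y v : E3) : oneForm g y v = ∑ i, (v i : ℂ) * g i y := by
  simp [oneForm]

lemma oneForm_single (g : Fin 3 → E3 → ℂ) (y : E3) (i : Fin 3) :
    oneForm g y (EuclideanSpace.single i 1) = g i y := by
  rw [oneForm_apply, Finset.sum_eq_single i]
  · simp
  · intro j _ hj; simp [hj]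
  · simp

lemma norm_oneForm_apply_le (g : Fin 3 → E3 → ℂ) (y v : E3) :
    ‖oneForm g y v‖ ≤ ‖v‖ * ∑ i, ‖g i y‖ := by
  rw [oneForm_apply, Finset.mul_sum]
  refine (norm_sum_le _ _).trans (Finset.sum_le_sum fun i _ => ?_)
  rw [norm_mul, Complex.norm_real]
  gcongr
  exact PiLp.norm_apply_le v i

lemma hasFDerivAt_of_partials {f : E3 → ℂ} {g : Fin 3 → E3 → ℂ} {y : E3}
    (hf : DifferentiableAt ℝ f y)
    (h : ∀ i, fderiv ℝ f y (EuclideanSpace.single i 1) = g i y) :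
    HasFDerivAt f (oneForm g y) y := by
  have : fderiv ℝ f y = oneForm g y := clm_ext_single fun i => by rw [h, oneForm_single]
  rw [← this]
  exact hf.hasFDerivAt

/-- The change of variables costs t⁻³, which is at most 8 here. -/
lemma lintegral_comp_affine (F : E3 → ℝ≥0∞) (hF : Measurable F) {t : ℝ} (ht : 1 / 2 ≤ t) (a : E3) :
    ∫⁻ x, F (t • x + a) ≤ 8 * ∫⁻ x, F x := by
  have ht0 : 0 < t := by linarith
  have h1 : ∫⁻ x, F (t • x + a) = ∫⁻ x, F (x + a) ∂(Measure.map (fun x : E3 => t • x) volume) := by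
    rw [lintegral_map (f := fun x => F (x + a)) (hF.comp (measurable_add_const a))
      (measurable_const_smul t)]
  rw [h1, Measure.map_addHaar_smul _ ht0.ne', lintegral_smul_measure,
    lintegral_add_right_eq_self F a, smul_eq_mul]
  gcongr
  rw [finrank_euclideanSpace_fin, abs_of_pos (by positivity)]
  refine (ENNReal.ofReal_le_ofReal (q := 8) ?_).trans (by norm_num)
  rw [inv_le_comm₀ (by positivity) (by norm_num)]
  calc (8 : ℝ)⁻¹ = (1 / 2) ^ 3 := by norm_num
    _ ≤ t ^ 3 := by gcongr

variable {c : E3} {r R : ℝ} {p : E3 → ℂ} {g : Fin 3 → E3 → ℂ}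

/-- Fundamental theorem of calculus along the segment from `y` to `x`, of length at most 2r,
followed by Cauchy–Schwarz in t. -/
lemma enorm_sub_sq_le (hg : ∀ i, Continuous (g i))
    (hp : ∀ y ∈ Metric.ball c r, HasFDerivAt p (oneForm g y) y) {x y : E3}
    (hx : x ∈ Metric.ball c r) (hy : y ∈ Metric.ball c r) :
    ‖p x - p y‖ₑ ^ 2 ≤ ENNReal.ofReal (2 * r) ^ 2 *
      ∫⁻ t in Ioc (0 : ℝ) 1, ENNReal.ofReal (∑ i, ‖g i (t • x + (1 - t) • y)‖) ^ 2 := by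
  have hz (t : ℝ) (ht : t ∈ Icc (0 : ℝ) 1) : t • x + (1 - t) • y ∈ Metric.ball c r :=
    (convex_ball c r) hx hy ht.1 (by linarith [ht.2]) (by ring)
  have hpath (t : ℝ) : HasDerivAt (fun t : ℝ => t • x + (1 - t) • y) (x - y) t := by
    have h1 := (hasDerivAt_id t).smul_const x
    have h2 := ((hasDerivAt_id t).const_sub 1).smul_const y
    exact (h1.add h2).congr_deriv (by simp [sub_eq_add_neg])
  have hcont : Continuous fun t : ℝ => oneForm g (t • x + (1 - t) • y) (x - y) := by
    simp only [oneForm_apply]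
    refine continuous_finsetSum _ fun i _ => continuous_const.mul ((hg i).comp (by fun_prop))
  have hftc : ∫ t in (0 : ℝ)..1, oneForm g (t • x + (1 - t) • y) (x - y) = p x - p y := by
    rw [intervalIntegral.integral_eq_sub_of_hasDerivAt (f := fun t : ℝ => p (t • x + (1 - t) • y))]
    · simp
    · intro t ht
      rw [uIcc_of_le zero_le_one] at ht
      exact (hp _ (hz t ht)).comp_hasDerivAt t (hpath t)
    · exact hcont.intervalIntegrable _ _
  rw [intervalIntegral.integral_of_le zero_le_one] at hftc
  have hGm : Measurable fun t : ℝ => ENNReal.ofReal (∑ i, ‖g i (t • x + (1 - t) • y)‖) := by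
    refine Continuous.measurable ?_ |>.ennreal_ofReal
    exact continuous_finsetSum _ fun i _ => ((hg i).comp (by fun_prop)).norm
  have hxy : ‖x - y‖ ≤ 2 * r := by
    rw [← dist_eq_norm]
    linarith [dist_triangle_right x y c, Metric.mem_ball.1 hx, Metric.mem_ball.1 hy]
  have h1 : ‖p x - p y‖ₑ ≤ ENNReal.ofReal (2 * r) *
      ∫⁻ t in Ioc (0 : ℝ) 1, ENNReal.ofReal (∑ i, ‖g i (t • x + (1 - t) • y)‖) := by
    rw [← hftc, ← lintegral_const_mul _ hGm]
    refine (enorm_integral_le_lintegral_enorm _).trans (lintegral_mono fun t => ?_)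
    rw [← ENNReal.ofReal_mul ((norm_nonneg _).trans hxy), ← ofReal_norm]
    refine ENNReal.ofReal_le_ofReal ((norm_oneForm_apply_le _ _ _).trans ?_)
    gcongr
  calc _ ≤ _ := pow_le_pow_left' h1 2
    _ ≤ _ := by
      rw [mul_pow]
      gcongr
      have := lintegral_sq_le (μ := volume.restrict (Ioc (0 : ℝ) 1)) hGm.aemeasurable
      simpa using this

/-- For every t, one of the weights t and 1 - t is at least 1/2. Integrating first in the variable
carrying that weight keeps the Jacobian below 8, and the other variable contributes the volume of
the ball. -/
lemma lintegral_lintegral_segment_le (hF : ∀ i, Continuous (g i)) :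
    ∫⁻ x in Metric.ball c r, ∫⁻ y in Metric.ball c r,
      ∫⁻ t in Ioc (0 : ℝ) 1, ENNReal.ofReal (∑ i, ‖g i (t • x + (1 - t) • y)‖) ^ 2
    ≤ 8 * volume (Metric.ball c r) *
      ∫⁻ x in Metric.ball c r, ENNReal.ofReal (∑ i, ‖g i x‖) ^ 2 := by
  set B := Metric.ball c r with hB
  set F : E3 → ℝ≥0∞ := B.indicator fun z => ENNReal.ofReal (∑ i, ‖g i z‖) ^ 2 with hFdef
  have hBm : MeasurableSet B := measurableSet_ball
  have hGm : Measurable fun z => ENNReal.ofReal (∑ i, ‖g i z‖) ^ 2 :=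
    ((continuous_finsetSum _ fun i _ => (hF i).norm).measurable.ennreal_ofReal).pow_const 2
  have hFm : Measurable F := hGm.indicator hBm
  have hFint : ∫⁻ x in B, ENNReal.ofReal (∑ i, ‖g i x‖) ^ 2 = ∫⁻ x, F x := by
    rw [hFdef, lintegral_indicator hBm]
  have hmeas3 : Measurable fun q : (E3 × E3) × ℝ => F (q.2 • q.1.1 + (1 - q.2) • q.1.2) :=
    hFm.comp (by fun_prop)
  have step1 : ∫⁻ x in B, ∫⁻ y in B,
      ∫⁻ t in Ioc (0 : ℝ) 1, ENNReal.ofReal (∑ i, ‖g i (t • x + (1 - t) • y)‖) ^ 2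
      = ∫⁻ x in B, ∫⁻ y in B, ∫⁻ t in Ioc (0 : ℝ) 1, F (t • x + (1 - t) • y) := by
    refine setLIntegral_congr_fun hBm fun x hx => setLIntegral_congr_fun hBm fun y hy =>
      setLIntegral_congr_fun measurableSet_Ioc fun t ht => ?_
    have : t • x + (1 - t) • y ∈ B :=
      (convex_ball c r) hx hy ht.1.le (by linarith [ht.2]) (by ring)
    simp [hFdef, this]
  have step2 : ∫⁻ x in B, ∫⁻ y in B, ∫⁻ t in Ioc (0 : ℝ) 1, F (t • x + (1 - t) • y)
      = ∫⁻ t in Ioc (0 : ℝ) 1, ∫⁻ x in B, ∫⁻ y in B, F (t • x + (1 - t) • y) := by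
    rw [← lintegral_prod (μ := volume.restrict B) (ν := volume.restrict B)
      (fun q : E3 × E3 => ∫⁻ t in Ioc (0 : ℝ) 1, F (t • q.1 + (1 - t) • q.2))
      (hmeas3.lintegral_prod_right').aemeasurable]
    rw [lintegral_lintegral_swap hmeas3.aemeasurable]
    refine lintegral_congr fun t => ?_
    rw [lintegral_prod]
    exact (hFm.comp (by fun_prop)).aemeasurable
  rw [step1, step2, hFint]
  have hmeas2 (t : ℝ) : Measurable fun q : E3 × E3 => F (t • q.1 + (1 - t) • q.2) :=
    hFm.comp (by fun_prop)
  have bound (t : ℝ) : ∫⁻ x in B, ∫⁻ y in B, F (t • x + (1 - t) • y)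
      ≤ 8 * volume B * ∫⁻ x, F x := by
    have hfin (a : ℝ≥0∞) : ∫⁻ _ in B, 8 * a = 8 * volume B * a := by
      rw [lintegral_const, Measure.restrict_apply_univ]; ring
    by_cases ht : 1 / 2 ≤ t
    · rw [lintegral_lintegral_swap (hmeas2 t).aemeasurable, ← hfin]
      refine lintegral_mono fun y => (setLIntegral_le_lintegral _ _).trans ?_
      exact lintegral_comp_affine F hFm ht _
    · rw [← hfin]
      refine lintegral_mono fun x => (setLIntegral_le_lintegral _ _).trans ?_
      have := lintegral_comp_affine F hFm (t := 1 - t) (by linarith) (t • x)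
      simpa only [add_comm] using this
  calc _ ≤ ∫⁻ t in Ioc (0 : ℝ) 1, 8 * volume B * ∫⁻ x, F x := lintegral_mono bound
    _ = _ := by simp

/-- The Poincaré inequality on a ball. -/
theorem poincare_ball (hrR : r < R) (hr : 0 < r) (hg : ∀ i, Continuous (g i))
    (hp : ∀ y ∈ Metric.ball c R, HasFDerivAt p (oneForm g y) y) :
    eLpNorm (fun x => p x - ⨍ y in Metric.ball c r, p y) 2 (volume.restrict (Metric.ball c r))
      ≤ ENNReal.ofReal (6 * r) *
        ∑ i, eLpNorm (g i) 2 (volume.restrict (Metric.ball c r)) := by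
  set B := Metric.ball c r with hB
  have hBm : MeasurableSet B := measurableSet_ball
  have hBR : B ⊆ Metric.ball c R := Metric.ball_subset_ball hrR.le
  have hcont : ContinuousOn p (Metric.closedBall c r) := fun y hy =>
    (hp y (Metric.closedBall_subset_ball hrR hy)).continuousAt.continuousWithinAt
  have hint : IntegrableOn p B :=
    (hcont.integrableOn_compact (isCompact_closedBall c r)).mono_set Metric.ball_subset_closedBall
  have hpm : AEMeasurable p (volume.restrict B) := hint.1.aemeasurable
  have hV0 : volume B ≠ 0 := (Metric.measure_ball_pos volume c hr).ne'
  have hVt : volume B ≠ ⊤ := measure_ball_lt_top.ne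
  have : IsFiniteMeasure (volume.restrict B) := ⟨by simpa using hVt.lt_top⟩
  -- The deviation from the mean is the mean of the deviations, and Cauchy–Schwarz passes to
  -- squares.
  have hpt (x : E3) : ‖p x - ⨍ y in B, p y‖ₑ ^ 2
      ≤ (volume B)⁻¹ * ∫⁻ y in B, ‖p x - p y‖ₑ ^ 2 := by
    have e1 : p x - ⨍ y in B, p y = ⨍ y in B, (p x - p y) := by
      rw [setAverage_eq, setAverage_eq, integral_sub (integrable_const _) hint, smul_sub]
      congr 1
      rw [integral_const, smul_smul]
      simp only [Measure.real, Measure.restrict_apply_univ]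
      rw [inv_mul_cancel₀ (ENNReal.toReal_ne_zero.2 ⟨hV0, hVt⟩), one_smul]
    have e2 : ‖p x - ⨍ y in B, p y‖ₑ ≤ (volume B)⁻¹ * ∫⁻ y in B, ‖p x - p y‖ₑ := by
      rw [e1, average_eq', Measure.restrict_apply_univ]
      refine (enorm_integral_le_lintegral_enorm _).trans ?_
      rw [lintegral_smul_measure, smul_eq_mul]
    calc _ ≤ ((volume B)⁻¹ * ∫⁻ y in B, ‖p x - p y‖ₑ) ^ 2 := by gcongr
      _ = ((volume B)⁻¹) ^ 2 * (∫⁻ y in B, ‖p x - p y‖ₑ) ^ 2 := mul_pow _ _ _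
      _ ≤ ((volume B)⁻¹) ^ 2 * (volume B * ∫⁻ y in B, ‖p x - p y‖ₑ ^ 2) := by
          gcongr
          have := lintegral_sq_le (μ := volume.restrict B)
            (f := fun y => ‖p x - p y‖ₑ) (hpm.const_sub (p x)).enorm
          simpa using this
      _ = _ := by
          rw [pow_two, ← mul_assoc, mul_assoc (volume B)⁻¹, ENNReal.inv_mul_cancel hV0 hVt, mul_one]
  have hG : ∫⁻ x in B, ENNReal.ofReal (∑ i, ‖g i x‖) ^ 2
      ≤ (∑ i, eLpNorm (g i) 2 (volume.restrict B)) ^ 2 := by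
    have h1 : ∫⁻ x in B, ENNReal.ofReal (∑ i, ‖g i x‖) ^ 2
        = eLpNorm (fun x => ∑ i, ‖g i x‖) 2 (volume.restrict B) ^ 2 := by
      rw [eLpNorm_two_sq]
      refine lintegral_congr fun x => ?_
      rw [← ofReal_norm, Real.norm_of_nonneg (Finset.sum_nonneg fun i _ => norm_nonneg _)]
    rw [h1]
    gcongr
    have h2 := eLpNorm_sum_le (μ := volume.restrict B) (p := 2) (s := Finset.univ)
      (f := fun i x => ‖g i x‖) (fun i _ => (hg i).norm.aestronglyMeasurable) (by norm_num)
    simp only [eLpNorm_norm] at h2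
    convert h2 using 2
    funext x; simp
  have hsq : eLpNorm (fun x => p x - ⨍ y in B, p y) 2 (volume.restrict B) ^ 2
      ≤ (ENNReal.ofReal (6 * r) * ∑ i, eLpNorm (g i) 2 (volume.restrict B)) ^ 2 := by
    rw [eLpNorm_two_sq]
    calc ∫⁻ x in B, ‖p x - ⨍ y in B, p y‖ₑ ^ 2
        ≤ ∫⁻ x in B, (volume B)⁻¹ * ∫⁻ y in B, ‖p x - p y‖ₑ ^ 2 := lintegral_mono hpt
      _ = (volume B)⁻¹ * ∫⁻ x in B, ∫⁻ y in B, ‖p x - p y‖ₑ ^ 2 :=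
          lintegral_const_mul' _ _ (ENNReal.inv_ne_top.2 hV0)
      _ ≤ (volume B)⁻¹ * ∫⁻ x in B, ∫⁻ y in B, ENNReal.ofReal (2 * r) ^ 2 *
            ∫⁻ t in Ioc (0 : ℝ) 1, ENNReal.ofReal (∑ i, ‖g i (t • x + (1 - t) • y)‖) ^ 2 := by
          gcongr 1
          refine setLIntegral_mono' hBm fun x hx => setLIntegral_mono' hBm fun y hy => ?_
          exact enorm_sub_sq_le hg (fun z hz => hp z (hBR hz)) hx hy
      _ = (volume B)⁻¹ * (ENNReal.ofReal (2 * r) ^ 2 * ∫⁻ x in B, ∫⁻ y in B,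
            ∫⁻ t in Ioc (0 : ℝ) 1, ENNReal.ofReal (∑ i, ‖g i (t • x + (1 - t) • y)‖) ^ 2) := by
          have hne : ENNReal.ofReal (2 * r) ^ 2 ≠ ⊤ := by finiteness
          simp only [lintegral_const_mul' _ _ hne]
      _ ≤ (volume B)⁻¹ * (ENNReal.ofReal (2 * r) ^ 2 * (8 * volume B *
            (∑ i, eLpNorm (g i) 2 (volume.restrict B)) ^ 2)) := by
          gcongr 2
          exact (lintegral_lintegral_segment_le hg).trans (by gcongr)
      _ = ((volume B)⁻¹ * volume B) * (ENNReal.ofReal (2 * r) ^ 2 * 8) *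
            (∑ i, eLpNorm (g i) 2 (volume.restrict B)) ^ 2 := by ring
      _ ≤ _ := by
          rw [ENNReal.inv_mul_cancel hV0 hVt, one_mul, mul_pow]
          gcongr
          -- The constant 6 comes from (2r)² · 8 = 32 r² ≤ (6r)².
          have : (8 : ℝ≥0∞) = ENNReal.ofReal 8 := by norm_num
          rw [this, ← ENNReal.ofReal_pow (by positivity), ← ENNReal.ofReal_mul (by positivity),
            ← ENNReal.ofReal_pow (by positivity)]
          exact ENNReal.ofReal_le_ofReal (by nlinarith)
  exact (ENNReal.pow_le_pow_left_iff (by norm_num)).1 hsq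

end Poincare

/-! ### Local potentials of curl free L² fields. -/

section LocalPotential

open Filter

/-- A smooth curl-free field has a potential on a convex open set. -/
lemma exists_smooth_potential {U : Set E3} (hU : IsOpen U) (hc : Convex ℝ U)
    {g : Fin 3 → E3 → ℂ} (hg : ∀ i, ContDiff ℝ ∞ (g i))
    (h : ∀ y ∈ U, ∀ i j, fderiv ℝ (g i) y (EuclideanSpace.single j 1)
      = fderiv ℝ (g j) y (EuclideanSpace.single i 1)) :
    ∃ p : E3 → ℂ, ∀ y ∈ U, HasFDerivAt p (oneForm g y) y := by
  have hd (i : Fin 3) (y : E3) : HasFDerivAt (g i) (fderiv ℝ (g i) y) y :=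
    ((hg i).differentiable (by simp) y).hasFDerivAt
  -- `D` is the derivative of the 1-form; vanishing of the curl is exactly its symmetry, the
  -- hypothesis of the Poincaré lemma on convex sets.
  let D (y : E3) : E3 →L[ℝ] E3 →L[ℝ] ℂ := ∑ i,
    (ContinuousLinearMap.smulRightL ℝ E3 ℂ (EuclideanSpace.proj i : E3 →L[ℝ] ℝ)).comp
      (fderiv ℝ (g i) y)
  have hD (y : E3) : HasFDerivAt (oneForm g) (D y) y := by
    refine HasFDerivAt.fun_sum (A := fun i y => (EuclideanSpace.proj i : E3 →L[ℝ] ℝ).smulRight (g i y))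
      fun i _ => ?_
    exact (ContinuousLinearMap.smulRightL ℝ E3 ℂ
      (EuclideanSpace.proj i : E3 →L[ℝ] ℝ)).hasFDerivAt.comp y (hd i y)
  have hDapp (y a b : E3) : D y a b = ∑ i, (b i : ℂ) * fderiv ℝ (g i) y a := by
    simp [D]
  have hsymm (y : E3) (hy : y ∈ U) : D y = (D y).flip := by
    refine clm_ext_single fun i => clm_ext_single fun j => ?_
    have key (i j : Fin 3) : D y (EuclideanSpace.single i 1) (EuclideanSpace.single j 1)
        = fderiv ℝ (g j) y (EuclideanSpace.single i 1) := by
      rw [hDapp, Finset.sum_eq_single j]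
      · simp
      · intro k _ hk; simp [hk]
      · simp
    rw [ContinuousLinearMap.flip_apply, key, key, h y hy]
  refine hc.exists_forall_hasFDerivAt_of_fderiv_symmetric hU
    (fun y _ => (hD y).differentiableAt.differentiableWithinAt) fun a ha x y => ?_
  rw [(hD a).fderiv]
  conv_lhs => rw [hsymm a ha]
  rfl

lemma LocL2.of_continuousOn {U : Set E3} {v : E3 → ℂ} (h : ContinuousOn v U) : LocL2 U v := by
  intro K hK hc
  have : IsFiniteMeasure (volume.restrict K) :=
    ⟨by rw [Measure.restrict_apply_univ]; exact hc.measure_lt_top⟩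
  obtain ⟨C, hC⟩ := (hc.image_of_continuousOn (h.mono hK)).isBounded.exists_norm_le
  refine MemLp.of_bound ((h.mono hK).aestronglyMeasurable hc.measurableSet) C ?_
  filter_upwards [ae_restrict_mem hc.measurableSet] with y hy
  exact hC _ (mem_image_of_mem _ hy)

/-- Classical gradients are weak gradients. -/
lemma HasGrad.of_hasFDerivAt {U : Set E3} {p : E3 → ℂ}
    {g : Fin 3 → E3 → ℂ} (hg : ∀ i, Continuous (g i))
    (h : ∀ y ∈ U, HasFDerivAt p (oneForm g y) y) : HasGrad U p g := by
  have hpl : LocL2 U p := LocL2.of_continuousOn fun y hy => (h y hy).continuousAt.continuousWithinAt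
  have hgl (i : Fin 3) : LocL2 U (g i) := LocL2.of_continuous (hg i)
  refine ⟨hpl, hgl, fun i φ hφ => ?_⟩
  have e0 (y : E3) : (φ y : ℂ) * g i y = φ y • fderiv ℝ p y (EuclideanSpace.single i 1) := by
    by_cases hy : y ∈ U
    · rw [(h y hy).fderiv, oneForm_single]; simp
    · simp [image_eq_zero_of_notMem_tsupport fun hn => hy (hφ.support_subset hn)]
  have i1 := (hgl i).integrable_test hφ
  have i2 := hpl.integrable_test hφ
  have i3 := hpl.integrable_test (hφ.partialDeriv i)
  simp only [e0] at i1 ⊢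
  rw [integral_smul_fderiv_eq_neg_fderiv_smul_of_integrable, neg_neg]
  · refine integral_congr_ae (.of_forall fun y => ?_)
    simp [partialDeriv]
  · simpa [partialDeriv] using i3
  · exact i1
  · simpa using i2
  · exact fun y _ => hφ.differentiable y
  · exact fun y hy => (h y (hφ.support_subset hy)).differentiableAt

lemma exists_tendsto_of_eLpNorm_sub_le {μ : Measure E3} {P : ℕ → E3 → ℂ}
    (hP : ∀ n, MemLp (P n) 2 μ) {a : ℕ → ℝ≥0∞}
    (h : ∀ n m, eLpNorm (fun y => P n y - P m y) 2 μ ≤ a n + a m) (ha : Tendsto a atTop (𝓝 0)) :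
    ∃ p, MemLp p 2 μ ∧ Tendsto (fun n => eLpNorm (fun y => P n y - p y) 2 μ) atTop (𝓝 0) := by
  have hc : CauchySeq fun n => (hP n).toLp (P n) := by
    rw [EMetric.cauchySeq_iff]
    intro ε hε
    have hε2 : 0 < ε / 2 := ENNReal.half_pos hε.ne'
    obtain ⟨N, hN⟩ := eventually_atTop.1 (ha.eventually (gt_mem_nhds hε2))
    refine ⟨N, fun m hm n hn => ?_⟩
    rw [Lp.edist_toLp_toLp]
    calc _ ≤ a m + a n := h m n
      _ < ε / 2 + ε / 2 := ENNReal.add_lt_add (hN m hm) (hN n hn)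
      _ = ε := ENNReal.add_halves ε
  obtain ⟨p, hp⟩ := cauchySeq_tendsto_of_complete hc
  refine ⟨p, Lp.memLp p, ?_⟩
  rw [tendsto_iff_edist_tendsto_0] at hp
  refine hp.congr fun n => ?_
  rw [← Lp.toLp_coeFn p (Lp.memLp p), Lp.edist_toLp_toLp]
  refine eLpNorm_congr_ae ?_
  filter_upwards [(Lp.memLp p).coeFn_toLp] with y hy
  simp only [Pi.sub_apply, hy]

/-- Curl-free `L²` fields have local potentials. -/
theorem exists_hasGrad_ball {c : E3} {r R : ℝ} (hr : 0 < r) (hrR : r < R) {u : Fin 3 → E3 → ℂ}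
    (hu : ∀ i, LocL2 (Metric.ball c R) (u i)) (hcurl : CurlFree (Metric.ball c R) u) :
    ∃ p, HasGrad (Metric.ball c r) p u := by
  -- The smooth potentials live on the ball of radius r + d, which contains the closed ball of
  -- radius r; there the kernels read the field only up to radius r + 2d, still less than R.
  set d := (R - r) / 3 with hd
  have hd0 : 0 < d := by rw [hd]; linarith
  obtain ⟨θ, hθ, hθd, hlim⟩ := exists_mollifier_seq hd0
  set K := Metric.closedBall c (r + d + d) with hKdef
  set B := Metric.ball c r with hB
  have hK : K ⊆ Metric.ball c R := Metric.closedBall_subset_ball (by rw [hd]; linarith)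
  have hBK : B ⊆ K := Metric.ball_subset_closedBall.trans
      (Metric.closedBall_subset_closedBall (by linarith))
  have hv (i : Fin 3) := memLp_indicator_of_locL2 (hu i) hK (isCompact_closedBall _ _)
  set v : Fin 3 → E3 → ℂ := fun i => K.indicator (u i) with hvdef
  have hvu (i : Fin 3) : ∀ y ∈ K, v i y = u i y := fun y hy => indicator_of_mem hy _
  have hvl (i : Fin 3) : LocallyIntegrable (v i) := (hv i).locallyIntegrable (by norm_num)
  have hmem (n : ℕ) {y w : E3} (hy : y ∈ Metric.ball c (r + d)) (hw : y - w ∈ tsupport (θ n)) :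
      w ∈ K := mem_closedBall_of_sub_mem hy ((hθd n).tsupport_subset hw)
  set g : ℕ → Fin 3 → E3 → ℂ := fun n i => mollify (θ n) (v i) with hgdef
  have hg (n : ℕ) (i : Fin 3) : ContDiff ℝ ∞ (g n i) :=
    contDiff_mollify (hθ n).smooth (hθ n).compact (hvl i)
  have hpot (n : ℕ) : ∃ p, ∀ y ∈ Metric.ball c (r + d), HasFDerivAt p (oneForm (g n) y) y :=
    exists_smooth_potential Metric.isOpen_ball (convex_ball _ _) (hg n) fun y hy i j =>
      fderiv_mollify_curlFree (hθ n).smooth (hθ n).compact hvl hcurl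
        (fun w hw => hK (hmem n hy hw)) (fun i w hw => hvu i w (hmem n hy hw)) i j
  choose q hq using hpot
  have hfin : IsFiniteMeasure (volume.restrict B) :=
    ⟨by rw [Measure.restrict_apply_univ]; exact measure_ball_lt_top⟩
  have hLq (n : ℕ) : LocL2 (Metric.ball c (r + d)) (q n) := LocL2.of_continuousOn
    fun y hy => (hq n y hy).continuousAt.continuousWithinAt
  have hcl : Metric.closedBall c r ⊆ Metric.ball c (r + d) :=
    Metric.closedBall_subset_ball (by linarith)
  have hqB (n : ℕ) : MemLp (q n) 2 (volume.restrict B) :=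
    (hLq n _ hcl (isCompact_closedBall _ _)).mono_measure
      (Measure.restrict_mono Metric.ball_subset_closedBall le_rfl)
  have hqi (n : ℕ) : IntegrableOn (q n) B := (hqB n).integrable (by norm_num)
  -- With zero mean on the ball, the Poincaré inequality bounds differences of potentials by
  -- differences of fields, so the sequence is Cauchy in L².
  set P : ℕ → E3 → ℂ := fun n y => q n y - ⨍ z in B, q n z with hPdef
  have hPL (n : ℕ) : MemLp (P n) 2 (volume.restrict B) := (hqB n).sub (memLp_const _)
  have hPderiv (n : ℕ) : ∀ y ∈ B, HasFDerivAt (P n) (oneForm (g n) y) y := fun y hy =>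
    (hq n y (Metric.ball_subset_ball (by linarith) hy)).sub_const _
  have hconv (i : Fin 3) : Tendsto (fun n => eLpNorm (fun y => g n i y - v i y) 2 volume)
      atTop (𝓝 0) := tendsto_mollify hθ hlim (hv i)
  set a : ℕ → ℝ≥0∞ := fun n => ENNReal.ofReal (6 * r) *
    ∑ i, eLpNorm (fun y => g n i y - v i y) 2 volume with hadef
  have ha : Tendsto a atTop (𝓝 0) := by
    have h1 : Tendsto (fun n => ∑ i, eLpNorm (fun y => g n i y - v i y) 2 volume) atTop
        (𝓝 (∑ _i : Fin 3, 0)) := tendsto_finsetSum _ fun i _ => hconv i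
    have h2 := ENNReal.Tendsto.const_mul (a := ENNReal.ofReal (6 * r)) h1
      (.inr ENNReal.ofReal_ne_top)
    simpa only [Finset.sum_const_zero, mul_zero] using h2
  have hcauchy (n m : ℕ) : eLpNorm (fun y => P n y - P m y) 2 (volume.restrict B)
      ≤ a n + a m := by
    have hpd : ∀ y ∈ Metric.ball c (r + d), HasFDerivAt (fun y => q n y - q m y)
        (oneForm (fun i y => g n i y - g m i y) y) y := fun y hy => by
      have e : oneForm (fun i y => g n i y - g m i y) y = oneForm (g n) y - oneForm (g m) y :=
        clm_ext_single fun i => by simp [oneForm_single]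
      rw [e]
      exact (hq n y hy).sub (hq m y hy)
    have hpc := poincare_ball (c := c) (r := r) (by linarith) hr
      (fun i => (hg n i).continuous.sub (hg m i).continuous) hpd
    have e1 : (fun y => P n y - P m y)
        = fun y => (q n y - q m y) - ⨍ z in B, (q n z - q m z) := by
      funext y
      have : ⨍ z in B, (q n z - q m z) = (⨍ z in B, q n z) - ⨍ z in B, q m z := by
        rw [setAverage_eq, setAverage_eq, setAverage_eq, integral_sub (hqi n) (hqi m), smul_sub]
      rw [this, hPdef]; ring
    rw [e1]
    refine hpc.trans ?_
    rw [hadef]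
    simp only
    rw [← mul_add, ← Finset.sum_add_distrib]
    gcongr with i
    calc _ ≤ eLpNorm (fun y => g n i y - g m i y) 2 volume :=
          eLpNorm_mono_measure _ Measure.restrict_le_self
      _ = eLpNorm ((fun y => g n i y - v i y) - fun y => g m i y - v i y) 2 volume := by
          congr 1; funext y; simp
      _ ≤ _ := eLpNorm_sub_le ((hg n i).continuous.aestronglyMeasurable.sub (hv i).1)
          ((hg m i).continuous.aestronglyMeasurable.sub (hv i).1) (by norm_num)
  obtain ⟨p, hp, hpt⟩ := exists_tendsto_of_eLpNorm_sub_le hPL hcauchy ha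
  have hgB (n : ℕ) (i : Fin 3) : MemLp (g n i) 2 (volume.restrict B) :=
    (LocL2.of_continuous (U := univ) (hg n i).continuous _ (subset_univ _)
      (isCompact_closedBall c r)).mono_measure
      (Measure.restrict_mono Metric.ball_subset_closedBall le_rfl)
  have huB (i : Fin 3) : MemLp (u i) 2 (volume.restrict B) :=
    (hu i K hK (isCompact_closedBall _ _)).mono_measure (Measure.restrict_mono hBK le_rfl)
  refine ⟨p, fun L hL _ => hp.mono_measure (Measure.restrict_mono hL le_rfl),
    fun i L hL _ => (huB i).mono_measure (Measure.restrict_mono hL le_rfl), fun i => ?_⟩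
  refine HasWeakPartial.of_tendsto
    (fun n => (HasGrad.of_hasFDerivAt (fun i => (hg n i).continuous) (hPderiv n)).weak i)
    hp (huB i) hPL (fun n => hgB n i) hpt ?_
  refine (tendsto_eLpNorm_restrict (B := B) Measure.restrict_le_self (hconv i)).congr fun n => ?_
  exact eLpNorm_sub_congr measurableSet_ball fun y hy => hvu i y (hBK hy)

end LocalPotential

/-! ### From local to global potentials on simply connected sets. -/

section Cocycle

lemma HasGrad.const (U : Set E3) (k : ℂ) : HasGrad U (fun _ => k) fun _ _ => 0 := by
  refine HasGrad.of_hasFDerivAt (fun _ => continuous_const) fun y _ => ?_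
  have : oneForm (fun _ _ => 0) y = 0 := clm_ext_single fun i => by simp [oneForm_single]
  rw [this]
  exact hasFDerivAt_const k y

/-- A locally constant cocycle on a simply connected space is a coboundary. -/
theorem exists_primitive_of_cocycle {X G : Type*} [TopologicalSpace X] [SimplyConnectedSpace X]
    [LocallyPathConnectedSpace X] [AddCommGroup G] (B : X → Set X) (hB : ∀ x, IsOpen (B x))
    (hmem : ∀ x, x ∈ B x) (hconn : ∀ x, IsPreconnected (B x)) (c : X → X → G)
    (hc : ∀ x y z, (B x ∩ B y ∩ B z).Nonempty → c x y + c y z = c x z) :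
    ∃ a : X → G, ∀ x, ∀ y ∈ B x, a y = a x + c x y := by
  -- With discrete fibre, the bundle glued from the cocycle is a covering, and a continuous section
  -- of it is the required coboundary.
  let _ : TopologicalSpace G := ⊥
  have : DiscreteTopology G := ⟨rfl⟩
  have hself (x : X) : c x x = 0 := by
    have := hc x x x ⟨x, ⟨hmem x, hmem x⟩, hmem x⟩
    simpa using this
  let Z : FiberBundleCore X X G :=
    { baseSet := B
      isOpen_baseSet := hB
      indexAt := id
      mem_baseSet_at := hmem
      coordChange := fun i j _ v => v + c i j
      coordChange_self := fun i x _ v => by rw [hself, add_zero]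
      continuousOn_coordChange := fun i j =>
        ((continuous_of_discreteTopology (f := fun v : G => v + c i j)).comp
          continuous_snd).continuousOn
      coordChange_comp := fun i j k x hx v => by
        rw [add_assoc, hc i j k ⟨x, hx⟩] }
  have hcov : IsCoveringMap Z.proj := IsFiberBundle.isCoveringMap fun x =>
    ⟨Z.localTrivAt x, hmem x⟩
  obtain ⟨x0⟩ : Nonempty X := inferInstance
  -- Simple connectedness enters here: the identity of the base lifts to the covering.
  obtain ⟨σ, ⟨-, hσ⟩, -⟩ := hcov.existsUnique_continuousMap_lifts (ContinuousMap.id X) x0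
    (⟨x0, (0 : G)⟩ : Z.TotalSpace) rfl
  have hproj (y : X) : (σ y).1 = y := congrFun hσ y
  let a : X → G := fun y => (σ y).2
  have happ (x y : X) : (Z.localTriv x (σ y)).2 = a y + c y x := by
    change (show G from (σ y).2) + c (σ y).1 x = _
    rw [hproj]
  refine ⟨a, fun x y hy => ?_⟩
  -- This is the section read in the chart at `x`. It is continuous with discrete values on a
  -- connected set, hence equal to its value `a x` at the centre.
  have hcont : ContinuousOn (fun y => a y + c y x) (B x) := by
    have h1 : ContinuousOn (fun y => (Z.localTriv x (σ y)).2) (B x) := by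
      refine continuous_snd.comp_continuousOn ?_
      refine (Z.localTriv x).continuousOn.comp σ.continuous.continuousOn fun y hy => ?_
      rw [(Z.localTriv x).mem_source]
      change (σ y).1 ∈ B x
      rwa [hproj]
    exact h1.congr fun y _ => (happ x y).symm
  have := (hconn x).constant hcont hy (hmem x)
  simp only [hself, add_zero] at this
  rw [← this, add_assoc, hc y x y ⟨y, ⟨hmem y, hy⟩, hmem y⟩, hself, add_zero]

/-- On a simply connected open set, every curl-free field which is locally square integrable is a
gradient. -/
theorem exists_hasGrad_of_isSimplyConnected {U : Set E3} (hU : IsOpen U)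
    (hsc : IsSimplyConnected U) {u : Fin 3 → E3 → ℂ} (hu : ∀ i, LocL2 U (u i))
    (hcurl : CurlFree U u) : ∃ ψ, HasGrad U ψ u := by
  have hloc (x : U) : ∃ r > 0, Metric.ball (x : E3) r ⊆ U ∧
      ∃ p, HasGrad (Metric.ball (x : E3) r) p u := by
    obtain ⟨R, hR, hRU⟩ := Metric.isOpen_iff.1 hU x x.2
    exact ⟨R / 2, by positivity, (Metric.ball_subset_ball (by linarith)).trans hRU,
      exists_hasGrad_ball (by positivity) (by linarith) (fun i => (hu i).mono hRU)
        (hcurl.mono hRU)⟩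
  choose r hr hrU p hp using hloc
  have hdiff (x y : U) : ∃ k, ∀ᵐ z ∂(volume.restrict
      (Metric.ball (x : E3) (r x) ∩ Metric.ball (y : E3) (r y))), p x z - p y z = k := by
    refine ae_const_of_zero_grad (Metric.isOpen_ball.inter Metric.isOpen_ball)
      ((convex_ball _ _).inter (convex_ball _ _)).isPreconnected ?_
    have := ((hp x).mono inter_subset_left).sub
      ((hp y).mono (inter_subset_right (s := Metric.ball (x : E3) (r x))))
    simpa using this
  choose c hc using hdiff
  have : SimplyConnectedSpace U := hsc.simplyConnectedSpace
  have : LocallyPathConnectedSpace U := hU.locallyPathConnectedSpace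
  have hcoc (x y z : U) (hne : (Metric.ball (x : E3) (r x) ∩ Metric.ball (y : E3) (r y) ∩
      Metric.ball (z : E3) (r z)).Nonempty) : c x y + c y z = c x z := by
    refine eq_of_ae_eq_of_isOpen ((Metric.isOpen_ball.inter Metric.isOpen_ball).inter
      Metric.isOpen_ball) hne ?_
    filter_upwards [ae_restrict_of_ae_restrict_of_subset inter_subset_left (hc x y),
      ae_restrict_of_ae_restrict_of_subset (inter_subset_inter_left _ inter_subset_right) (hc y z),
      ae_restrict_of_ae_restrict_of_subset (inter_subset_inter_left _ inter_subset_left) (hc x z)]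
      with w h1 h2 h3
    rw [← h1, ← h2, ← h3]; ring
  obtain ⟨a, ha⟩ := exists_primitive_of_cocycle
    (fun x : U => ((↑) : U → E3) ⁻¹' Metric.ball (x : E3) (r x))
    (fun x => Metric.isOpen_ball.preimage continuous_subtype_val)
    (fun x => Metric.mem_ball_self (hr x))
    (fun x => by
      refine Topology.IsInducing.subtypeVal.isPreconnected_image.1 ?_
      rw [Subtype.image_preimage_coe, inter_eq_right.2 (hrU x)]
      exact (convex_ball _ _).isPreconnected)
    c (fun x y z ⟨w, hw⟩ => hcoc x y z ⟨w, hw⟩)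
  have hagree (x y : U) : ∀ᵐ z ∂(volume.restrict
      (Metric.ball (x : E3) (r x) ∩ Metric.ball (y : E3) (r y))), p x z + a x = p y z + a y := by
    rcases (Metric.ball (x : E3) (r x) ∩ Metric.ball (y : E3) (r y)).eq_empty_or_nonempty
      with he | ⟨w, hw⟩
    · rw [he]; simp
    · have hwU : w ∈ U := hrU x hw.1
      have e1 := ha x ⟨w, hwU⟩ hw.1
      have e2 := ha y ⟨w, hwU⟩ hw.2
      have e3 := hcoc x y ⟨w, hwU⟩ ⟨w, hw, Metric.mem_ball_self (hr _)⟩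
      filter_upwards [hc x y] with z hz
      linear_combination hz - e1 + e2 + e3
  -- The corrected potentials agree only almost everywhere on overlaps. A countable subcover keeps
  -- the total exceptional set null, so any choice of ball at each point defines the same function
  -- almost everywhere.
  obtain ⟨T, hT, hTU⟩ := TopologicalSpace.isOpen_iUnion_countable
    (fun x : U => Metric.ball (x : E3) (r x)) fun _ => Metric.isOpen_ball
  have hall : ∀ᵐ z, ∀ x ∈ T, ∀ y ∈ T, z ∈ Metric.ball (x : E3) (r x) ∩ Metric.ball (y : E3) (r y) →
      p x z + a x = p y z + a y := by
    rw [ae_ball_iff hT]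
    intro x _
    rw [ae_ball_iff hT]
    intro y _
    exact (ae_restrict_iff' (Metric.isOpen_ball.inter Metric.isOpen_ball).measurableSet).1
      (hagree x y)
  classical
  let ψ : E3 → ℂ := fun z =>
    if h : ∃ x, x ∈ T ∧ z ∈ Metric.ball (x : E3) (r x) then p h.choose z + a h.choose else 0
  refine ⟨ψ, HasGrad.of_local fun z hz => ?_⟩
  have hz' : z ∈ ⋃ x ∈ T, Metric.ball (x : E3) (r x) := by
    rw [hTU]
    exact mem_iUnion.2 ⟨⟨z, hz⟩, Metric.mem_ball_self (hr _)⟩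
  simp only [mem_iUnion] at hz'
  obtain ⟨x, hxT, hzx⟩ := hz'
  refine ⟨_, Metric.isOpen_ball, hzx, ?_⟩
  have h1 : HasGrad (Metric.ball (x : E3) (r x)) (fun z => p x z + a x) u := by
    have := (hp x).add (HasGrad.const _ (a x))
    simpa using this
  refine (h1.congr Metric.isOpen_ball (ψ' := ψ) ?_ fun i => .rfl).mono inter_subset_right
  filter_upwards [ae_restrict_of_ae hall, ae_restrict_mem measurableSet_ball] with w hw hwx
  have hex : ∃ x, x ∈ T ∧ w ∈ Metric.ball (x : E3) (r x) := ⟨x, hxT, hwx⟩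
  have : ψ w = p hex.choose w + a hex.choose := dif_pos hex
  rw [this]
  exact hw x hxT _ hex.choose_spec.1 ⟨hwx, hex.choose_spec.2⟩

end Cocycle

/-! ### Lipschitz maps: volume distortion and weak differentiability. -/

section Lipschitz

open Filter

/-- Lebesgue measure is a multiple of three-dimensional Hausdorff measure, which a Lipschitz map
multiplies by at most the cube of its constant. -/
lemma volume_image_le_of_lipschitz {f : E3 → E3} {M : NNReal} (hf : LipschitzWith M f)
    (s : Set E3) : volume (f '' s) ≤ M ^ 3 * volume s := by
  have h1 : (volume : Measure E3) = _ := Measure.isAddLeftInvariant_eq_smul volume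
    (Measure.hausdorffMeasure (Module.finrank ℝ E3 : ℝ))
  have h2 := hf.hausdorffMeasure_image_le (d := (Module.finrank ℝ E3 : ℝ)) (by positivity) s
  have h3 : (M : ℝ≥0∞) ^ (Module.finrank ℝ E3 : ℝ) = M ^ 3 := by
    rw [finrank_euclideanSpace_fin]; exact ENNReal.rpow_natCast _ 3
  rw [h3] at h2
  rw [h1]
  simp only [Measure.smul_apply]
  rw [mul_smul_comm]
  gcongr

/-- Lipschitz functions have weak derivatives, given by the classical derivative a.e. -/
lemma hasWeakPartial_of_lipschitz {f : E3 → ℂ} {C : NNReal} (hf : LipschitzWith C f) (i : Fin 3) :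
    HasWeakPartial univ i f fun y => fderiv ℝ f y (EuclideanSpace.single i 1) := by
  intro φ hφ
  obtain ⟨D, hD⟩ := hφ.smooth.lipschitzWith_of_hasCompactSupport hφ.compact (by simp)
  set e : E3 := EuclideanSpace.single i 1 with he
  have hre : LipschitzWith C fun y => (f y).re := by
    refine LipschitzWith.of_dist_le_mul fun y z => ?_
    rw [Real.dist_eq, ← Complex.sub_re]
    refine (Complex.abs_re_le_norm _).trans ?_
    rw [← dist_eq_norm]
    exact hf.dist_le_mul y z
  have him : LipschitzWith C fun y => (f y).im := by
    refine LipschitzWith.of_dist_le_mul fun y z => ?_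
    rw [Real.dist_eq, ← Complex.sub_im]
    refine (Complex.abs_im_le_norm _).trans ?_
    rw [← dist_eq_norm]
    exact hf.dist_le_mul y z
  -- Integration by parts holds for the line derivatives of real Lipschitz functions, and
  -- Rademacher's theorem identifies these with the full derivative almost everywhere. The complex
  -- case follows from real and imaginary parts.
  have key {h : E3 → ℝ} (hh : LipschitzWith C h) :
      ∫ y, partialDeriv i φ y * h y = -∫ y, φ y * fderiv ℝ h y e := by
    have h1 := hh.integral_lineDeriv_mul_eq (μ := volume) hD hφ.compact e
    have h2 : ∫ y, lineDeriv ℝ h y e * φ y = ∫ y, φ y * fderiv ℝ h y e := by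
      refine integral_congr_ae ?_
      filter_upwards [hh.ae_differentiableAt (μ := volume)] with y hy
      rw [hy.lineDeriv_eq_fderiv, mul_comm]
    have h3 : ∫ y, lineDeriv ℝ φ y (-e) * h y = -∫ y, partialDeriv i φ y * h y := by
      rw [← integral_neg]
      refine integral_congr_ae (.of_forall fun y => ?_)
      simp only [(hφ.differentiable y).lineDeriv_eq_fderiv, map_neg, neg_mul, partialDeriv, he]
    rw [← h2, h1, h3, neg_neg]
  have hsplit : ∀ᵐ y, fderiv ℝ f y e
      = (fderiv ℝ (fun y => (f y).re) y e : ℂ) + Complex.I * (fderiv ℝ (fun y => (f y).im) y e : ℂ) := by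
    filter_upwards [hf.ae_differentiableAt (μ := volume)] with y hy
    have e1 : fderiv ℝ (fun y => (f y).re) y e = (fderiv ℝ f y e).re := by
      have h := (Complex.reCLM.hasFDerivAt.comp y hy.hasFDerivAt).fderiv
      change fderiv ℝ (⇑Complex.reCLM ∘ f) y e = _
      rw [h]; rfl
    have e2 : fderiv ℝ (fun y => (f y).im) y e = (fderiv ℝ f y e).im := by
      have h := (Complex.imCLM.hasFDerivAt.comp y hy.hasFDerivAt).fderiv
      change fderiv ℝ (⇑Complex.imCLM ∘ f) y e = _
      rw [h]; rfl
    rw [e1, e2, mul_comm, Complex.re_add_im]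
  have hb {h : E3 → ℝ} (hh : LipschitzWith C h) : Integrable fun y => φ y * fderiv ℝ h y e := by
    refine (hφ.continuous.integrable_of_hasCompactSupport hφ.compact).mul_bdd (c := C * ‖e‖)
      (measurable_fderiv_apply_const ℝ h e).aestronglyMeasurable (.of_forall fun y => ?_)
    exact ((fderiv ℝ h y).le_opNorm e).trans
      (mul_le_mul_of_nonneg_right (norm_fderiv_le_of_lipschitz ℝ hh) (norm_nonneg _))
  have ha {h : E3 → ℝ} (hh : LipschitzWith C h) : Integrable fun y => partialDeriv i φ y * h y :=
    ((hφ.partialDeriv i).continuous.mul hh.continuous).integrable_of_hasCompactSupport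
      (hφ.partialDeriv i).compact.mul_right
  have l1 : ∫ y, (partialDeriv i φ y : ℂ) * f y = ((∫ y, partialDeriv i φ y * (f y).re : ℝ) : ℂ)
      + Complex.I * ((∫ y, partialDeriv i φ y * (f y).im : ℝ) : ℂ) := by
    rw [← integral_complex_ofReal, ← integral_complex_ofReal, ← integral_const_mul,
      ← integral_add (ha hre).ofReal ((ha him).ofReal.const_mul _)]
    refine integral_congr_ae (.of_forall fun y => ?_)
    simp only [Complex.ofReal_mul]
    conv_lhs => rw [← Complex.re_add_im (f y)]
    ring
  have l2 : ∫ y, (φ y : ℂ) * fderiv ℝ f y e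
      = ((∫ y, φ y * fderiv ℝ (fun y => (f y).re) y e : ℝ) : ℂ)
      + Complex.I * ((∫ y, φ y * fderiv ℝ (fun y => (f y).im) y e : ℝ) : ℂ) := by
    rw [← integral_complex_ofReal, ← integral_complex_ofReal, ← integral_const_mul,
      ← integral_add (hb hre).ofReal ((hb him).ofReal.const_mul _)]
    refine integral_congr_ae ?_
    filter_upwards [hsplit] with y hy
    rw [hy]
    simp only [Complex.ofReal_mul]
    ring
  rw [l1, l2, key hre, key him]
  push_cast
  ring

end Lipschitz

/-! ### Height functions and the folding across a Lipschitz graph. -/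

section Height

/-- `S` is, in the ball of centre `x` and radius `r`, the sublevel set of a Lipschitz height
function `G` that increases with unit speed in the direction `e`. -/
structure IsHeight (S : Set E3) (x : E3) (r : ℝ) (e : E3) (G : E3 → ℝ) (K : NNReal) : Prop where
  r_pos : 0 < r
  norm_e : ‖e‖ = 1
  shift : ∀ y (t : ℝ), G (y + t • e) = G y + t
  lipschitz : LipschitzWith K G
  one_le : 1 ≤ K
  zero : G x = 0
  mem_iff : ∀ y ∈ Metric.ball x r, y ∈ S ↔ G y ≤ 0

/-- `G` is the signed vertical distance to the graph in the adapted coordinates, and `e` is their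
vertical unit vector. At a boundary point `G` vanishes: closedness of `S` gives one inequality, and
a strictly negative value would put a neighbourhood inside `S`. -/
lemma HasLipschitzBoundary.exists_isHeight {S : Set E3} (hS : HasLipschitzBoundary S)
    (hcl : IsClosed S) {x : E3} (hx : x ∈ frontier S) : ∃ r e G K, IsHeight S x r e G K := by
  obtain ⟨r, hr, L, g, ⟨K, hg⟩, hmem⟩ := hS x hx
  set G : E3 → ℝ := fun y => L y 2 - g !₂[L y 0, L y 1] with hG
  have hcoord (i : Fin 3) : LipschitzWith 1 fun y => L y i := by
    refine LipschitzWith.of_dist_le_mul fun y z => ?_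
    rw [Real.dist_eq, NNReal.coe_one, one_mul, ← L.dist_map y z, dist_eq_norm]
    exact PiLp.norm_apply_le (L y - L z) i
  have hpair : LipschitzWith 1 fun y => (!₂[L y 0, L y 1] : EuclideanSpace ℝ (Fin 2)) := by
    refine LipschitzWith.of_dist_le_mul fun y z => ?_
    rw [NNReal.coe_one, one_mul, ← L.dist_map y z, EuclideanSpace.dist_eq, EuclideanSpace.dist_eq]
    refine Real.sqrt_le_sqrt ?_
    rw [Fin.sum_univ_two, Fin.sum_univ_three]
    simp
  have hGl : LipschitzWith (1 + K) G := by
    refine ((hcoord 2).sub (hg.comp hpair)).weaken ?_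
    simp
  have hGx : G x = 0 := by
    have hxb : x ∈ Metric.ball x r := Metric.mem_ball_self hr
    have h1 : G x ≤ 0 := by
      have hxS : x ∈ S := hcl.closure_eq ▸ hx.1
      have := (hmem x hxb).1 hxS
      simp only [hG]; linarith
    refine le_antisymm h1 (not_lt.1 fun h2 => hx.2 ?_)
    rw [mem_interior_iff_mem_nhds]
    filter_upwards [Metric.ball_mem_nhds x hr, hGl.continuous.continuousAt.eventually (gt_mem_nhds h2)]
      with y hy hy2
    refine (hmem y hy).2 ?_
    simp only [hG] at hy2; linarith
  refine ⟨r, L.symm (EuclideanSpace.single 2 1), G, 1 + K, hr, by simp, fun y t => ?_, hGl,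
    by simp, hGx, fun y hy => ?_⟩
  · simp [hG]
    ring
  · rw [hmem y hy]
    simp only [hG]
    constructor <;> intro h <;> linarith

variable {S : Set E3} {x : E3} {r : ℝ} {e : E3} {G : E3 → ℝ} {K : NNReal}

/-- The folding of `{G < 0}` onto `{G > 0}`. -/
noncomputable def foldUp (e : E3) (G : E3 → ℝ) (y : E3) : E3 := y + (2 * max (-G y) 0) • e

lemma foldUp_of_nonneg {y : E3} (h : 0 ≤ G y) : foldUp e G y = y := by
  simp [foldUp, h]

lemma IsHeight.foldUp_self (h : IsHeight S x r e G K) : foldUp e G x = x :=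
  foldUp_of_nonneg h.zero.ge

lemma IsHeight.height_foldUp (h : IsHeight S x r e G K) (y : E3) : 0 ≤ G (foldUp e G y) := by
  rw [foldUp, h.shift]
  rcases le_total 0 (G y) with h0 | h0
  · simp [h0]
  · rw [max_eq_left (by linarith)]; linarith

lemma IsHeight.lipschitz_foldUp (h : IsHeight S x r e G K) :
    LipschitzWith (1 + 2 * K) (foldUp e G) := by
  refine LipschitzWith.of_dist_le_mul fun y z => ?_
  have h1 : |max (-G y) 0 - max (-G z) 0| ≤ K * dist y z := by
    refine (abs_max_sub_max_le_abs _ _ _).trans ?_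
    have := h.lipschitz.dist_le_mul y z
    rw [Real.dist_eq] at this
    rwa [neg_sub_neg, abs_sub_comm]
  rw [dist_eq_norm]
  have h2 : foldUp e G y - foldUp e G z
      = (y - z) + (2 * (max (-G y) 0 - max (-G z) 0)) • e := by
    simp only [foldUp]; module
  rw [h2]
  refine (norm_add_le _ _).trans ?_
  rw [norm_smul, h.norm_e, mul_one, Real.norm_eq_abs, abs_mul, abs_two, ← dist_eq_norm]
  push_cast
  linarith

/-- The folding is the identity above the graph and the reflection `R` below it. As `R` is an
involution, preimages under it are images, and its Lipschitz constant controls their volume; no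
Jacobian is computed. -/
lemma IsHeight.volume_preimage_foldUp_le (h : IsHeight S x r e G K) (A : Set E3) :
    volume (foldUp e G ⁻¹' A) ≤ (1 + (1 + 2 * K : NNReal) ^ 3 : ℝ≥0∞) * volume A := by
  let R : E3 → E3 := fun y => y - (2 * G y) • e
  have hGR (y : E3) : G (R y) = - G y := by
    have := h.shift y (-(2 * G y))
    rw [neg_smul, ← sub_eq_add_neg] at this
    change G (y - (2 * G y) • e) = _
    rw [this]; ring
  have hRR (y : E3) : R (R y) = y := by
    change R y - (2 * G (R y)) • e = y
    rw [hGR]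
    simp only [R]; module
  have hRl : LipschitzWith (1 + 2 * K) R := by
    refine LipschitzWith.of_dist_le_mul fun y z => ?_
    have h1 := h.lipschitz.dist_le_mul y z
    rw [Real.dist_eq] at h1
    rw [dist_eq_norm]
    have h2 : R y - R z = (y - z) - (2 * (G y - G z)) • e := by
      simp only [R]; module
    rw [h2]
    refine (norm_sub_le _ _).trans ?_
    rw [norm_smul, h.norm_e, mul_one, Real.norm_eq_abs, abs_mul, abs_two, ← dist_eq_norm]
    push_cast
    linarith
  have hsub : foldUp e G ⁻¹' A ⊆ A ∪ R '' A := by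
    intro y hy
    rcases le_total 0 (G y) with h0 | h0
    · left
      rwa [mem_preimage, foldUp_of_nonneg h0] at hy
    · right
      refine ⟨R y, ?_, hRR y⟩
      have : foldUp e G y = R y := by
        simp only [foldUp, R, max_eq_left (show (0 : ℝ) ≤ -G y by linarith)]; module
      rwa [mem_preimage, this] at hy
  calc _ ≤ volume (A ∪ R '' A) := measure_mono hsub
    _ ≤ volume A + volume (R '' A) := measure_union_le _ _
    _ ≤ volume A + (1 + 2 * K : NNReal) ^ 3 * volume A := by
        gcongr
        exact volume_image_le_of_lipschitz hRl A
    _ = _ := by rw [add_mul, one_mul]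

lemma IsHeight.map_foldUp_le (h : IsHeight S x r e G K) :
    Measure.map (foldUp e G) volume ≤ (1 + (1 + 2 * K : NNReal) ^ 3 : ℝ≥0∞) • volume := by
  refine Measure.le_iff.2 fun A hA => ?_
  rw [Measure.map_apply h.lipschitz_foldUp.continuous.measurable hA]
  exact h.volume_preimage_foldUp_le A

/-- Composition with the folding is bounded on `L²`. -/
lemma IsHeight.eLpNorm_comp_foldUp_le (h : IsHeight S x r e G K) {v : E3 → ℂ}
    (hv : AEStronglyMeasurable v volume) :
    AEStronglyMeasurable (fun y => v (foldUp e G y)) volume ∧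
    eLpNorm (fun y => v (foldUp e G y)) 2 volume ≤
      (1 + (1 + 2 * K : NNReal) ^ 3 : ℝ≥0∞) ^ (1 / 2 : ℝ≥0∞).toReal * eLpNorm v 2 volume := by
  have hm : Measurable (foldUp e G) := h.lipschitz_foldUp.continuous.measurable
  have hac : Measure.map (foldUp e G) volume ≪ volume :=
    (Measure.absolutelyContinuous_of_le h.map_foldUp_le).trans
      (Measure.smul_absolutelyContinuous)
  have hv' : AEStronglyMeasurable v (Measure.map (foldUp e G) volume) := hv.mono_ac hac
  refine ⟨hv'.comp_measurable hm, ?_⟩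
  have := eLpNorm_map_measure (p := 2) hv' hm.aemeasurable
  change eLpNorm (v ∘ foldUp e G) 2 volume ≤ _
  rw [← this]
  refine (eLpNorm_mono_measure _ h.map_foldUp_le).trans ?_
  rw [eLpNorm_smul_measure_of_ne_top (by simp), smul_eq_mul]

end Height

/-! ### Pullback of 1-forms by the folding. -/

section Pullback

open Filter

variable {S : Set E3} {x : E3} {r : ℝ} {e : E3} {G : E3 → ℝ} {K : NNReal}

/-- The pullback of a field (seen as a `1`-form) by the folding. -/
noncomputable def pullForm (e : E3) (G : E3 → ℝ) (w : Fin 3 → E3 → ℂ) (i : Fin 3) (y : E3) : ℂ :=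
  ∑ j, ((fderiv ℝ (foldUp e G) y (EuclideanSpace.single i 1) j : ℝ) : ℂ) * w j (foldUp e G y)

lemma IsHeight.norm_fderiv_foldUp_le (h : IsHeight S x r e G K) (i j : Fin 3) (y : E3) :
    ‖((fderiv ℝ (foldUp e G) y (EuclideanSpace.single i 1) j : ℝ) : ℂ)‖ ≤ 1 + 2 * K := by
  rw [Complex.norm_real]
  refine (PiLp.norm_apply_le _ j).trans ?_
  refine ((fderiv ℝ (foldUp e G) y).le_opNorm _).trans ?_
  have := norm_fderiv_le_of_lipschitz ℝ h.lipschitz_foldUp (x₀ := y)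
  simpa using this

lemma measurable_fderiv_foldUp (i j : Fin 3) : Measurable fun y =>
    ((fderiv ℝ (foldUp e G) y (EuclideanSpace.single i 1) j : ℝ) : ℂ) := by
  have h1 := measurable_fderiv_apply_const ℝ (foldUp e G) (EuclideanSpace.single i 1)
  have h2 : Measurable fun z : E3 => z j :=
    (EuclideanSpace.proj (𝕜 := ℝ) j).continuous.measurable
  exact Complex.measurable_ofReal.comp (h2.comp h1)

/-- Composition with the folding is bounded on L² and the derivatives of the folding are bounded.
The constant is chosen before the field, so pullback commutes with L² limits. -/
lemma IsHeight.memLp_pullForm (h : IsHeight S x r e G K) : ∃ D : ℝ≥0∞, D ≠ ⊤ ∧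
    ∀ w : Fin 3 → E3 → ℂ, (∀ j, MemLp (w j) 2) → ∀ i, MemLp (pullForm e G w i) 2 ∧
      eLpNorm (pullForm e G w i) 2 volume ≤ D * ∑ j, eLpNorm (w j) 2 volume := by
  set D1 : ℝ≥0∞ := (1 + (1 + 2 * K : NNReal) ^ 3 : ℝ≥0∞) ^ (1 / 2 : ℝ≥0∞).toReal
  set D2 : ℝ≥0∞ := ENNReal.ofReal (1 + 2 * K)
  have hD1 : D1 ≠ ⊤ := ENNReal.rpow_ne_top_of_nonneg (by simp) (by finiteness)
  refine ⟨D2 * D1, by finiteness, fun w hw i => ?_⟩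
  have hterm (j : Fin 3) :
      AEStronglyMeasurable (fun y => ((fderiv ℝ (foldUp e G) y (EuclideanSpace.single i 1) j : ℝ) : ℂ)
        * w j (foldUp e G y)) volume ∧
      eLpNorm (fun y => ((fderiv ℝ (foldUp e G) y (EuclideanSpace.single i 1) j : ℝ) : ℂ)
        * w j (foldUp e G y)) 2 volume ≤ D2 * D1 * eLpNorm (w j) 2 volume := by
    obtain ⟨h1, h2⟩ := h.eLpNorm_comp_foldUp_le (hw j).aestronglyMeasurable
    refine ⟨(measurable_fderiv_foldUp i j).aestronglyMeasurable.mul h1, ?_⟩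
    rw [mul_assoc]
    refine le_trans ?_ (mul_le_mul_right h2 D2)
    refine eLpNorm_le_mul_eLpNorm_of_ae_le_mul (.of_forall fun y => ?_) 2
    rw [norm_mul]
    exact mul_le_mul_of_nonneg_right (h.norm_fderiv_foldUp_le i j y) (norm_nonneg _)
  have hb : eLpNorm (pullForm e G w i) 2 volume ≤ D2 * D1 * ∑ j, eLpNorm (w j) 2 volume := by
    have h1 : pullForm e G w i = ∑ j, fun y =>
        ((fderiv ℝ (foldUp e G) y (EuclideanSpace.single i 1) j : ℝ) : ℂ) * w j (foldUp e G y) := by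
      ext y; simp [pullForm]
    rw [h1]
    refine (eLpNorm_sum_le (fun j _ => (hterm j).1) (by norm_num)).trans ?_
    rw [Finset.mul_sum]
    exact Finset.sum_le_sum fun j _ => (hterm j).2
  refine ⟨⟨?_, hb.trans_lt ?_⟩, hb⟩
  · exact Finset.aestronglyMeasurable_fun_sum _ fun j _ => (hterm j).1
  · refine ENNReal.mul_lt_top (by finiteness) (ENNReal.sum_lt_top.2 fun j _ => (hw j).2)

/-- The pullback of the gradient of a function of class `C^1` with compact support. -/
lemma IsHeight.hasGrad_comp_foldUp (h : IsHeight S x r e G K) {p : E3 → ℂ}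
    (hp : ContDiff ℝ ∞ p) (hc : HasCompactSupport p) :
    HasGrad univ (fun y => p (foldUp e G y))
      (pullForm e G fun j y => fderiv ℝ p y (EuclideanSpace.single j 1)) := by
  obtain ⟨C, hC⟩ := hp.lipschitzWith_of_hasCompactSupport hc (by simp)
  have hl : LipschitzWith (C * (1 + 2 * K)) fun y => p (foldUp e G y) :=
    hC.comp h.lipschitz_foldUp
  obtain ⟨D, -, hD⟩ := h.memLp_pullForm
  refine ⟨.of_continuous hl.continuous, fun i => ?_, fun i => ?_⟩
  · refine fun Q _ _ => ((hD _ (fun j => ?_) i).1).restrict _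
    have hcont : Continuous fun y => fderiv ℝ p y (EuclideanSpace.single j 1) :=
      (hp.continuous_fderiv (by simp)).clm_apply continuous_const
    refine hcont.memLp_of_hasCompactSupport ?_
    exact (hc.fderiv ℝ).comp_left (g := fun A : E3 →L[ℝ] ℂ => A (EuclideanSpace.single j 1)) rfl
  · refine (hasWeakPartial_of_lipschitz hl i).congr isOpen_univ (by rfl) ?_
    rw [Measure.restrict_univ]
    filter_upwards [h.lipschitz_foldUp.ae_differentiableAt (μ := volume)] with y hy
    have h1 := ((hp.differentiable (by simp)) (foldUp e G y)).hasFDerivAt.comp y hy.hasFDerivAt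
    change fderiv ℝ (p ∘ foldUp e G) y _ = _
    rw [h1.fderiv, ContinuousLinearMap.comp_apply, pullForm]
    set a := fderiv ℝ (foldUp e G) y (EuclideanSpace.single i 1)
    have h2 : a = ∑ j, a j • (EuclideanSpace.single j (1 : ℝ) : E3) := by
      ext k; simp [Fin.sum_univ_three]; fin_cases k <;> simp
    conv_lhs => rw [h2, map_sum]
    refine Finset.sum_congr rfl fun j _ => ?_
    rw [map_smul, Complex.real_smul]

/-- The pullback of a gradient from the region above the graph is curl free. -/
theorem IsHeight.curlFree_pullForm (h : IsHeight S x r e G K) {ψ : E3 → ℂ} {u : Fin 3 → E3 → ℂ}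
    (hψ : HasGrad (Metric.ball x r \ S) ψ u) {w : Fin 3 → E3 → ℂ} (hw : ∀ j, MemLp (w j) 2)
    (hwc : ∀ j, HasCompactSupport (w j))
    (hwu : ∀ j, ∀ y ∈ Metric.ball x r \ S, w j y = u j y) :
    CurlFree (Metric.ball x (r / (4 * (1 + 2 * K)))) (pullForm e G w) := by
  have hr := h.r_pos
  have hK : (1 : ℝ) ≤ K := h.one_le
  set V := Metric.ball x r \ S with hV
  set B := Metric.ball x (r / (4 * (1 + 2 * K))) with hB
  set δ : ℕ → ℝ := fun n => r / 16 / (n + 1) with hδ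
  have hδ0 (n : ℕ) : 0 < δ n := by positivity
  have hδ1 (n : ℕ) : δ n ≤ r / 16 :=
    div_le_self (by positivity) (by linarith [n.cast_nonneg (α := ℝ)])
  have hδt : Tendsto (fun n => 2 * δ n) atTop (𝓝 0) := by
    have h1 : Tendsto (fun n : ℕ => (n : ℝ) + 1) atTop atTop :=
      tendsto_atTop_add_const_right _ _ tendsto_natCast_atTop_atTop
    simpa using ((tendsto_const_nhds (x := r / 16)).div_atTop h1).const_mul 2
  -- The kernels are off-centre: mollification at z averages over the ball with centre z + δe and
  -- radius δ/(2K), where G ≥ G(z) + δ - δ/2. So points with G(z) ≥ 0 see only the region strictly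
  -- above the graph, where ψ is known.
  choose θ hθ using fun n => exists_isMollifier (-(δ n • e)) (r := δ n / (2 * K))
    (div_pos (hδ0 n) (by linarith))
  have hθ0 (n : ℕ) : IsMollifier 0 (2 * δ n) (θ n) := by
    refine (hθ n).mono (Metric.closedBall_subset_closedBall' ?_)
    rw [dist_zero_right, norm_neg, norm_smul, h.norm_e, mul_one, Real.norm_of_nonneg (hδ0 n).le]
    have : δ n / (2 * K) ≤ δ n := div_le_self (hδ0 n).le (by linarith)
    linarith
  set Q : ℕ → Set E3 := fun n => Metric.closedBall x (3 * r / 4) ∩ {y | δ n / 2 ≤ G y} with hQ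
  have hQc (n : ℕ) : IsCompact (Q n) :=
    (isCompact_closedBall _ _).inter_right (isClosed_le continuous_const h.lipschitz.continuous)
  have hQV (n : ℕ) : Q n ⊆ V := by
    rintro y ⟨h1, h2⟩
    have hy : y ∈ Metric.ball x r := Metric.closedBall_subset_ball (by linarith) h1
    refine ⟨hy, fun hyS => ?_⟩
    have := (h.mem_iff y hy).1 hyS
    have h3 : δ n / 2 ≤ G y := h2
    linarith [hδ0 n]
  have hsupp (n : ℕ) (z : E3) (hz : z ∈ Metric.ball x (r / 2)) (hz0 : 0 ≤ G z) (y : E3)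
      (hy : z - y ∈ tsupport (θ n)) : y ∈ Q n := by
    have h1 := (hθ n).tsupport_subset hy
    rw [mem_closedBall_iff_norm, sub_neg_eq_add] at h1
    have h2 : δ n / (2 * K) ≤ δ n := div_le_self (hδ0 n).le (by linarith)
    constructor
    · have e1 : y - x = (z - x) + (δ n • e) - (z - y + δ n • e) := by module
      rw [mem_closedBall_iff_norm, e1]
      have h3 := norm_sub_le ((z - x) + (δ n • e)) (z - y + δ n • e)
      have h4 := norm_add_le (z - x) (δ n • e)
      rw [norm_smul, h.norm_e, mul_one, Real.norm_of_nonneg (hδ0 n).le] at h4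
      rw [mem_ball_iff_norm] at hz
      linarith [hδ1 n]
    · have h3 := h.lipschitz.dist_le_mul (z + δ n • e) y
      rw [Real.dist_eq, h.shift, dist_eq_norm] at h3
      have e1 : z + δ n • e - y = z - y + δ n • e := by module
      rw [e1] at h3
      have h4 : (K : ℝ) * ‖z - y + δ n • e‖ ≤ δ n / 2 := by
        refine (mul_le_mul_of_nonneg_left h1 K.coe_nonneg).trans (le_of_eq ?_)
        have : (K : ℝ) ≠ 0 := by positivity
        field_simp
      have h5 := (abs_le.1 (h3.trans h4)).2
      change δ n / 2 ≤ G y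
      linarith
  have hli (n : ℕ) : LocallyIntegrable ((Q n).indicator ψ) :=
    (memLp_indicator_of_locL2 hψ.locL2 (hQV n) (hQc n)).locallyIntegrable (by norm_num)
  set P : ℕ → E3 → ℂ := fun n => mollify (θ n) ((Q n).indicator ψ) with hP
  have hPs (n : ℕ) : ContDiff ℝ ∞ (P n) := contDiff_mollify (hθ n).smooth (hθ n).compact (hli n)
  have hPc (n : ℕ) : HasCompactSupport (P n) := by
    refine HasCompactSupport.convolution _ (hθ n).compact ?_
    exact HasCompactSupport.intro (hQc n) fun y hy => indicator_of_notMem hy _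
  -- The folding fixes `x` and has Lipschitz constant 1 + 2K, which explains the radius of `B`.
  have hmap (y : E3) (hy : y ∈ B) : foldUp e G y ∈ Metric.ball x (r / 2) := by
    have h1 := h.lipschitz_foldUp.dist_le_mul y x
    rw [h.foldUp_self] at h1
    rw [hB, Metric.mem_ball, lt_div_iff₀ (by linarith)] at hy
    push_cast at h1
    rw [Metric.mem_ball]
    linarith
  have hwl (j : Fin 3) : LocallyIntegrable (w j) := (hw j).locallyIntegrable (by norm_num)
  set W : ℕ → Fin 3 → E3 → ℂ := fun n j => mollify (θ n) (w j) with hW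
  have hWm (n : ℕ) (j : Fin 3) : MemLp (W n j) 2 := by
    refine (contDiff_mollify (hθ n).smooth (hθ n).compact (hwl j)).continuous.memLp_of_hasCompactSupport ?_
    exact HasCompactSupport.convolution _ (hθ n).compact (hwc j)
  -- At the points reached by the folding, `W n` is the gradient of the smooth function `P n`; its
  -- pullback is the gradient of the Lipschitz function obtained by composing `P n` with the
  -- folding.
  have hcf (n : ℕ) : CurlFree B (pullForm e G (W n)) := by
    have h1 := ((h.hasGrad_comp_foldUp (hPs n) (hPc n)).mono (subset_univ B))
    refine h1.curlFree.congr Metric.isOpen_ball h1.grad_locL2 fun i => ?_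
    refine (ae_restrict_mem Metric.isOpen_ball.measurableSet).mono fun y hy => ?_
    refine Finset.sum_congr rfl fun j _ => ?_
    congr 1
    have h2 := hsupp n _ (hmap y hy) (h.height_foldUp y)
    change fderiv ℝ (mollify (θ n) ((Q n).indicator ψ)) (foldUp e G y) _ = _
    rw [fderiv_mollify_of_hasWeakPartial (hθ n).smooth (hθ n).compact (hli n) (hψ.weak j)
      (fun z hz => hQV n (h2 z hz)) (fun z hz => indicator_of_mem (h2 z hz) _)]
    exact mollify_congr fun z hz => (hwu j z (hQV n (h2 z hz))).symm
  obtain ⟨D, hDt, hD⟩ := h.memLp_pullForm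
  refine CurlFree.of_tendsto hcf (fun i => (hD w hw i).1.restrict _)
    (fun n i => (hD (W n) (hWm n) i).1.restrict _) fun i => ?_
  refine tendsto_eLpNorm_restrict (μ := volume) Measure.restrict_le_self ?_
  have hsub (n : ℕ) : (fun y => pullForm e G (W n) i y - pullForm e G w i y)
      = pullForm e G (fun j y => W n j y - w j y) i := by
    ext y; simp [pullForm, mul_sub]
  have ht : Tendsto (fun n => D * ∑ j, eLpNorm (fun y => W n j y - w j y) 2 volume) atTop (𝓝 0) := by
    have h1 := tendsto_finsetSum Finset.univ fun j _ => tendsto_mollify hθ0 hδt (hw j)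
    have := ENNReal.Tendsto.const_mul h1 (a := D) (.inr hDt)
    simpa using this
  refine tendsto_of_tendsto_of_tendsto_of_le_of_le tendsto_const_nhds ht (fun _ => zero_le) fun n => ?_
  rw [hsub]
  exact (hD _ (fun j => (hWm n j).sub (hw j)) i).2

end Pullback

/-! ### Extension of a potential across the boundary of the inclusion. -/

section Extension

variable {S : Set E3} {x : E3} {r : ℝ} {e : E3} {G : E3 → ℝ} {K : NNReal}

lemma IsHeight.pullForm_of_pos (h : IsHeight S x r e G K) (w : Fin 3 → E3 → ℂ) {y : E3}
    (hy : 0 < G y) (i : Fin 3) : pullForm e G w i y = w i y := by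
  have h1 : foldUp e G =ᶠ[𝓝 y] id := by
    filter_upwards [h.lipschitz.continuous.continuousAt.eventually (lt_mem_nhds hy)] with z hz
    exact foldUp_of_nonneg hz.le
  rw [pullForm, h1.fderiv_eq, fderiv_id, foldUp_of_nonneg hy.le]
  simp only [ContinuousLinearMap.id_apply]
  rw [Finset.sum_eq_single i (fun j _ hj => by simp [hj]) (by simp)]
  simp

/-- Rise from `y` along `e`, which only increases the height, then go straight to the lifted centre.
On the ball of radius σ = ρ/(1 + 2K) the height exceeds -Kσ, so a rise of 2Kσ puts the whole shifted
ball above the graph, and σ + 2Kσ = ρ keeps the path in the larger ball. -/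
lemma IsHeight.joinedIn (h : IsHeight S x r e G K) {ρ : ℝ} (hρr : ρ ≤ r)
    {y : E3} (hy : y ∈ Metric.ball x (ρ / (1 + 2 * K)) \ S) :
    JoinedIn (Metric.ball x ρ \ S) y (x + (2 * K * (ρ / (1 + 2 * K))) • e) := by
  have hK : (1 : ℝ) ≤ K := h.one_le
  set σ := ρ / (1 + 2 * K) with hσ
  have hσρ : σ * (1 + 2 * K) = ρ := by rw [hσ]; field_simp
  have hσ0 : 0 < σ := lt_of_le_of_lt dist_nonneg hy.1
  have hρσ : σ ≤ ρ := by nlinarith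
  set s := 2 * K * σ with hs
  have hs0 : 0 < s := by positivity
  have hmem (q : E3) (t : ℝ) (hq : q ∈ Metric.ball x σ) (ht : 0 ≤ t) (hts : t ≤ s)
      (hG : 0 < G q + t) : q + t • e ∈ Metric.ball x ρ \ S := by
    have h1 : q + t • e ∈ Metric.ball x ρ := by
      rw [mem_ball_iff_norm] at hq ⊢
      have e1 : q + t • e - x = (q - x) + t • e := by module
      rw [e1]
      refine (norm_add_le _ _).trans_lt ?_
      rw [norm_smul, h.norm_e, mul_one, Real.norm_of_nonneg ht]
      nlinarith
    refine ⟨h1, fun hS => ?_⟩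
    have := (h.mem_iff _ (Metric.ball_subset_ball hρr h1)).1 hS
    rw [h.shift] at this
    linarith
  have hlow (q : E3) (hq : q ∈ Metric.ball x σ) : 0 < G q + s := by
    have h1 := h.lipschitz.dist_le_mul q x
    rw [h.zero, Real.dist_eq, sub_zero] at h1
    have h2 := (abs_le.1 h1).1
    have h3 : K * dist q x < K * σ := mul_lt_mul_of_pos_left hq (by linarith)
    rw [hs]
    nlinarith
  have hpos : 0 < G y := by
    refine not_le.1 fun h1 => hy.2 ((h.mem_iff y ?_).2 h1)
    exact Metric.ball_subset_ball (hρσ.trans hρr) hy.1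
  refine (JoinedIn.of_segment_subset (y := y + s • e) ?_).trans (JoinedIn.of_segment_subset ?_)
  · rw [segment_eq_image']
    rintro _ ⟨t, ⟨ht0, ht1⟩, rfl⟩
    have e1 : y + t • (y + s • e - y) = y + (t * s) • e := by module
    simp only [e1]
    refine hmem y (t * s) hy.1 (by positivity) (by nlinarith) (by positivity)
  · rw [segment_eq_image']
    rintro _ ⟨t, ht, rfl⟩
    have e1 : y + s • e + t • (x + s • e - (y + s • e)) = (y + t • (x - y)) + s • e := by module
    simp only [e1]
    have h1 : y + t • (x - y) ∈ Metric.ball x σ := by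
      refine (convex_ball x σ).segment_subset hy.1 (Metric.mem_ball_self hσ0) ?_
      rw [segment_eq_image']
      exact ⟨t, ht, rfl⟩
    exact hmem _ s h1 hs0.le le_rfl (hlow _ h1)

/-- Extension of a function with square integrable gradient across a Lipschitz graph. -/
theorem IsHeight.exists_extension (h : IsHeight S x r e G K) (hcl : IsClosed S) {ψ : E3 → ℂ}
    {u : Fin 3 → E3 → ℂ} (hψ : HasGrad (Metric.ball x r \ S) ψ u)
    (hu : ∀ j, MemLp (u j) 2 (volume.restrict (Metric.ball x r))) :
    ∃ ρ > 0, ρ ≤ r ∧ ∃ v g, HasGrad (Metric.ball x ρ) v g ∧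
      v =ᵐ[volume.restrict (Metric.ball x ρ \ S)] ψ := by
  have hr := h.r_pos
  have hK : (1 : ℝ) ≤ K := h.one_le
  set V := Metric.ball x r \ S with hV
  have hVo : IsOpen V := Metric.isOpen_ball.sdiff hcl
  -- The field is folded rather than the potential: `u` is square integrable up to the graph, while
  -- ψ is controlled only on compact subsets of the exterior.
  set w : Fin 3 → E3 → ℂ := fun j => V.indicator (u j) with hw
  have hwm (j : Fin 3) : MemLp (w j) 2 :=
    (memLp_indicator_iff_restrict hVo.measurableSet).2
      ((hu j).mono_measure (Measure.restrict_mono sdiff_subset le_rfl))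
  have hwc (j : Fin 3) : HasCompactSupport (w j) :=
    HasCompactSupport.intro (isCompact_closedBall x r) fun y hy =>
      indicator_of_notMem (fun h' => hy (Metric.ball_subset_closedBall h'.1)) _
  have hcf := h.curlFree_pullForm hψ hwm hwc fun j y hy => indicator_of_mem hy _
  set R := r / (4 * (1 + 2 * K)) with hR
  have hR0 : 0 < R := by positivity
  have hRr : R ≤ r := div_le_self hr.le (by linarith)
  obtain ⟨D, -, hD⟩ := h.memLp_pullForm
  obtain ⟨p, hp⟩ := exists_hasGrad_ball (half_pos hR0) (half_lt_self hR0)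
    (fun i Q _ _ => ((hD w hwm i).1).restrict Q) hcf
  set ρ := R / 2 with hρ
  have hρr : ρ ≤ r := by linarith
  set A := Metric.ball x ρ \ S with hA
  have hAo : IsOpen A := Metric.isOpen_ball.sdiff hcl
  have hAV : A ⊆ V := sdiff_subset_sdiff_left (Metric.ball_subset_ball hρr)
  have hz : HasGrad A (fun y => p y - ψ y) fun _ _ => 0 := by
    refine ((hp.mono sdiff_subset).sub (hψ.mono hAV)).congr hAo (by rfl) fun i => ?_
    refine (ae_restrict_mem hAo.measurableSet).mono fun y hy => ?_
    have hy' : 0 < G y :=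
      not_le.1 fun h1 => hy.2 ((h.mem_iff y (Metric.ball_subset_ball hρr hy.1)).2 h1)
    simp only [h.pullForm_of_pos w hy' i]
    change V.indicator (u i) y - u i y = 0
    rw [indicator_of_mem (hAV hy), sub_self]
  set σ := ρ / (1 + 2 * K) with hσ
  have hρ0 : 0 < ρ := half_pos hR0
  have hσ0 : 0 < σ := by positivity
  have hσρ : σ ≤ ρ := div_le_self hρ0.le (by linarith)
  set b := x + (2 * K * σ) • e with hb
  -- Connectedness of `A` is not available, so p - ψ is shown to be constant only on the path
  -- component of the lifted centre. That component contains a smaller ball minus `S`.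
  set W := pathComponentIn A b with hW
  have hBW : Metric.ball x σ \ S ⊆ W := fun y hy => (h.joinedIn hρr hy).symm
  obtain ⟨k, hk⟩ : ∃ k, ∀ᵐ y ∂(volume.restrict W), p y - ψ y = k := by
    refine ae_const_of_zero_grad (hAo.pathComponentIn b) ?_ (hz.mono pathComponentIn_subset)
    by_cases hbA : b ∈ A
    · exact (isPathConnected_pathComponentIn hbA).isConnected.isPreconnected
    · rw [not_nonempty_iff_eq_empty.1 (mt pathComponentIn_nonempty_iff.1 hbA)]; exact isPreconnected_empty
  refine ⟨σ, hσ0, hσρ.trans hρr, fun y => p y - k, fun i y => pullForm e G w i y - 0,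
    (hp.mono (Metric.ball_subset_ball hσρ)).sub (.const _ k), ?_⟩
  refine (ae_restrict_of_ae_restrict_of_subset hBW hk).mono fun y hy => ?_
  simp only
  rw [← hy]; ring

end Extension

/-! ### Gluing local extensions. -/

section Glue

lemma HasGrad.sum {ι : Type*} {U : Set E3} {v : ι → E3 → ℂ} {g : ι → Fin 3 → E3 → ℂ}
    (F : Finset ι) (h : ∀ a ∈ F, HasGrad U (v a) (g a)) :
    HasGrad U (fun y => ∑ a ∈ F, v a y) fun i y => ∑ a ∈ F, g a i y := by
  classical
  induction F using Finset.induction_on with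
  | empty => simpa using HasGrad.zero U
  | insert a F ha ih =>
    simp only [Finset.sum_insert ha]
    exact (h a (Finset.mem_insert_self a F)).add
      (ih fun b hb => h b (Finset.mem_insert_of_mem hb))

lemma HasGrad.smul_of_tsupport_subset {U B : Set E3} (hU : IsOpen U) {ψ : E3 → ℂ}
    {g : Fin 3 → E3 → ℂ} {χ : E3 → ℝ} (h : HasGrad (U ∩ B) ψ g) (hχ : ContDiff ℝ ∞ χ)
    (hB : IsOpen B) (hs : tsupport χ ⊆ B) :
    HasGrad U (fun y => (χ y : ℂ) * ψ y)
      (fun i y => (χ y : ℂ) * g i y + (partialDeriv i χ y : ℂ) * ψ y) := by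
  refine .of_local fun x hx => ?_
  by_cases hxB : x ∈ B
  · exact ⟨B, hB, hxB, h.smul hχ⟩
  · have ho : IsOpen (tsupport χ)ᶜ := (isClosed_tsupport χ).isOpen_compl
    have hm : ∀ᵐ y ∂(volume.restrict (U ∩ (tsupport χ)ᶜ)), y ∉ tsupport χ :=
      (ae_restrict_mem (hU.inter ho).measurableSet).mono fun y hy => hy.2
    refine ⟨_, ho, fun h' => hxB (hs h'), (HasGrad.zero _).congr (hU.inter ho) ?_ fun i => ?_⟩
    · exact hm.mono fun y hy => by simp [image_eq_zero_of_notMem_tsupport hy]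
    · refine hm.mono fun y hy => ?_
      have h1 := image_eq_zero_of_notMem_tsupport fun h' => hy (tsupport_partialDeriv_subset χ i h')
      simp [image_eq_zero_of_notMem_tsupport hy, h1]

/-- Gluing of local functions with square integrable gradients that agree with a given function
on a smaller open set. -/
theorem HasGrad.exists_glue {U W : Set E3} (hU : IsOpen U) (hW : IsOpen W) {B : E3 → Set E3}
    (hB : ∀ x, IsOpen (B x)) (hmem : ∀ x, x ∈ B x) {v : E3 → E3 → ℂ} {g : E3 → Fin 3 → E3 → ℂ}
    (h : ∀ x, HasGrad (U ∩ B x) (v x) (g x)) {ψ : E3 → ℂ}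
    (hv : ∀ x, v x =ᵐ[volume.restrict (W ∩ B x)] ψ) :
    ∃ ψ' g', HasGrad U ψ' g' ∧ ψ' =ᵐ[volume.restrict W] ψ := by
  obtain ⟨f, hf⟩ := SmoothPartitionOfUnity.exists_isSubordinate 𝓘(ℝ, E3)
    (isClosed_univ (X := E3)) B hB fun y _ => mem_iUnion.2 ⟨y, hmem y⟩
  have hsm (a : E3) : ContDiff ℝ ∞ (f a) := (f a).contMDiff.contDiff
  have hloc (y : E3) : ∃ N, IsOpen N ∧ y ∈ N ∧ ∃ F : Finset E3, ∀ z ∈ N, ∀ a ∉ F,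
      f a z = 0 ∧ ∀ i, partialDeriv i (f a) z = 0 := by
    obtain ⟨N, hN, hfin⟩ := f.locallyFinite y
    obtain ⟨N', hN', ho, hy⟩ := mem_nhds_iff.1 hN
    refine ⟨N', ho, hy, hfin.toFinset, fun z hz a ha => ?_⟩
    have h0 : ∀ z ∈ N', f a z = 0 := fun z hz => by
      by_contra hne
      exact ha (hfin.mem_toFinset.2 ⟨z, hne, hN' hz⟩)
    refine ⟨h0 z hz, fun i => ?_⟩
    have h1 : (f a : E3 → ℝ) =ᶠ[𝓝 z] fun _ => 0 := by
      filter_upwards [ho.mem_nhds hz] with w hw using h0 w hw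
    rw [partialDeriv, h1.fderiv_eq]
    simp
  -- The weights sum to one, so the glued function equals ψ wherever the pieces do. The sums are
  -- locally finite, and the second one is given by the product rule.
  refine ⟨fun y => ∑ᶠ a, (f a y : ℂ) * v a y, fun i y => ∑ᶠ a,
    ((f a y : ℂ) * g a i y + (partialDeriv i (f a) y : ℂ) * v a y), .of_local fun x _ => ?_,
    ae_restrict_of_local hW fun x _ => ?_⟩
  · obtain ⟨N, hN, hx, F, hF⟩ := hloc x
    refine ⟨N, hN, hx, ?_⟩
    have h1 := HasGrad.sum F fun a _ => ((h a).smul_of_tsupport_subset hU (hsm a) (hB a) (hf a)).mono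
      (inter_subset_left (t := N))
    have hm := ae_restrict_mem (μ := volume) (hU.inter hN).measurableSet
    refine h1.congr (hU.inter hN) (hm.mono fun y hy => ?_) fun i => hm.mono fun y hy => ?_
    · refine (finsum_eq_sum_of_support_subset _ fun a ha => ?_).symm
      by_contra h'
      exact ha (by simp [(hF y hy.2 a h').1])
    · refine (finsum_eq_sum_of_support_subset _ fun a ha => ?_).symm
      by_contra h'
      exact ha (by simp [(hF y hy.2 a h').1, (hF y hy.2 a h').2 i])
  · obtain ⟨N, hN, hx, F, hF⟩ := hloc x
    refine ⟨N, hN, hx, ?_⟩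
    have h1 : ∀ᵐ y, ∀ a ∈ F, y ∈ W ∩ B a → v a y = ψ y :=
      (Finset.eventually_all F).2 fun a _ =>
        (ae_restrict_iff' (hW.inter (hB a)).measurableSet).1 (hv a)
    refine (ae_restrict_iff' (hW.inter hN).measurableSet).2 (h1.mono fun y hy hyW => ?_)
    have hsupp {c : E3 → ℂ} : (Function.support fun a => (f a y : ℂ) * c a) ⊆ F := fun a ha => by
      by_contra h'
      exact ha (by simp [(hF y hyW.2 a h').1])
    have h2 : ∑ a ∈ F, (f a y : ℂ) = 1 := by
      have h3 : ∑ᶠ a, f a y = 1 := f.sum_eq_one (mem_univ y)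
      rw [finsum_eq_sum_of_support_subset (s := F)] at h3
      · exact_mod_cast h3
      · intro a ha
        by_contra h'
        exact ha (hF y hyW.2 a h').1
    change ∑ᶠ a, (f a y : ℂ) * v a y = ψ y
    rw [finsum_eq_sum_of_support_subset _ hsupp]
    calc ∑ a ∈ F, (f a y : ℂ) * v a y = ∑ a ∈ F, (f a y : ℂ) * ψ y := by
          refine Finset.sum_congr rfl fun a ha => ?_
          by_cases hya : y ∈ B a
          · rw [hy a ha ⟨hyW.1, hya⟩]
          · have : f a y = 0 := by
              by_contra hne
              exact hya (hf a (subset_tsupport _ hne))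
            simp [this]
      _ = ψ y := by rw [← Finset.sum_mul, h2, one_mul]

end Glue

/-! ### Extension of the potential to the whole cell. -/

section Cell

lemma isOpen_unitCell : IsOpen unitCell := by
  have : unitCell = ⋂ i, (fun y : E3 => y i) ⁻¹' Ioo (-(1 / 2) : ℝ) (1 / 2) := by
    ext y; simp [unitCell]
  rw [this]
  exact isOpen_iInter_of_finite fun i => isOpen_Ioo.preimage (by fun_prop)

lemma IsInclusion.isOpen_cellComplement {S : Set E3} (hS : IsInclusion S) :
    IsOpen (cellComplement S) := isOpen_unitCell.sdiff hS.isCompact.isClosed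

lemma IsHeight.of_le {S : Set E3} {x : E3} {r : ℝ} {e : E3} {G : E3 → ℝ} {K : NNReal}
    (h : IsHeight S x r e G K) {r' : ℝ} (h0 : 0 < r') (hr : r' ≤ r) : IsHeight S x r' e G K :=
  ⟨h0, h.norm_e, h.shift, h.lipschitz, h.one_le, h.zero,
    fun y hy => h.mem_iff y (Metric.ball_subset_ball hr hy)⟩

/-- A curl free field in `Σ*` coincides there with a gradient in the whole cell. -/
theorem IsInclusion.exists_hasGrad_unitCell {S : Set E3} (hS : IsInclusion S)
    {u : Fin 3 → E3 → ℂ} (hu : ∀ i, LocL2 univ (u i)) (hc : CurlFree (cellComplement S) u) :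
    ∃ ψ g, HasGrad unitCell ψ g ∧
      ∀ i, g i =ᵐ[volume.restrict (cellComplement S)] u i := by
  have hcl := hS.isCompact.isClosed
  have hW := hS.isOpen_cellComplement
  obtain ⟨ψ, hψ⟩ := exists_hasGrad_of_isSimplyConnected hW hS.simplyConnected
    (fun i => (hu i).mono (subset_univ _)) hc
  have hloc (x : E3) : ∃ B, IsOpen B ∧ x ∈ B ∧ ∃ v g, HasGrad (unitCell ∩ B) v g ∧
      v =ᵐ[volume.restrict (cellComplement S ∩ B)] ψ := by
    by_cases hx : x ∈ frontier S
    · obtain ⟨r, e, G, K, h⟩ := hS.lipschitz.exists_isHeight hcl hx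
      obtain ⟨s, hs, hsY⟩ := Metric.isOpen_iff.1 isOpen_unitCell x
        (hS.subset_cell (hcl.frontier_subset hx))
      have h' := h.of_le (lt_min h.r_pos hs) (min_le_left r s)
      have hsub : Metric.ball x (min r s) \ S ⊆ cellComplement S :=
        sdiff_subset_sdiff_left ((Metric.ball_subset_ball (min_le_right r s)).trans hsY)
      obtain ⟨ρ, hρ, hρr, v, g, hv, hvψ⟩ := h'.exists_extension hcl (hψ.mono hsub) fun j =>
        (hu j _ (subset_univ _) (isCompact_closedBall x (min r s))).mono_measure
          (Measure.restrict_mono Metric.ball_subset_closedBall le_rfl)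
      have hsub' : cellComplement S ∩ Metric.ball x ρ ⊆ Metric.ball x ρ \ S :=
        fun y hy => ⟨hy.2, hy.1.2⟩
      exact ⟨_, Metric.isOpen_ball, Metric.mem_ball_self hρ, v, g, hv.mono inter_subset_right,
        ae_restrict_of_ae_restrict_of_subset hsub' hvψ⟩
    -- Away from the boundary no construction is needed: in the interior of `S` there is nothing to
    -- match, so zero will do, and outside `S` the potential itself is used.
    · by_cases hxS : x ∈ S
      · refine ⟨interior S, isOpen_interior, ?_, fun _ => 0, fun _ _ => 0, .zero _, ?_⟩
        · by_contra h'
          exact hx ⟨subset_closure hxS, h'⟩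
        · have : cellComplement S ∩ interior S = ∅ := by
            ext y
            simp only [mem_inter_iff, mem_empty_iff_false, iff_false]
            exact fun hy => hy.1.2 (interior_subset hy.2)
          rw [this, Measure.restrict_empty, ae_zero]
          exact Filter.eventually_bot
      · exact ⟨Sᶜ, hcl.isOpen_compl, hxS, ψ, u, hψ, by rfl⟩
  choose B hB hmem v g h hv using hloc
  obtain ⟨ψ', g', h', hψ'⟩ := HasGrad.exists_glue isOpen_unitCell hW hB hmem h hv
  exact ⟨ψ', g', h', fun i => (h'.mono sdiff_subset).ae_eq hW hψ hψ' i⟩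

end Cell

/-! ### Translation of weak gradients. -/

section Translate

lemma measurePreserving_add (a : E3) : MeasurePreserving (fun y : E3 => y + a) volume volume :=
  measurePreserving_add_right volume a

lemma LocL2.translate {U : Set E3} {v : E3 → ℂ} (h : LocL2 U v) (a : E3) :
    LocL2 ((fun y => y + a) ⁻¹' U) (fun y => v (y + a)) := fun K hK hc => by
  have hc' : IsCompact ((fun y => y + a) '' K) := hc.image (by fun_prop)
  have h1 := h _ (image_subset_iff.2 hK) hc'
  have h2 := (measurePreserving_add a).restrict_preimage hc'.measurableSet
  rw [preimage_image_eq _ (add_left_injective a)] at h2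
  exact h1.comp_measurePreserving h2

lemma IsTest.translate {U : Set E3} {φ : E3 → ℝ} {a : E3}
    (h : IsTest ((fun y => y + a) ⁻¹' U) φ) : IsTest U (fun y => φ (y - a)) := by
  have h1 : HasCompactSupport fun y => φ (y - a) := h.compact.comp_homeomorph (Homeomorph.subRight a)
  refine ⟨h.smooth.comp (by fun_prop), h1, ?_⟩
  have h2 : tsupport (fun y => φ (y - a)) = (fun y => y - a) ⁻¹' tsupport φ :=
    tsupport_comp_eq_preimage φ (Homeomorph.subRight a)
  intro y hy
  rw [h2] at hy
  have := h.support_subset hy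
  simpa using this

lemma partialDeriv_translate (φ : E3 → ℝ) (i : Fin 3) (a y : E3) :
    partialDeriv i (fun y => φ (y - a)) y = partialDeriv i φ (y - a) := by
  simp only [partialDeriv, fderiv_comp_sub]

lemma HasWeakPartial.translate {U : Set E3} {i : Fin 3} {ψ g : E3 → ℂ}
    (h : HasWeakPartial U i ψ g) (a : E3) :
    HasWeakPartial ((fun y => y + a) ⁻¹' U) i (fun y => ψ (y + a)) (fun y => g (y + a)) := by
  intro φ hφ
  have h1 := h _ hφ.translate
  simp only [partialDeriv_translate] at h1
  rw [← integral_add_right_eq_self _ a, ← integral_add_right_eq_self (fun y => (φ (y - a) : ℂ) * g y) a]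
    at h1
  simpa only [add_sub_cancel_right] using h1

lemma HasGrad.translate {U : Set E3} {ψ : E3 → ℂ} {g : Fin 3 → E3 → ℂ} (h : HasGrad U ψ g)
    (a : E3) :
    HasGrad ((fun y => y + a) ⁻¹' U) (fun y => ψ (y + a)) (fun i y => g i (y + a)) :=
  ⟨h.locL2.translate a, fun i => (h.grad_locL2 i).translate a, fun i => (h.weak i).translate a⟩

lemma ae_comp_add {p : E3 → Prop} (h : ∀ᵐ y, p y) (a : E3) : ∀ᵐ y, p (y + a) :=
  (measurePreserving_add a).quasiMeasurePreserving.ae h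

lemma ae_restrict_comp_add {U : Set E3} (hU : IsOpen U) {p : E3 → Prop}
    (h : ∀ᵐ y ∂(volume.restrict U), p y) (a : E3) :
    ∀ᵐ y ∂(volume.restrict ((fun y => y + a) ⁻¹' U)), p (y + a) := by
  rw [ae_restrict_iff' (hU.preimage (by fun_prop)).measurableSet]
  exact ae_comp_add ((ae_restrict_iff' hU.measurableSet).1 h) a

end Translate

/-! ### Lattice translates of the inclusion and periodic filling. -/

section Lattice

@[simp] lemma latticeVec_apply (k : Fin 3 → ℤ) (i : Fin 3) : latticeVec k i = k i := rfl

lemma latticeVec_add (k m : Fin 3 → ℤ) : latticeVec (k + m) = latticeVec k + latticeVec m := by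
  ext i; simp

lemma latticeVec_sub (k m : Fin 3 → ℤ) : latticeVec (k - m) = latticeVec k - latticeVec m := by
  ext i; simp

@[simp] lemma latticeVec_zero : latticeVec 0 = 0 := by
  ext i; simp

lemma eq_of_add_latticeVec_mem_unitCell {y : E3} {k m : Fin 3 → ℤ}
    (hk : y + latticeVec k ∈ unitCell) (hm : y + latticeVec m ∈ unitCell) : k = m := by
  ext i
  have h1 := hk i
  have h2 := hm i
  simp only [PiLp.add_apply, latticeVec_apply, mem_Ioo] at h1 h2
  have h3 : (k i : ℝ) < m i + 1 := by linarith
  have h4 : (m i : ℝ) < k i + 1 := by linarith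
  have h3' : k i < m i + 1 := by exact_mod_cast h3
  have h4' : m i < k i + 1 := by exact_mod_cast h4
  omega

variable {S : Set E3}

lemma locallyFinite_translates (hS : S ⊆ unitCell) :
    LocallyFinite fun k : Fin 3 → ℤ => (fun y => y + latticeVec k) ⁻¹' S := by
  intro y
  refine ⟨Metric.ball y 1, Metric.ball_mem_nhds y one_pos, ?_⟩
  refine (Set.finite_Icc (fun i => ⌊-y i - 2⌋) (fun i => ⌈-y i + 2⌉)).subset ?_
  rintro k ⟨z, hz1, hz2⟩
  have h1 (i : Fin 3) : |z i - y i| < 1 := by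
    rw [mem_ball_iff_norm] at hz2
    exact (PiLp.norm_apply_le (z - y) i).trans_lt hz2
  have h2 (i : Fin 3) := hS hz1 i
  simp only [PiLp.add_apply, latticeVec_apply, mem_Ioo] at h2
  refine ⟨fun i => ?_, fun i => ?_⟩
  · have h3 : -y i - 2 ≤ k i := by linarith [(abs_lt.1 (h1 i)).2, (h2 i).1]
    exact Int.cast_le.1 ((Int.floor_le (-y i - 2)).trans h3)
  · have h3 : k i ≤ -y i + 2 := by linarith [(abs_lt.1 (h1 i)).1, (h2 i).2]
    exact Int.cast_le.1 (h3.trans (Int.le_ceil (-y i + 2)))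

lemma periodicComplement_eq (S : Set E3) : periodicComplement S
    = (⋃ k : Fin 3 → ℤ, (fun y => y + latticeVec k) ⁻¹' S)ᶜ := by
  ext y; simp [periodicComplement]

lemma isOpen_periodicComplement (hcl : IsClosed S) (hS : S ⊆ unitCell) :
    IsOpen (periodicComplement S) := by
  rw [periodicComplement_eq]
  exact ((locallyFinite_translates hS).isClosed_iUnion fun k =>
    hcl.preimage (by fun_prop)).isOpen_compl

lemma cellComplement_subset_periodicComplement (hS : S ⊆ unitCell) :
    cellComplement S ⊆ periodicComplement S := by
  intro y hy k hk
  have h0 : y + latticeVec 0 ∈ unitCell := by simpa using hy.1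
  have := eq_of_add_latticeVec_mem_unitCell h0 (hS hk)
  rw [← this] at hk
  exact hy.2 (by simpa using hk)

open Classical in
/-- The periodic field that is `g` in the translates of `S` and `u` elsewhere. -/
noncomputable def fillIn (S : Set E3) (g u : E3 → ℂ) (y : E3) : ℂ :=
  if h : ∃ k : Fin 3 → ℤ, y + latticeVec k ∈ S then g (y + latticeVec h.choose) else u y

lemma fillIn_of_mem_periodicComplement {g u : E3 → ℂ} {y : E3} (hy : y ∈ periodicComplement S) :
    fillIn S g u y = u y := by
  rw [fillIn, dif_neg]
  rintro ⟨k, hk⟩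
  exact hy k hk

lemma fillIn_of_mem (hS : S ⊆ unitCell) {g u : E3 → ℂ} {y : E3} {k : Fin 3 → ℤ}
    (hk : y + latticeVec k ∈ S) : fillIn S g u y = g (y + latticeVec k) := by
  have h : ∃ k : Fin 3 → ℤ, y + latticeVec k ∈ S := ⟨k, hk⟩
  rw [fillIn, dif_pos h, eq_of_add_latticeVec_mem_unitCell (hS h.choose_spec) (hS hk)]

/-- A point lies in at most one translate of `S`, so the chosen index is forced. Translation by k
replaces the index m by m - k and leaves the point where `g` is evaluated unchanged. -/
lemma fillIn_periodic (hS : S ⊆ unitCell) {g u : E3 → ℂ}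
    (hu : ∀ k : Fin 3 → ℤ, ∀ᵐ y, u (y + latticeVec k) = u y) (k : Fin 3 → ℤ) :
    ∀ᵐ y, fillIn S g u (y + latticeVec k) = fillIn S g u y := by
  filter_upwards [hu k] with y hy
  by_cases h : ∃ m : Fin 3 → ℤ, y + latticeVec m ∈ S
  · obtain ⟨m, hm⟩ := h
    have h1 : y + latticeVec k + latticeVec (m - k) = y + latticeVec m := by
      rw [latticeVec_sub]; abel
    rw [fillIn_of_mem hS hm, fillIn_of_mem hS (k := m - k) (h1 ▸ hm), h1]
  · have h1 : y ∈ periodicComplement S := fun m hm => h ⟨m, hm⟩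
    have h2 : y + latticeVec k ∈ periodicComplement S := fun m hm => h ⟨k + m, by
      rwa [latticeVec_add, ← add_assoc]⟩
    rw [fillIn_of_mem_periodicComplement h1, fillIn_of_mem_periodicComplement h2, hy]

lemma fillIn_ae_eq (hcl : IsClosed S) (hS : S ⊆ unitCell) {g u : E3 → ℂ}
    (hg : g =ᵐ[volume.restrict (cellComplement S)] u) :
    g =ᵐ[volume.restrict unitCell] fillIn S g u := by
  have hm : MeasurableSet (cellComplement S) :=
    (isOpen_unitCell.sdiff hcl).measurableSet
  refine (ae_restrict_iff' isOpen_unitCell.measurableSet).2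
    (((ae_restrict_iff' hm).1 hg).mono fun y hy hyY => ?_)
  by_cases hyS : y ∈ S
  · rw [fillIn_of_mem hS (k := 0) (by simpa using hyS)]
    simp
  · rw [fillIn_of_mem_periodicComplement (cellComplement_subset_periodicComplement hS ⟨hyY, hyS⟩)]
    exact hy ⟨hyY, hyS⟩

end Lattice

/-! ### The global potential and its periods. -/

section Potential

variable {S : Set E3}

/-- Functions with the same gradient on `ℝ³` differ by a constant. -/
lemma HasGrad.exists_sub_const {p q : E3 → ℂ} {g : Fin 3 → E3 → ℂ} {U : Set E3} (hU : IsOpen U)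
    (hc : IsPreconnected U) (hp : HasGrad U p g) (hq : HasGrad U q g) :
    ∃ k, ∀ᵐ y ∂(volume.restrict U), q y = p y + k := by
  obtain ⟨k, hk⟩ := ae_const_of_zero_grad hU hc
    ((hq.sub hp).congr hU (by rfl) fun i => .of_forall fun y => sub_self _)
  exact ⟨k, hk.mono fun y hy => by rw [← hy]; ring⟩

/-- The translate of `p` by k has the same gradient, so the increment is a constant. Composing
translations shows that this constant is additive in k, hence determined by its values on the
standard basis of ℤ³. -/
lemma exists_ae_add_latticeVec {p : E3 → ℂ} {g : Fin 3 → E3 → ℂ} (hp : HasGrad univ p g)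
    (hg : ∀ i k, ∀ᵐ y, g i (y + latticeVec k) = g i y) :
    ∃ z : Fin 3 → ℂ, ∀ k : Fin 3 → ℤ, ∀ᵐ y, p (y + latticeVec k) = p y + ∑ i, (k i : ℂ) * z i := by
  have h1 (k : Fin 3 → ℤ) : ∃ c, ∀ᵐ y, p (y + latticeVec k) = p y + c := by
    have h2 : HasGrad univ (fun y => p (y + latticeVec k)) g := by
      refine ((hp.translate (latticeVec k)).mono (by simp)).congr isOpen_univ (by rfl) fun i => ?_
      rw [Measure.restrict_univ]
      exact hg i k
    have := hp.exists_sub_const isOpen_univ isPreconnected_univ h2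
    rwa [Measure.restrict_univ] at this
  choose c hc using h1
  have hadd (k m : Fin 3 → ℤ) : c (k + m) = c k + c m := by
    refine eq_of_ae_eq_of_isOpen isOpen_univ univ_nonempty ?_
    rw [Measure.restrict_univ]
    filter_upwards [hc (k + m), hc k, ae_comp_add (hc m) (latticeVec k)] with y h1 h2 h3
    rw [latticeVec_add, ← add_assoc, h3, h2] at h1
    have := add_left_cancel ((add_assoc _ _ _).symm.trans h1)
    exact this.symm
  let L : (Fin 3 → ℤ) →ₗ[ℤ] ℂ := (AddMonoidHom.mk' c hadd).toIntLinearMap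
  refine ⟨fun i => c fun j => if i = j then 1 else 0, fun k => ?_⟩
  have h3 := LinearMap.pi_apply_eq_sum_univ L k
  have h4 : c k = ∑ i, (k i : ℂ) * c fun j => if i = j then 1 else 0 := by
    simpa [L, zsmul_eq_mul] using h3
  rw [← h4]
  exact hc k

/-- The field `u` coincides on the periodic matrix with a periodic gradient. -/
theorem IsInclusion.exists_hasGrad_univ (hS : IsInclusion S) {u : Fin 3 → E3 → ℂ}
    (hu : ∀ i, LocL2 univ (u i)) (hper : ∀ i k, ∀ᵐ y, u i (y + latticeVec k) = u i y)
    (hc : CurlFree (periodicComplement S) u) :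
    ∃ (p : E3 → ℂ) (v : Fin 3 → E3 → ℂ) (z : Fin 3 → ℂ), HasGrad univ p v ∧
      (∀ i k, ∀ᵐ y, v i (y + latticeVec k) = v i y) ∧
      (∀ y ∈ periodicComplement S, ∀ i, v i y = u i y) ∧
      ∀ k : Fin 3 → ℤ, ∀ᵐ y, p (y + latticeVec k) = p y + ∑ i, (k i : ℂ) * z i := by
  have hcl := hS.isCompact.isClosed
  have hSY := hS.subset_cell
  have hPo := isOpen_periodicComplement hcl hSY
  obtain ⟨ψ, g, hψ, hg⟩ := hS.exists_hasGrad_unitCell hu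
    (hc.mono (cellComplement_subset_periodicComplement hSY))
  -- Being curl free is a local property, and ℝ³ is covered by the periodic matrix, where `v` is
  -- `u`, and by the translated cells, where `v` is the gradient of a translate of the extended
  -- potential.
  set v : Fin 3 → E3 → ℂ := fun i => fillIn S (g i) (u i) with hv
  have hvper (i k) : ∀ᵐ y, v i (y + latticeVec k) = v i y := fillIn_periodic hSY (hper i) k
  have hvP (y) (hy : y ∈ periodicComplement S) (i) : v i y = u i y :=
    fillIn_of_mem_periodicComplement hy
  have hcell (k : Fin 3 → ℤ) : HasGrad ((fun y => y + latticeVec k) ⁻¹' unitCell)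
      (fun y => ψ (y + latticeVec k)) v := by
    refine (hψ.translate (latticeVec k)).congr (isOpen_unitCell.preimage (by fun_prop)) (by rfl)
      fun i => ?_
    filter_upwards [ae_restrict_comp_add isOpen_unitCell (fillIn_ae_eq hcl hSY (hg i)) (latticeVec k),
      ae_restrict_of_ae (hvper i k)] with y h1 h2
    rw [h1, ← h2]
  have hloc (x : E3) : ∃ V, IsOpen V ∧ x ∈ V ∧ (∀ i, LocL2 (univ ∩ V) (v i)) ∧
      CurlFree (univ ∩ V) v := by
    simp only [univ_inter]
    by_cases hx : x ∈ periodicComplement S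
    · have he (i) : u i =ᵐ[volume.restrict (periodicComplement S)] v i :=
        (ae_restrict_mem hPo.measurableSet).mono fun y hy => (hvP y hy i).symm
      exact ⟨_, hPo, hx, fun i => ((hu i).mono (subset_univ _)).congr (he i),
        hc.congr hPo (fun i => (hu i).mono (subset_univ _)) he⟩
    · obtain ⟨k, hk⟩ : ∃ k : Fin 3 → ℤ, x + latticeVec k ∈ S := by
        by_contra h
        exact hx fun k hk => h ⟨k, hk⟩
      exact ⟨(fun y => y + latticeVec k) ⁻¹' unitCell,
        isOpen_unitCell.preimage (by fun_prop), hSY hk, (hcell k).grad_locL2,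
        (hcell k).curlFree⟩
  choose V hVo hV hVl hVc using hloc
  have hvl (i) : LocL2 univ (v i) := .of_local fun x _ => ⟨V x, hVo x, hV x, hVl x i⟩
  have hsc : IsSimplyConnected (univ : Set E3) := by
    have : ContractibleSpace (univ : Set E3) :=
      (convex_univ (𝕜 := ℝ) (E := E3)).contractibleSpace univ_nonempty
    exact SimplyConnectedSpace.ofContractible _
  obtain ⟨p, hp⟩ := exists_hasGrad_of_isSimplyConnected isOpen_univ hsc hvl
    (.of_local hvl fun x _ => ⟨V x, hVo x, hV x, hVc x⟩)
  obtain ⟨z, hz⟩ := exists_ae_add_latticeVec hp hvper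
  exact ⟨p, v, z, hp, hvper, hvP, hz⟩

end Potential

/-! ### Averages of periodic functions over the cell. -/

section Cell

lemma unitCell_eq_preimage :
    unitCell = @WithLp.ofLp 2 (Fin 3 → ℝ) ⁻¹' (univ.pi fun _ => Ioo (-(1 / 2)) (1 / 2)) := by
  ext y; simp [unitCell]

/-- The half-open unit cell centred at `w`. -/
def halfOpenCell (w : E3) : Set E3 := {y | ∀ i, y i - w i ∈ Ico (-(1 / 2) : ℝ) (1 / 2)}

/-- Half-open cells tile space exactly, which open cells do only up to their null faces; this
transfers integrals from one to the other. -/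
lemma halfOpenCell_zero_ae_eq : halfOpenCell 0 =ᵐ[volume] unitCell := by
  have h1 : halfOpenCell 0
      = @WithLp.ofLp 2 (Fin 3 → ℝ) ⁻¹' (univ.pi fun _ => Ico (-(1 / 2)) (1 / 2)) := by
    ext y; simp [halfOpenCell]
  rw [h1, unitCell_eq_preimage]
  refine (PiLp.volume_preserving_ofLp (Fin 3)).quasiMeasurePreserving.preimage_ae_eq ?_
  exact Measure.univ_pi_Ico_ae_eq_Icc.trans Measure.univ_pi_Ioo_ae_eq_Icc.symm

lemma measurableSet_halfOpenCell (w : E3) : MeasurableSet (halfOpenCell w) := by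
  have : halfOpenCell w = ⋂ i, (fun y : E3 => y i - w i) ⁻¹' Ico (-(1 / 2) : ℝ) (1 / 2) := by
    ext y; simp [halfOpenCell]
  rw [this]
  refine MeasurableSet.iInter fun i => measurableSet_Ico.preimage ?_
  exact Continuous.measurable (by fun_prop)

/-- The lattice `ℤ³` as a subgroup of `ℝ³`. -/
noncomputable def latticeSubgroup : AddSubgroup E3 :=
  (AddMonoidHom.mk' latticeVec latticeVec_add).range

instance : Countable latticeSubgroup :=
  (Set.countable_range (AddMonoidHom.mk' latticeVec latticeVec_add)).to_subtype

lemma existsUnique_mem_halfOpenCell (w x : E3) :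
    ∃! k : Fin 3 → ℤ, latticeVec k + x ∈ halfOpenCell w := by
  have h (i : Fin 3) := existsUnique_add_zsmul_mem_Ico (one_pos (α := ℝ)) (x i - w i) (-(1 / 2))
  choose k hk hu using h
  refine ⟨k, fun i => ?_, fun m hm => funext fun i => hu i (m i) ?_⟩
  · have := hk i
    simp only [zsmul_eq_mul, mul_one, mem_Ico] at this
    simp only [PiLp.add_apply, latticeVec_apply, mem_Ico]
    constructor <;> linarith [this.1, this.2]
  · have := hm i
    simp only [PiLp.add_apply, latticeVec_apply, mem_Ico] at this
    simp only [zsmul_eq_mul, mul_one, mem_Ico]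
    constructor <;> linarith [this.1, this.2]

lemma isAddFundamentalDomain_halfOpenCell (w : E3) :
    IsAddFundamentalDomain latticeSubgroup (halfOpenCell w) := by
  refine .mk' (measurableSet_halfOpenCell w).nullMeasurableSet fun x => ?_
  obtain ⟨k, hk, hu⟩ := existsUnique_mem_halfOpenCell w x
  refine ⟨⟨latticeVec k, k, rfl⟩, hk, ?_⟩
  rintro ⟨_, m, rfl⟩ hm
  exact Subtype.ext (congrArg latticeVec (hu m hm))

/-- A function that is periodic almost everywhere has a periodic representative. -/
lemma exists_periodic_representative {h : E3 → ℂ}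
    (hp : ∀ k : Fin 3 → ℤ, ∀ᵐ y, h (y + latticeVec k) = h y) :
    ∃ h' : E3 → ℂ, h =ᵐ[volume] h' ∧ ∀ k y, h' (latticeVec k + y) = h' y := by
  choose k hk hu using existsUnique_mem_halfOpenCell 0
  -- The value is read at the lattice representative in the half-open cell. Countability of the
  -- lattice makes the exceptional sets of all shifts jointly null.
  refine ⟨fun y => h (latticeVec (k y) + y), ?_, fun m y => ?_⟩
  · filter_upwards [ae_all_iff.2 hp] with y hy
    rw [add_comm, hy]
  · have h1 : k (latticeVec m + y) + m = k y := by
      refine hu y _ ?_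
      have : latticeVec (k (latticeVec m + y)) + (latticeVec m + y) ∈ halfOpenCell 0 := hk _
      rwa [← add_assoc, ← latticeVec_add] at this
    change h (latticeVec (k (latticeVec m + y)) + (latticeVec m + y)) = h (latticeVec (k y) + y)
    rw [← h1, latticeVec_add, add_assoc]

/-- The integral of a periodic function over the cell is translation invariant. -/
theorem setIntegral_unitCell_translate {h : E3 → ℂ}
    (hp : ∀ k : Fin 3 → ℤ, ∀ᵐ y, h (y + latticeVec k) = h y) (w : E3) :
    ∫ z in unitCell, h (z + w) = ∫ z in unitCell, h z := by
  obtain ⟨h', hh, hper⟩ := exists_periodic_representative hp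
  have e1 : ∫ z in unitCell, h (z + w) = ∫ z in unitCell, h' (z + w) :=
    setIntegral_congr_ae₀ isOpen_unitCell.measurableSet.nullMeasurableSet
      ((ae_comp_add hh w).mono fun y hy _ => hy)
  have e2 : ∫ z in unitCell, h z = ∫ z in unitCell, h' z :=
    setIntegral_congr_ae₀ isOpen_unitCell.measurableSet.nullMeasurableSet (hh.mono fun y hy _ => hy)
  rw [e1, e2, ← setIntegral_congr_set halfOpenCell_zero_ae_eq,
    ← setIntegral_congr_set halfOpenCell_zero_ae_eq]
  have hpre : halfOpenCell 0 = (fun z => z + w) ⁻¹' halfOpenCell w := by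
    ext y
    simp only [halfOpenCell, mem_ofPred_eq, mem_preimage, PiLp.add_apply, PiLp.zero_apply, sub_zero,
      add_sub_cancel_right]
  have e3 : ∫ z in halfOpenCell 0, h' (z + w) = ∫ z in halfOpenCell w, h' z := by
    rw [hpre]
    exact (measurePreserving_add w).setIntegral_preimage_emb
      (Homeomorph.addRight w).measurableEmbedding h' _
  rw [e3]
  -- Two fundamental domains of the lattice carry the same integral of an invariant function.
  -- Invariance must hold everywhere here, hence the passage to `h'`.
  refine (isAddFundamentalDomain_halfOpenCell w).setIntegral_eq
    (isAddFundamentalDomain_halfOpenCell 0) ?_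
  rintro ⟨_, m, rfl⟩ y
  exact hper m y

lemma unitCell_subset_closedBall : unitCell ⊆ Metric.closedBall 0 1 := by
  intro y hy
  rw [mem_closedBall_zero_iff, EuclideanSpace.norm_eq, Real.sqrt_le_one]
  have h (i : Fin 3) : ‖y i‖ ^ 2 ≤ 1 / 4 := by
    have := hy i
    rw [Real.norm_eq_abs, sq_abs]
    nlinarith [this.1, this.2]
  rw [Fin.sum_univ_three]
  linarith [h 0, h 1, h 2]

instance : IsFiniteMeasure (volume.restrict unitCell) :=
  ⟨by
    rw [Measure.restrict_apply_univ]
    exact (measure_mono unitCell_subset_closedBall).trans_lt measure_closedBall_lt_top⟩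

/-- Averaging the translates of a test function against a periodic function. -/
theorem integral_unitCell_translate_mul {θ : E3 → ℝ} (hθ : Continuous θ) (hc : HasCompactSupport θ)
    {h : E3 → ℂ} (hh : LocallyIntegrable h)
    (hp : ∀ k : Fin 3 → ℤ, ∀ᵐ y, h (y + latticeVec k) = h y) :
    IntegrableOn (fun z => ∫ y, (θ (y - z) : ℂ) * h y) unitCell ∧
    ∫ z in unitCell, ∫ y, (θ (y - z) : ℂ) * h y = (∫ y, (θ y : ℂ)) * ∫ y in unitCell, h y := by
  have hθc : Continuous fun y => (θ y : ℂ) := Complex.continuous_ofReal.comp hθ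
  obtain ⟨M, hM⟩ := hc.exists_bound_of_continuous hθ
  obtain ⟨R, hR⟩ := hc.isCompact.isBounded.subset_closedBall 0
  -- Fubini needs an integrable factor and `h` is only locally integrable; for a shift in the cell
  -- and a point in the support of θ, only its values on this ball count.
  set K := Metric.closedBall (0 : E3) (1 + R) with hK
  have hint : Integrable (fun q : E3 × E3 => (θ q.2 : ℂ) * h (q.1 + q.2))
      ((volume.restrict unitCell).prod volume) := by
    have h1 : Integrable (K.indicator h) :=
      (hh.integrableOn_isCompact (isCompact_closedBall _ _)).integrable_indicator
        measurableSet_closedBall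
    have h2 : Integrable (fun q : E3 × E3 => K.indicator h q.2)
        ((volume.restrict unitCell).prod volume) := h1.comp_snd _
    have h3 : Integrable (fun q : E3 × E3 => K.indicator h (q.1 + q.2))
        ((volume.restrict unitCell).prod volume) :=
      (measurePreserving_prod_add (volume.restrict unitCell) volume).integrable_comp_of_integrable h2
    have h4 : Integrable (fun q : E3 × E3 => (θ q.2 : ℂ) * K.indicator h (q.1 + q.2))
        ((volume.restrict unitCell).prod volume) := by
      refine h3.bdd_mul (c := M) (hθc.comp continuous_snd).aestronglyMeasurable
        (.of_forall fun q => ?_)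
      rw [Complex.norm_real]
      exact hM _
    refine h4.congr ?_
    have h5 : ∀ᵐ q ∂((volume.restrict unitCell).prod (volume : Measure E3)), q.1 ∈ unitCell :=
      Measure.quasiMeasurePreserving_fst.ae (ae_restrict_mem isOpen_unitCell.measurableSet)
    refine h5.mono fun q hq => ?_
    by_cases hq2 : q.2 ∈ tsupport θ
    · have : q.1 + q.2 ∈ K := by
        have a1 := unitCell_subset_closedBall hq
        have a2 := hR hq2
        rw [mem_closedBall_zero_iff] at a1 a2
        rw [hK, mem_closedBall_zero_iff]
        linarith [norm_add_le q.1 q.2]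
      simp only [indicator_of_mem this]
    · simp only [image_eq_zero_of_notMem_tsupport hq2, Complex.ofReal_zero, zero_mul]
  have hsub (z : E3) : ∫ y, (θ (y - z) : ℂ) * h y = ∫ y, (θ y : ℂ) * h (z + y) := by
    rw [← integral_add_right_eq_self _ z]
    simp only [add_sub_cancel_right, add_comm z]
  simp only [hsub]
  refine ⟨hint.integral_prod_left, ?_⟩
  rw [integral_integral_swap hint, ← integral_mul_const]
  refine integral_congr_ae (.of_forall fun w => ?_)
  simp only [integral_const_mul]
  rw [setIntegral_unitCell_translate hp]

end Cell

/-! ### Orthogonality of periodic gradients and divergence free fields. -/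

section Pairing

open Filter

lemma LocL2.memLp_closedBall {v : E3 → ℂ} (h : LocL2 univ v) (R : ℝ) :
    MemLp v 2 (volume.restrict (Metric.closedBall 0 R)) :=
  h _ (subset_univ _) (isCompact_closedBall _ _)

lemma integral_sum_add {μ : Measure E3} {a b : Fin 3 → E3 → ℂ} (ha : ∀ i, Integrable (a i) μ)
    (hb : ∀ i, Integrable (b i) μ) :
    ∫ y, ∑ i, (a i y + b i y) ∂μ = ∑ i, ((∫ y, a i y ∂μ) + ∫ y, b i y ∂μ) := by
  have h (i : Fin 3) : Integrable (fun y => a i y + b i y) μ := (ha i).add (hb i)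
  rw [integral_finsetSum _ fun i _ => h i]
  exact Finset.sum_congr rfl fun i _ => integral_add (ha i) (hb i)

lemma fderiv_eq_re_add_im {P : E3 → ℂ} (hP : Differentiable ℝ P) (i : Fin 3) (y : E3) :
    fderiv ℝ P y (EuclideanSpace.single i 1)
      = partialDeriv i (fun y => (P y).re) y + Complex.I * partialDeriv i (fun y => (P y).im) y := by
  have e1 : partialDeriv i (fun y => (P y).re) y = (fderiv ℝ P y (EuclideanSpace.single i 1)).re := by
    have h := (Complex.reCLM.hasFDerivAt.comp y (hP y).hasFDerivAt).fderiv
    change fderiv ℝ (⇑Complex.reCLM ∘ P) y _ = _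
    rw [h]; rfl
  have e2 : partialDeriv i (fun y => (P y).im) y = (fderiv ℝ P y (EuclideanSpace.single i 1)).im := by
    have h := (Complex.imCLM.hasFDerivAt.comp y (hP y).hasFDerivAt).fderiv
    change fderiv ℝ (⇑Complex.imCLM ∘ P) y _ = _
    rw [h]; rfl
  rw [e1, e2, mul_comm, Complex.re_add_im]

variable {F : Fin 3 → E3 → ℂ}

/-- Divergence free fields may be tested with complex valued smooth functions. -/
lemma integral_divFree_mul_smooth (hF : ∀ i, LocL2 univ (F i))
    (hdiv : ∀ φ, IsTest univ φ → ∫ y, ∑ i, (partialDeriv i φ y : ℂ) * F i y = 0)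
    {ρ : E3 → ℝ} (hρ : IsTest univ ρ) {P : E3 → ℂ} (hP : ContDiff ℝ ∞ P) :
    ∫ y, ∑ i, (((partialDeriv i ρ y : ℂ) * F i y) * P y
      + ((ρ y : ℂ) * F i y) * fderiv ℝ P y (EuclideanSpace.single i 1)) = 0 := by
  have hre : ContDiff ℝ ∞ fun y => (P y).re := Complex.reCLM.contDiff.comp hP
  have him : ContDiff ℝ ∞ fun y => (P y).im := Complex.imCLM.contDiff.comp hP
  have htest {χ : E3 → ℝ} (hχ : ContDiff ℝ ∞ χ) : IsTest univ fun y => χ y * ρ y :=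
    (hρ.mul_left hχ (subset_univ _)).mono (subset_univ _)
  have hint {χ : E3 → ℝ} (hχ : ContDiff ℝ ∞ χ) :
      Integrable fun y => ∑ i, (partialDeriv i (fun y => χ y * ρ y) y : ℂ) * F i y :=
    integrable_finsetSum _ fun i _ => (hF i).integrable_test ((htest hχ).partialDeriv i)
  -- Test functions are real, so the real and imaginary parts of `P`, each multiplied by ρ, are
  -- tested separately and recombined.
  have h0 : ∫ y, ((∑ i, (partialDeriv i (fun y => (P y).re * ρ y) y : ℂ) * F i y)
      + Complex.I * ∑ i, (partialDeriv i (fun y => (P y).im * ρ y) y : ℂ) * F i y) = 0 := by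
    rw [integral_add (hint hre) ((hint him).const_mul _), integral_const_mul, hdiv _ (htest hre),
      hdiv _ (htest him)]
    simp
  rw [← h0]
  refine integral_congr_ae (.of_forall fun y => ?_)
  simp only [Finset.mul_sum, ← Finset.sum_add_distrib]
  refine Finset.sum_congr rfl fun i _ => ?_
  rw [partialDeriv_mul (hre.differentiable (by simp)) hρ.differentiable,
    partialDeriv_mul (him.differentiable (by simp)) hρ.differentiable,
    fderiv_eq_re_add_im (hP.differentiable (by simp))]
  conv_lhs => rw [← Complex.re_add_im (P y)]
  push_cast
  ring

/-- Divergence free fields may be tested with the product of a test function and a function with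
square integrable gradient. -/
theorem integral_divFree_mul_grad (hF : ∀ i, LocL2 univ (F i))
    (hdiv : ∀ φ, IsTest univ φ → ∫ y, ∑ i, (partialDeriv i φ y : ℂ) * F i y = 0)
    {ρ : E3 → ℝ} (hρ : IsTest univ ρ) {Ψ : E3 → ℂ} {g : Fin 3 → E3 → ℂ} (hΨ : HasGrad univ Ψ g) :
    ∫ y, ∑ i, (((partialDeriv i ρ y : ℂ) * F i y) * Ψ y + ((ρ y : ℂ) * F i y) * g i y) = 0 := by
  obtain ⟨R, hR⟩ := hρ.compact.isCompact.isBounded.subset_closedBall 0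
  set B := Metric.closedBall (0 : E3) R with hB
  -- The kernels have radius at most 1, so at points of `B` mollification does not notice the
  -- truncation to `K`.
  set K := Metric.closedBall (0 : E3) (R + 1) with hK
  obtain ⟨θ, hθn, hθ, hθt⟩ := exists_mollifier_seq one_pos
  have hmem {n : ℕ} {y w : E3} (hy : y ∈ B) (hw : y - w ∈ tsupport (θ n)) : w ∈ K := by
    have h1 := (hθ n).tsupport_subset hw
    rw [mem_closedBall_zero_iff] at h1 hy ⊢
    have e1 : w = y - (y - w) := by abel
    rw [e1]
    linarith [norm_sub_le y (y - w)]
  have hKm {v : E3 → ℂ} (hv : LocL2 univ v) : MemLp (K.indicator v) 2 :=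
    memLp_indicator_of_locL2 hv (subset_univ _) (isCompact_closedBall _ _)
  have hli {v : E3 → ℂ} (hv : LocL2 univ v) : LocallyIntegrable (K.indicator v) :=
    (hKm hv).locallyIntegrable (by norm_num)
  have hsm {v : E3 → ℂ} (hv : LocL2 univ v) (n : ℕ) : ContDiff ℝ ∞ (mollify (θ n) (K.indicator v)) :=
    contDiff_mollify (hθ n).smooth (hθ n).compact (hli hv)
  have hmoll {v : E3 → ℂ} (hv : LocL2 univ v) (n : ℕ) :
      MemLp (mollify (θ n) (K.indicator v)) 2 (volume.restrict B) :=
    (LocL2.of_continuous (hsm hv n).continuous).memLp_closedBall R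
  have hlim {v : E3 → ℂ} (hv : LocL2 univ v) : Tendsto (fun n => eLpNorm (fun y =>
      mollify (θ n) (K.indicator v) y - v y) 2 (volume.restrict B)) atTop (𝓝 0) := by
    have h1 := tendsto_eLpNorm_restrict (B := B) Measure.restrict_le_self
      (tendsto_mollify hθn hθt (hKm hv))
    refine h1.congr fun n => eLpNorm_sub_congr measurableSet_closedBall fun y hy => ?_
    exact indicator_of_mem (Metric.closedBall_subset_closedBall (by linarith) hy) v
  have ha (i : Fin 3) : MemLp (fun y => (partialDeriv i ρ y : ℂ) * F i y) 2 (volume.restrict B) :=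
    ((hF i).mul_continuous (hρ.partialDeriv i).continuous).memLp_closedBall R
  have hb (i : Fin 3) : MemLp (fun y => (ρ y : ℂ) * F i y) 2 (volume.restrict B) :=
    ((hF i).mul_continuous hρ.continuous).memLp_closedBall R
  have hset (p : E3 → ℂ) (q : Fin 3 → E3 → ℂ) (hp : MemLp p 2 (volume.restrict B))
      (hq : ∀ i, MemLp (q i) 2 (volume.restrict B)) :
      ∫ y, ∑ i, (((partialDeriv i ρ y : ℂ) * F i y) * p y + ((ρ y : ℂ) * F i y) * q i y)
      = ∑ i, ((∫ y in B, ((partialDeriv i ρ y : ℂ) * F i y) * p y)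
        + ∫ y in B, ((ρ y : ℂ) * F i y) * q i y) := by
    have h1 : ∀ y ∉ B,
        ∑ i, (((partialDeriv i ρ y : ℂ) * F i y) * p y + ((ρ y : ℂ) * F i y) * q i y) = 0 := by
      intro y hy
      have h2 : y ∉ tsupport ρ := fun h => hy (hR h)
      have h3 (i) : partialDeriv i ρ y = 0 := image_eq_zero_of_notMem_tsupport fun h =>
        h2 (tsupport_partialDeriv_subset ρ i h)
      simp [image_eq_zero_of_notMem_tsupport h2, h3]
    rw [← setIntegral_eq_integral_of_forall_compl_eq_zero h1]
    have i1 (i : Fin 3) := (ha i).integrable_mul hp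
    have i2 (i : Fin 3) := (hb i).integrable_mul (hq i)
    exact integral_sum_add i1 i2
  have hz (n : ℕ) : ∑ i, ((∫ y in B, ((partialDeriv i ρ y : ℂ) * F i y)
        * mollify (θ n) (K.indicator Ψ) y)
      + ∫ y in B, ((ρ y : ℂ) * F i y) * mollify (θ n) (K.indicator (g i)) y) = 0 := by
    rw [← hset _ _ (hmoll hΨ.locL2 n) fun i => hmoll (hΨ.grad_locL2 i) n,
      ← integral_divFree_mul_smooth hF hdiv hρ (hsm hΨ.locL2 n)]
    refine integral_congr_ae (.of_forall fun y => Finset.sum_congr rfl fun i _ => ?_)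
    by_cases hy : y ∈ B
    · rw [fderiv_mollify_of_hasWeakPartial (hθ n).smooth (hθ n).compact (hli hΨ.locL2) (hΨ.weak i)
        (fun _ _ => mem_univ _) fun w hw => indicator_of_mem (hmem hy hw) Ψ,
        mollify_congr fun w hw => indicator_of_mem (hmem hy hw) (g i)]
    · have h2 : y ∉ tsupport ρ := fun h => hy (hR h)
      simp [image_eq_zero_of_notMem_tsupport h2]
  rw [hset _ _ (hΨ.locL2.memLp_closedBall R) fun i => (hΨ.grad_locL2 i).memLp_closedBall R]
  refine tendsto_nhds_unique (tendsto_finsetSum Finset.univ fun i _ =>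
    (tendsto_integral_mul_of_memLp (ha i) (hmoll hΨ.locL2) (hΨ.locL2.memLp_closedBall R)
      (hlim hΨ.locL2)).add (tendsto_integral_mul_of_memLp (hb i) (hmoll (hΨ.grad_locL2 i))
      ((hΨ.grad_locL2 i).memLp_closedBall R) (hlim (hΨ.grad_locL2 i)))) ?_
  simp only [hz]
  exact tendsto_const_nhds

lemma LocL2.locallyIntegrable_mul {v w : E3 → ℂ} (hv : LocL2 univ v) (hw : LocL2 univ w) :
    LocallyIntegrable fun y => v y * w y :=
  locallyIntegrable_iff.2 fun _ hQ =>
    (hv _ (subset_univ _) hQ).integrable_mul (hw _ (subset_univ _) hQ)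

lemma LocallyIntegrable.integrableOn_unitCell {h : E3 → ℂ} (hh : LocallyIntegrable h) :
    IntegrableOn h unitCell :=
  (hh.integrableOn_isCompact (isCompact_closedBall 0 1)).mono_set unitCell_subset_closedBall

/-- Gradients of periodic functions are orthogonal to periodic divergence free fields. -/
theorem integral_unitCell_grad_mul_divFree (hF : ∀ i, LocL2 univ (F i))
    (hFp : ∀ i (k : Fin 3 → ℤ), ∀ᵐ y, F i (y + latticeVec k) = F i y)
    (hdiv : ∀ φ, IsTest univ φ → ∫ y, ∑ i, (partialDeriv i φ y : ℂ) * F i y = 0)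
    {Ψ : E3 → ℂ} {g : Fin 3 → E3 → ℂ} (hΨ : HasGrad univ Ψ g)
    (hΨp : ∀ k : Fin 3 → ℤ, ∀ᵐ y, Ψ (y + latticeVec k) = Ψ y)
    (hgp : ∀ i (k : Fin 3 → ℤ), ∀ᵐ y, g i (y + latticeVec k) = g i y) :
    ∫ y in unitCell, ∑ i, g i y * F i y = 0 := by
  -- The indicator of the cell is not a test function. The identity is tested with θ(· - z) instead
  -- and averaged over z in the cell: the weight of F·g becomes ∫ θ = 1, and that of Fᵢ Ψ becomes ∫
  -- ∂ᵢθ = 0.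
  obtain ⟨θ, hθ⟩ := exists_isMollifier (0 : E3) one_pos
  have hθt : IsTest univ θ := ⟨hθ.smooth, hθ.compact, subset_univ _⟩
  have hJ (i : Fin 3) : LocallyIntegrable fun y => F i y * Ψ y :=
    (hF i).locallyIntegrable_mul hΨ.locL2
  have hH (i : Fin 3) : LocallyIntegrable fun y => F i y * g i y :=
    (hF i).locallyIntegrable_mul (hΨ.grad_locL2 i)
  have a1 (i : Fin 3) := integral_unitCell_translate_mul (hθt.partialDeriv i).continuous
    (hθt.partialDeriv i).compact (hJ i) fun k => by
      filter_upwards [hFp i k, hΨp k] with y h1 h2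
      rw [h1, h2]
  have a2 (i : Fin 3) := integral_unitCell_translate_mul hθt.continuous hθt.compact (hH i) fun k => by
      filter_upwards [hFp i k, hgp i k] with y h1 h2
      rw [h1, h2]
  have z1 (i : Fin 3) : ∫ y, (partialDeriv i θ y : ℂ) = 0 := by
    have := (HasGrad.const univ 1).weak i θ hθt
    simpa using this
  have z2 : ∫ y, (θ y : ℂ) = 1 := by
    rw [integral_complex_ofReal, hθ.integral_eq, Complex.ofReal_one]
  have hz (z : E3) : ∑ i, ((∫ y, (partialDeriv i θ (y - z) : ℂ) * (F i y * Ψ y))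
      + ∫ y, (θ (y - z) : ℂ) * (F i y * g i y)) = 0 := by
    have ht : IsTest univ fun y => θ (y - z) := hθt.translate (U := univ)
    have h1 := integral_divFree_mul_grad hF hdiv ht hΨ
    have i1 (i : Fin 3) : Integrable fun y => (partialDeriv i θ (y - z) : ℂ) * (F i y * Ψ y) := by
      refine ((hJ i).integrable_smul_left_of_hasCompactSupport
        (g := fun y => (partialDeriv i θ (y - z) : ℂ)) ?_ ?_)
      · exact Complex.continuous_ofReal.comp
          ((hθt.partialDeriv i).continuous.comp (by fun_prop))
      · exact ((hθt.partialDeriv i).compact.comp_homeomorph (Homeomorph.subRight z)).comp_left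
          (g := fun x : ℝ => (x : ℂ)) (by simp)
    have i2 (i : Fin 3) : Integrable fun y => (θ (y - z) : ℂ) * (F i y * g i y) := by
      refine ((hH i).integrable_smul_left_of_hasCompactSupport
        (g := fun y => (θ (y - z) : ℂ)) ?_ ?_)
      · exact Complex.continuous_ofReal.comp (hθt.continuous.comp (by fun_prop))
      · exact (hθt.compact.comp_homeomorph (Homeomorph.subRight z)).comp_left
          (g := fun x : ℝ => (x : ℂ)) (by simp)
    simp only [partialDeriv_translate, mul_assoc] at h1
    rw [← h1]
    exact (integral_sum_add i1 i2).symm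
  have h3 : ∫ z in unitCell, ∑ i, ((∫ y, (partialDeriv i θ (y - z) : ℂ) * (F i y * Ψ y))
      + ∫ y, (θ (y - z) : ℂ) * (F i y * g i y)) = 0 := by simp only [hz, integral_zero]
  have h4 : ∫ z in unitCell, ∑ i, ((∫ y, (partialDeriv i θ (y - z) : ℂ) * (F i y * Ψ y))
      + ∫ y, (θ (y - z) : ℂ) * (F i y * g i y)) = ∑ i, ∫ y in unitCell, g i y * F i y := by
    refine (integral_sum_add (fun i => (a1 i).1) fun i => (a2 i).1).trans ?_
    refine Finset.sum_congr rfl fun i _ => ?_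
    rw [(a1 i).2, (a2 i).2, z1, z2, zero_mul, zero_add, one_mul]
    simp only [mul_comm]
  rw [h4] at h3
  rw [integral_finsetSum _ fun i _ => ?_, h3]
  exact LocallyIntegrable.integrableOn_unitCell
    ((hΨ.grad_locL2 i).locallyIntegrable_mul (hF i))

end Pairing

/-! ### Line integrals of continuous weak gradients. -/

section LineIntegral

open Filter

/-- An average of values within ε of `c` is within ε of `c`. The choice c = 0 gives uniform bounds,
and c = v(y) gives convergence at points of continuity. -/
lemma IsMollifier.norm_mollify_sub_le {θ : E3 → ℝ} {r : ℝ} (hθ : IsMollifier 0 r θ) {v : E3 → ℂ}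
    (hv : LocallyIntegrable v) {y : E3} {c : ℂ} {ε : ℝ}
    (h : ∀ w ∈ Metric.closedBall y r, ‖v w - c‖ ≤ ε) : ‖mollify θ v y - c‖ ≤ ε := by
  have h1 : ∫ w, (θ w : ℂ) * c = c := by
    rw [integral_mul_const, integral_complex_ofReal, hθ.integral_eq, Complex.ofReal_one, one_mul]
  have i1 := integrable_mollify hθ.smooth.continuous hθ.compact hv y
  have i2 : Integrable fun w => (θ w : ℂ) * c := hθ.integrable.ofReal.mul_const c
  rw [mollify_apply', ← h1, ← integral_sub i1 i2]
  have h2 : ∫ w, θ w * ε = ε := by rw [integral_mul_const, hθ.integral_eq, one_mul]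
  rw [← h2]
  refine norm_integral_le_of_norm_le (hθ.integrable.mul_const ε) (.of_forall fun w => ?_)
  rw [← mul_sub, norm_mul, Complex.norm_real, Real.norm_of_nonneg (hθ.nonneg w)]
  by_cases hw : w ∈ tsupport θ
  · refine mul_le_mul_of_nonneg_left ?_ (hθ.nonneg w)
    have h3 := hθ.tsupport_subset hw
    have h4 : y - w ∈ Metric.closedBall y r := by
      rw [mem_closedBall_iff_norm, sub_sub_cancel_left, norm_neg]
      simpa using h3
    exact h _ h4
  · rw [image_eq_zero_of_notMem_tsupport hw, zero_mul, zero_mul]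

/-- Averaging upgrades an identity valid almost everywhere to one valid at every point, in
particular at the endpoints of a curve. -/
lemma IsMollifier.mollify_add_const {θ : E3 → ℝ} {r : ℝ} (hθ : IsMollifier 0 r θ) {p : E3 → ℂ}
    (hp : LocallyIntegrable p) {a : E3} {c : ℂ} (h : ∀ᵐ y, p (y + a) = p y + c) (y : E3) :
    mollify θ p (y + a) = mollify θ p y + c := by
  have h1 : ∫ w, (θ w : ℂ) * c = c := by
    rw [integral_mul_const, integral_complex_ofReal, hθ.integral_eq, Complex.ofReal_one, one_mul]
  have i1 := integrable_mollify hθ.smooth.continuous hθ.compact hp y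
  have i2 : Integrable fun w => (θ w : ℂ) * c := hθ.integrable.ofReal.mul_const c
  conv_rhs => rw [← h1]
  rw [mollify_apply', mollify_apply', ← integral_add i1 i2]
  refine integral_congr_ae ?_
  have h2 : ∀ᵐ w, p (y - w + a) = p (y - w) + c :=
    (Measure.measurePreserving_sub_left volume y).quasiMeasurePreserving.ae h
  filter_upwards [h2] with w hw
  rw [add_sub_right_comm, hw, mul_add]

/-- The increment of a potential along a path in an open set where the gradient is continuous. -/
theorem HasGrad.eq_integral_path {p : E3 → ℂ} {v : Fin 3 → E3 → ℂ} (hp : HasGrad univ p v)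
    {U : Set E3} (hU : IsOpen U) (hv : ∀ i, ContinuousOn (v i) U) {γ : ℝ → E3}
    (hγ : ContDiffOn ℝ 1 γ (Icc 0 1)) (hm : MapsTo γ (Icc 0 1) U) {a : E3} {c : ℂ}
    (hpa : ∀ᵐ y, p (y + a) = p y + c) (ha : γ 1 - γ 0 = a) :
    c = ∫ s in (0 : ℝ)..1, ∑ i, v i (γ s) * ((derivWithin γ (Icc 0 1) s i : ℝ) : ℂ) := by
  obtain ⟨θ, hθn, -, hθt⟩ := exists_mollifier_seq one_pos
  set D := derivWithin γ (Icc 0 1) with hD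
  have hDc : ContinuousOn D (Icc 0 1) :=
    hγ.continuousOn_derivWithin (uniqueDiffOn_Icc one_pos) le_rfl
  have hDi (i : Fin 3) : ContinuousOn (fun s => ((D s i : ℝ) : ℂ)) (Icc 0 1) :=
    Complex.continuous_ofReal.comp_continuousOn
      ((EuclideanSpace.proj (𝕜 := ℝ) i).continuous.comp_continuousOn hDc)
  have hpl := hp.locL2.locallyIntegrable
  have hvl (i : Fin 3) := (hp.grad_locL2 i).locallyIntegrable
  have hvs (n : ℕ) (i : Fin 3) : ContDiff ℝ ∞ (mollify (θ n) (v i)) :=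
    contDiff_mollify (hθn n).smooth (hθn n).compact (hvl i)
  have hps (n : ℕ) : ContDiff ℝ ∞ (mollify (θ n) p) :=
    contDiff_mollify (hθn n).smooth (hθn n).compact hpl
  have hcont (n : ℕ) : ContinuousOn
      (fun s => ∑ i, mollify (θ n) (v i) (γ s) * ((D s i : ℝ) : ℂ)) (Icc 0 1) :=
    continuousOn_finsetSum _ fun i _ =>
      ((hvs n i).continuous.comp_continuousOn hγ.continuousOn).mul (hDi i)
  -- For the mollified potential the line integral is exactly the increment `c`, independently of n.
  have hftc (n : ℕ) : ∫ s in (0 : ℝ)..1, ∑ i, mollify (θ n) (v i) (γ s) * ((D s i : ℝ) : ℂ) = c := by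
    rw [intervalIntegral.integral_eq_sub_of_hasDerivAt_of_le zero_le_one
      (f := fun s => mollify (θ n) p (γ s)) ((hps n).continuous.comp_continuousOn hγ.continuousOn)
      (fun s hs => ?_) ((hcont n).intervalIntegrable_of_Icc zero_le_one)]
    · have e1 : γ 1 = γ 0 + a := by rw [← ha]; abel
      rw [e1, (hθn n).mollify_add_const hpl hpa, add_sub_cancel_left]
    · have hn : Icc (0 : ℝ) 1 ∈ 𝓝 s := Icc_mem_nhds hs.1 hs.2
      have h1 : HasDerivAt γ (D s) s :=
        ((hγ.differentiableOn (by simp) s (Ioo_subset_Icc_self hs)).hasDerivWithinAt).hasDerivAt hn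
      have h2 : HasFDerivAt (mollify (θ n) p) (oneForm (fun i => mollify (θ n) (v i)) (γ s)) (γ s) :=
        hasFDerivAt_of_partials ((hps n).differentiable (by simp) _) fun i =>
          fderiv_mollify_of_hasWeakPartial (hθn n).smooth (hθn n).compact hpl (hp.weak i)
            (fun _ _ => mem_univ _) fun _ _ => rfl
      refine (h2.comp_hasDerivAt s h1).congr_deriv ?_
      rw [oneForm_apply]
      exact Finset.sum_congr rfl fun i _ => mul_comm _ _
  have hK : IsCompact (γ '' Icc 0 1) := isCompact_Icc.image_of_continuousOn hγ.continuousOn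
  -- A compact neighbourhood of the curve inside `U` bounds the continuous field, which supplies the
  -- dominating constant for the limit.
  obtain ⟨δ, hδ, hδU⟩ := hK.exists_cthickening_subset_open hU (image_subset_iff.2 hm)
  have hKδ : IsCompact (Metric.cthickening δ (γ '' Icc 0 1)) := hK.cthickening
  choose M hM using fun i => hKδ.exists_bound_of_continuousOn ((hv i).mono hδU)
  obtain ⟨A, hA⟩ := isCompact_Icc.exists_bound_of_continuousOn hDc
  have hlim : Tendsto
      (fun n => ∫ s in (0 : ℝ)..1, ∑ i, mollify (θ n) (v i) (γ s) * ((D s i : ℝ) : ℂ)) atTop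
      (𝓝 (∫ s in (0 : ℝ)..1, ∑ i, v i (γ s) * ((D s i : ℝ) : ℂ))) := by
    have hIoc : uIoc (0 : ℝ) 1 = Ioc 0 1 := uIoc_of_le zero_le_one
    refine intervalIntegral.tendsto_integral_filter_of_dominated_convergence
      (fun _ => ∑ i, M i * A) (.of_forall fun n => ?_) ?_ intervalIntegrable_const ?_
    · rw [hIoc]
      exact ((hcont n).mono Ioc_subset_Icc_self).aestronglyMeasurable measurableSet_Ioc
    · filter_upwards [hθt.eventually (gt_mem_nhds hδ)] with n hn
      refine .of_forall fun s hs => ?_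
      rw [hIoc] at hs
      have hs' := Ioc_subset_Icc_self hs
      refine (norm_sum_le _ _).trans (Finset.sum_le_sum fun i _ => ?_)
      rw [norm_mul, Complex.norm_real]
      have h1 : ‖mollify (θ n) (v i) (γ s)‖ ≤ M i := by
        have := (hθn n).norm_mollify_sub_le (hvl i) (y := γ s) (c := 0) (ε := M i) fun w hw => by
          rw [sub_zero]
          refine hM i w (Metric.mem_cthickening_of_dist_le w (γ s) δ _ ⟨s, hs', rfl⟩ ?_)
          exact le_trans hw hn.le
        rwa [sub_zero] at this
      exact mul_le_mul h1 ((PiLp.norm_apply_le _ i).trans (hA s hs')) (norm_nonneg _)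
        ((norm_nonneg _).trans h1)
    · refine .of_forall fun s hs => ?_
      rw [hIoc] at hs
      refine tendsto_finsetSum _ fun i _ => Tendsto.mul_const _ ?_
      have hc := (hv i).continuousAt (hU.mem_nhds (hm (Ioc_subset_Icc_self hs)))
      rw [Metric.tendsto_nhds]
      intro ε hε
      obtain ⟨η, hη, h1⟩ := Metric.continuousAt_iff.1 hc (ε / 2) (half_pos hε)
      filter_upwards [hθt.eventually (gt_mem_nhds hη)] with n hn
      rw [dist_eq_norm]
      refine ((hθn n).norm_mollify_sub_le (hvl i) fun w hw => ?_).trans_lt (half_lt_self hε)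
      rw [← dist_eq_norm]
      exact (h1 (lt_of_le_of_lt hw hn)).le
  simp only [hftc] at hlim
  exact tendsto_nhds_unique tendsto_const_nhds hlim

end LineIntegral

/-! ### Components of periodic vector fields. -/

section Components

lemma memLp_coord {u : E3 → C3} {μ : Measure E3} (h : MemLp u 2 μ) (i : Fin 3) :
    MemLp (fun y => u y i) 2 μ := by
  have hc : Continuous fun z : C3 => z i := (EuclideanSpace.proj (𝕜 := ℂ) i).continuous
  exact h.of_le (hc.comp_aestronglyMeasurable h.1) (.of_forall fun y => PiLp.norm_apply_le (u y) i)

lemma MemL2per.locL2_coord {u : E3 → C3} (h : MemL2per u) (i : Fin 3) :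
    LocL2 univ fun y => u y i := fun K _ hK => memLp_coord (h.memLp K hK) i

lemma MemL2per.periodic_coord {u : E3 → C3} (h : MemL2per u) (i : Fin 3) (k : Fin 3 → ℤ) :
    ∀ᵐ y, u (y + latticeVec k) i = u y i := (h.periodic k).mono fun y hy => by rw [hy]

lemma MemL2per.locL2 {v : E3 → ℂ} (h : MemL2per v) : LocL2 univ v := fun K _ hK => h.memLp K hK

lemma LocL2.memL2per {v : E3 → ℂ} (h : LocL2 univ v)
    (hp : ∀ k : Fin 3 → ℤ, ∀ᵐ y, v (y + latticeVec k) = v y) : MemL2per v :=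
  ⟨fun K hK => h K (subset_univ _) hK, hp⟩

lemma MemL2per.memLp_unitCell {u : E3 → C3} (h : MemL2per u) :
    MemLp u 2 (volume.restrict unitCell) :=
  (h.memLp _ (isCompact_closedBall 0 1)).mono_measure
    (Measure.restrict_mono unitCell_subset_closedBall le_rfl)

end Components

/-! ### The splitting and its pairing property. -/

section Splitting

variable {S : Set E3} {u : E3 → C3}

/-- The potential counts only on Σ*, whereas a periodic function restricting to it can be paired
over the whole cell. Uniqueness of weak gradients identifies its gradient with u - z on Σ*; nothing
is asserted inside Σ. -/
lemma IsCirculationSplitting.exists_hasGrad {z : C3} {ψ : E3 → ℂ} (hS : IsInclusion S)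
    (hu : MemL2per u) (h : IsCirculationSplitting S u z ψ) :
    HasGrad (cellComplement S) ψ (fun i y => u y i - z i) ∧
    ∃ Ψ g, HasGrad univ Ψ g ∧ (∀ k : Fin 3 → ℤ, ∀ᵐ y, Ψ (y + latticeVec k) = Ψ y) ∧
      (∀ i (k : Fin 3 → ℤ), ∀ᵐ y, g i (y + latticeVec k) = g i y) ∧
      ∀ i, g i =ᵐ[volume.restrict (cellComplement S)] fun y => u y i - z i := by
  obtain ⟨⟨Ψ, ⟨hΨ, hg⟩, hψ⟩, hw⟩ := h
  choose g hgm hgw using hg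
  have hG : HasGrad univ Ψ g := ⟨hΨ.locL2, fun i => (hgm i).locL2, hgw⟩
  have hψg : HasGrad (cellComplement S) ψ (fun i y => u y i - z i) :=
    ⟨(hΨ.locL2.mono (subset_univ _)).congr hψ.symm, fun i =>
      ((hu.locL2_coord i).sub (.of_continuous continuous_const)).mono (subset_univ _), hw⟩
  exact ⟨hψg, Ψ, g, hG, hΨ.periodic, fun i => (hgm i).periodic,
    fun i => (hG.mono (subset_univ _)).ae_eq hS.isOpen_cellComplement hψg hψ.symm i⟩

/-- Pairing with divergence free fields that vanish in the inclusion. -/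
theorem IsCirculationSplitting.integral_eq {z : C3} {ψ : E3 → ℂ} (hS : IsInclusion S)
    (hu : MemL2per u) (h : IsCirculationSplitting S u z ψ) {f : E3 → C3} (hf : MemL2per f)
    (hdiv : IsDivFreeOn univ f) (hf0 : ∀ᵐ y ∂(volume.restrict S), f y = 0) :
    ∫ y in unitCell, ∑ i, u y i * f y i = ∑ i, z i * ∫ y in unitCell, f y i := by
  obtain ⟨-, Ψ, g, hG, hΨp, hgp, hgu⟩ := h.exists_hasGrad hS hu
  have h0 := integral_unitCell_grad_mul_divFree hf.locL2_coord hf.periodic_coord hdiv hG hΨp hgp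
  -- The gradient may differ from u - z inside `S`, but `f` vanishes there.
  have hae : ∀ᵐ y ∂(volume.restrict unitCell),
      ∑ i, u y i * f y i = ∑ i, (g i y * f y i + z i * f y i) := by
    have hS' := (ae_restrict_iff' hS.isCompact.measurableSet).1 hf0
    have hg' := ae_all_iff.2 fun i =>
      (ae_restrict_iff' hS.isOpen_cellComplement.measurableSet).1 (hgu i)
    refine (ae_restrict_iff' isOpen_unitCell.measurableSet).2 ?_
    filter_upwards [hS', hg'] with y h1 h2 hy
    by_cases hyS : y ∈ S
    · simp [h1 hyS]
    · refine Finset.sum_congr rfl fun i _ => ?_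
      rw [h2 i ⟨hy, hyS⟩]
      ring
  have i1 (i : Fin 3) : Integrable (fun y => g i y * f y i) (volume.restrict unitCell) :=
    LocallyIntegrable.integrableOn_unitCell
      ((hG.grad_locL2 i).locallyIntegrable_mul (hf.locL2_coord i))
  have i2 (i : Fin 3) : Integrable (fun y => z i * f y i) (volume.restrict unitCell) :=
    (LocallyIntegrable.integrableOn_unitCell (hf.locL2_coord i).locallyIntegrable).const_mul _
  rw [integral_finsetSum _ fun i _ => i1 i] at h0
  rw [integral_congr_ae hae, integral_sum_add i1 i2, Finset.sum_add_distrib, h0, zero_add]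
  simp only [integral_const_mul]

/-- Existence of the splitting, with the line integral formula. -/
theorem IsInclusion.exists_splitting (hS : IsInclusion S) (hu : MemL2per u)
    (hc : IsCurlFreeOn (periodicComplement S) u) :
    ∃ (z : C3) (ψ : E3 → ℂ), IsCirculationSplitting S u z ψ ∧
      (ContinuousOn u (periodicComplement S) →
          ∀ (k : Fin 3) (γ : ℝ → E3), ContDiffOn ℝ 1 γ (Icc 0 1) →
            MapsTo γ (Icc 0 1) (periodicComplement S) →
            γ 1 - γ 0 = EuclideanSpace.single k 1 →
            z k = ∫ s in (0 : ℝ)..1,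
              ∑ i, u (γ s) i * ((derivWithin γ (Icc 0 1) s i : ℝ) : ℂ)) := by
  obtain ⟨p, v, z, hp, hvp, hvu, hpz⟩ := hS.exists_hasGrad_univ hu.locL2_coord hu.periodic_coord hc
  have hW := hS.isOpen_cellComplement
  have hUo := isOpen_periodicComplement hS.isCompact.isClosed hS.subset_cell
  -- Subtracting the linear function z·y cancels the lattice increments of `p`.
  have hlin : HasGrad univ (oneForm (fun i _ => z i) 0) fun i _ => z i :=
    .of_hasFDerivAt (fun i => continuous_const) fun y _ => (oneForm (fun i _ => z i) 0).hasFDerivAt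
  have hΨ := hp.sub hlin
  have hΨp (k : Fin 3 → ℤ) : ∀ᵐ y, p (y + latticeVec k) - oneForm (fun i _ => z i) 0 (y + latticeVec k)
      = p y - oneForm (fun i _ => z i) 0 y := by
    filter_upwards [hpz k] with y hy
    rw [hy, map_add, oneForm_apply _ _ (latticeVec k)]
    simp
  have hgp (i : Fin 3) (k : Fin 3 → ℤ) : ∀ᵐ y, v i (y + latticeVec k) - z i = v i y - z i :=
    (hvp i k).mono fun y hy => by rw [hy]
  refine ⟨WithLp.toLp 2 z, fun y => p y - oneForm (fun i _ => z i) 0 y,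
    ⟨⟨_, ⟨hΨ.locL2.memL2per hΨp, fun i => ⟨_, (hΨ.grad_locL2 i).memL2per (hgp i), hΨ.weak i⟩⟩,
      by rfl⟩, fun i => ?_⟩, fun hcont k γ hγ hm hγ1 => ?_⟩
  · refine ((hΨ.mono (subset_univ (cellComplement S))).weak i).congr hW (by rfl) ?_
    refine (ae_restrict_mem hW.measurableSet).mono fun y hy => ?_
    simp only [hvu y (cellComplement_subset_periodicComplement hS.subset_cell hy) i]
  · have hk : latticeVec (Pi.single k 1) = EuclideanSpace.single k 1 := by
      ext i
      by_cases h : i = k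
      · subst h; simp
      · simp [h]
    have hpk : ∀ᵐ y, p (y + EuclideanSpace.single k 1) = p y + z k := by
      filter_upwards [hpz (Pi.single k 1)] with y hy
      rw [← hk, hy]
      congr 1
      rw [Finset.sum_eq_single k (fun i _ hi => by simp [hi]) (by simp)]
      simp
    have hvc (i : Fin 3) : ContinuousOn (v i) (periodicComplement S) := by
      have h1 : ContinuousOn (fun y => u y i) (periodicComplement S) :=
        (EuclideanSpace.proj (𝕜 := ℂ) i).continuous.comp_continuousOn hcont
      exact h1.congr fun y hy => hvu y hy i
    refine (hp.eq_integral_path hUo hvc hγ hm hpk hγ1).trans ?_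
    refine intervalIntegral.integral_congr fun s hs => ?_
    rw [uIcc_of_le zero_le_one] at hs
    exact Finset.sum_congr rfl fun i _ => by rw [hvu _ (hm hs) i]

end Splitting

/-! ### Divergence free fields that cross the cell and avoid the inclusion. -/

section CrossingField

/-- The 1-periodic function t ↦ -cos(2πt) takes its maximum 1 at t = 1/2, on a face of the cell, and
so detects closeness to that face. -/
lemma exists_neg_cos_gt {a : ℝ} (ha : a < 1) :
    ∃ t ∈ Ioo (-(1 / 2) : ℝ) (1 / 2), a < -Real.cos (2 * Real.pi * t) := by
  have hc : ContinuousAt (fun t : ℝ => -Real.cos (2 * Real.pi * t)) (1 / 2) := by fun_prop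
  have h1 : a < -Real.cos (2 * Real.pi * (1 / 2)) := by
    rw [show 2 * Real.pi * (1 / 2) = Real.pi by ring, Real.cos_pi]; linarith
  have h2 : ∀ᶠ t in 𝓝[<] (1 / 2 : ℝ), a < -Real.cos (2 * Real.pi * t) :=
    (hc.eventually (lt_mem_nhds h1)).filter_mono nhdsWithin_le_nhds
  have h3 : ∀ᶠ t in 𝓝[<] (1 / 2 : ℝ), t ∈ Ioo (-(1 / 2) : ℝ) (1 / 2) :=
    Ioo_mem_nhdsLT (by norm_num)
  obtain ⟨t, ht⟩ := (h2.and h3).exists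
  exact ⟨t, ht.2, ht.1⟩

lemma neg_cos_lt_one {t : ℝ} (ht : t ∈ Ioo (-(1 / 2) : ℝ) (1 / 2)) :
    -Real.cos (2 * Real.pi * t) < 1 := by
  have hpi := Real.pi_pos
  have h1 : |2 * Real.pi * t| < Real.pi := by
    rw [abs_lt]
    constructor <;> nlinarith [ht.1, ht.2]
  have h2 : Real.cos Real.pi < Real.cos |2 * Real.pi * t| :=
    Real.cos_lt_cos_of_nonneg_of_le_pi (abs_nonneg _) le_rfl h1
  rw [Real.cos_abs, Real.cos_pi] at h2
  linarith

/-- There is a periodic divergence free field in the direction `e_k`, with nonzero mean, that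
avoids the inclusion. -/
theorem IsInclusion.exists_crossing_field {S : Set E3} (hS : IsInclusion S) (k : Fin 3) :
    ∃ h : E3 → ℝ, 0 < ∫ y in unitCell, h y ∧ (∀ y ∈ S, h y = 0) ∧
      MemL2per (fun y => EuclideanSpace.single k (h y : ℂ)) ∧
      IsDivFreeOn univ fun y => EuclideanSpace.single k (h y : ℂ) := by
  -- A field η(y_j) e_k with j ≠ k does not vary in the direction k, hence is divergence free.
  obtain ⟨j, hjk⟩ : ∃ j : Fin 3, j ≠ k := exists_ne k
  have hcos : Continuous fun y : E3 => -Real.cos (2 * Real.pi * y j) := by fun_prop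
  obtain ⟨x, hx, hmax⟩ := hS.isCompact.exists_isMaxOn hS.isConnected.nonempty hcos.continuousOn
  -- `a` is the maximum of -cos(2πy_j) over `S`, less than 1 since a compact set stays away from the
  -- faces. The function η below is positive exactly where this maximum is exceeded, a periodic slab
  -- that misses `S`.
  set a := -Real.cos (2 * Real.pi * x j) with ha
  have ha1 : a < 1 := neg_cos_lt_one (hS.subset_cell hx j)
  set η : ℝ → ℝ := fun t => expNegInvGlue (-Real.cos (2 * Real.pi * t) - a) with hη
  have hηs : ContDiff ℝ ∞ η := by
    refine expNegInvGlue.contDiff.comp ?_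
    have : ContDiff ℝ ∞ fun t => Real.cos (2 * Real.pi * t) :=
      Real.contDiff_cos.comp (contDiff_const.mul contDiff_id)
    exact this.neg.sub contDiff_const
  have hηc : Continuous fun y : E3 => η (y j) := hηs.continuous.comp (by fun_prop)
  have hper (m : ℤ) (t : ℝ) : η (t + m) = η t := by
    simp only [hη]
    rw [show 2 * Real.pi * (t + m) = 2 * Real.pi * t + m * (2 * Real.pi) by ring,
      Real.cos_add_int_mul_two_pi]
  have hcC : Continuous fun y : E3 => (EuclideanSpace.single k (η (y j) : ℂ) : C3) := by
    have h1 : (fun y : E3 => (EuclideanSpace.single k (η (y j) : ℂ) : C3))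
        = fun y => (η (y j) : ℂ) • EuclideanSpace.single k (1 : ℂ) := by
      funext y
      ext i
      by_cases h : i = k
      · subst h; simp
      · simp [h]
    rw [h1]
    exact (Complex.continuous_ofReal.comp hηc).smul continuous_const
  refine ⟨fun y => η (y j), ?_, fun y hy => ?_, ⟨fun K hK => ?_, fun m => .of_forall fun y => ?_⟩,
    fun φ hφ => ?_⟩
  · have hint : IntegrableOn (fun y : E3 => η (y j)) unitCell :=
      (hηc.continuousOn.integrableOn_compact (isCompact_closedBall 0 1)).mono_set
        unitCell_subset_closedBall
    have hnn : 0 ≤ᵐ[volume.restrict unitCell] fun y : E3 => η (y j) :=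
      .of_forall fun y => expNegInvGlue.nonneg _
    rw [setIntegral_pos_iff_support_of_nonneg_ae hnn hint]
    have ho : IsOpen ((Function.support fun y : E3 => η (y j)) ∩ unitCell) :=
      hηc.isOpen_support.inter isOpen_unitCell
    refine ho.measure_pos volume ?_
    obtain ⟨t, ht, hta⟩ := exists_neg_cos_gt ha1
    refine ⟨WithLp.toLp 2 fun _ => t, ?_, fun _ => ht⟩
    exact (expNegInvGlue.pos_of_pos (sub_pos.2 hta)).ne'
  · exact expNegInvGlue.zero_of_nonpos (sub_nonpos.2 (hmax hy))
  · obtain ⟨M, hM⟩ := hK.exists_bound_of_continuousOn hcC.continuousOn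
    have : IsFiniteMeasure (volume.restrict K) := ⟨by simpa using hK.measure_lt_top⟩
    exact MemLp.of_bound hcC.aestronglyMeasurable M
      ((ae_restrict_mem hK.measurableSet).mono hM)
  · simp only [PiLp.add_apply, latticeVec_apply, hper]
  · have hgrad : HasGrad univ (fun y => (η (y j) : ℂ))
        fun i y => if i = j then ((deriv η (y j) : ℝ) : ℂ) else 0 := by
      refine .of_hasFDerivAt (fun i => ?_) fun y _ => ?_
      · split_ifs
        · exact Complex.continuous_ofReal.comp
            ((hηs.continuous_deriv (by simp)).comp (by fun_prop))
        · exact continuous_const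
      · have h1 : HasDerivAt (fun t => (η t : ℂ)) ((deriv η (y j) : ℝ) : ℂ) (y j) :=
          ((hηs.differentiable (by simp)) (y j)).hasDerivAt.ofReal_comp
        have h2 : HasFDerivAt (fun y : E3 => y j) (EuclideanSpace.proj j : E3 →L[ℝ] ℝ) y :=
          (EuclideanSpace.proj j : E3 →L[ℝ] ℝ).hasFDerivAt
        have h3 := h1.hasFDerivAt.comp y h2
        refine h3.congr_fderiv ?_
        ext w
        rw [oneForm_apply, Finset.sum_eq_single j (fun i _ hi => by simp [hi]) (by simp)]
        simp
    have h1 := hgrad.weak k φ hφ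
    simp only [if_neg hjk.symm, mul_zero, integral_zero, neg_zero] at h1
    rw [← h1]
    refine integral_congr_ae (.of_forall fun y => ?_)
    simp only
    rw [Finset.sum_eq_single k (fun i _ hi => by simp [hi]) (by simp)]
    simp

end CrossingField

/-! ### Formula for the components of the circulation and norm estimates. -/

section Bound

variable {S : Set E3}

/-- The components of the vector of a splitting, in terms of a crossing field. -/
lemma IsCirculationSplitting.mul_integral_eq (hS : IsInclusion S) {u : E3 → C3} (hu : MemL2per u)
    {z : C3} {ψ : E3 → ℂ} (h : IsCirculationSplitting S u z ψ) {k : Fin 3} {η : E3 → ℝ}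
    (hη : ∀ y ∈ S, η y = 0) (hm : MemL2per fun y => (EuclideanSpace.single k (η y : ℂ) : C3))
    (hdiv : IsDivFreeOn univ fun y => EuclideanSpace.single k (η y : ℂ)) :
    z k * ((∫ y in unitCell, η y : ℝ) : ℂ) = ∫ y in unitCell, (η y : ℂ) * u y k := by
  have h1 := h.integral_eq hS hu hm hdiv
    ((ae_restrict_mem hS.isCompact.measurableSet).mono fun y hy => by simp [hη y hy])
  have h2 (y : E3) : ∑ i, u y i * (EuclideanSpace.single k (η y : ℂ) : C3) i = (η y : ℂ) * u y k := by
    rw [Finset.sum_eq_single k (fun i _ hi => by simp [hi]) (by simp)]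
    simp [mul_comm]
  simp only [h2] at h1
  rw [h1, Finset.sum_eq_single k (fun i _ hi => by simp [hi]) (by simp)]
  simp only [PiLp.single_apply, if_true]
  rw [integral_complex_ofReal]

lemma norm_integral_mul_le {μ : Measure E3} {a b : E3 → ℂ} (ha : MemLp a 2 μ) (hb : MemLp b 2 μ) :
    ‖∫ y, a y * b y ∂μ‖ ≤ (eLpNorm a 2 μ).toReal * (eLpNorm b 2 μ).toReal := by
  rw [← ENNReal.toReal_mul, ← toReal_enorm]
  refine ENNReal.toReal_mono (ENNReal.mul_ne_top ha.2.ne hb.2.ne) ?_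
  refine (enorm_integral_le_lintegral_enorm _).trans ?_
  rw [← eLpNorm_one_eq_lintegral_enorm]
  have h := eLpNorm_smul_le_mul_eLpNorm (p := 2) (q := 2) (r := 1) hb.1 ha.1
  simpa only [smul_eq_mul, Pi.smul_apply', Pi.mul_def] using h

lemma norm_le_sum_norm (z : C3) : ‖z‖ ≤ ∑ k, ‖z k‖ := by
  have h : z = ∑ k, EuclideanSpace.single k (z k) := by
    ext i; simp [Fin.sum_univ_three]; fin_cases i <;> simp
  conv_lhs => rw [h]
  refine (norm_sum_le _ _).trans (Finset.sum_le_sum fun k _ => ?_)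
  simp

end Bound

/-! ### Assembly of the theorem. -/

theorem lemma4p3 (S : Set E3) (hS : IsInclusion S) :
    ∃ C : ℝ, 0 < C ∧ ∀ u : E3 → C3, MemL2per u → IsCurlFreeOn (periodicComplement S) u →
      ∃ (z : C3) (ψ : E3 → ℂ),
        -- the splitting, and its uniqueness (up to an additive constant in the potential)
        IsCirculationSplitting S u z ψ ∧
        (∀ (z' : C3) (ψ' : E3 → ℂ), IsCirculationSplitting S u z' ψ' →
          z' = z ∧ ∃ c : ℂ, ∀ᵐ y ∂(volume.restrict (cellComplement S)), ψ' y = ψ y + c) ∧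
        -- pairing with divergence-free fields vanishing in the inclusion
        (∀ f : E3 → C3, MemL2per f → IsDivFreeOn univ f →
          (∀ᵐ y ∂(volume.restrict S), f y = 0) →
          ∫ y in unitCell, ∑ i, u y i * f y i = ∑ i, z i * ∫ y in unitCell, f y i) ∧
        -- line integrals
        (ContinuousOn u (periodicComplement S) →
          ∀ (k : Fin 3) (γ : ℝ → E3), ContDiffOn ℝ 1 γ (Icc 0 1) →
            MapsTo γ (Icc 0 1) (periodicComplement S) →
            γ 1 - γ 0 = EuclideanSpace.single k 1 →
            z k = ∫ s in (0 : ℝ)..1,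
              ∑ i, u (γ s) i * ((derivWithin γ (Icc 0 1) s i : ℝ) : ℂ)) ∧
        -- the bound, uniform in `u`
        ‖z‖ ≤ C * (eLpNorm u 2 (volume.restrict unitCell)).toReal := by
  choose η hη0 hηS hηm hηdiv using hS.exists_crossing_field
  set A : Fin 3 → ℝ := fun k =>
    (eLpNorm (fun y => (η k y : ℂ)) 2 (volume.restrict unitCell)).toReal with hA
  have hηL (k : Fin 3) : MemLp (fun y => (η k y : ℂ)) 2 (volume.restrict unitCell) := by
    have := memLp_coord (hηm k).memLp_unitCell k
    simpa using this
  have hC0 (k : Fin 3) : 0 ≤ A k / ∫ y in unitCell, η k y :=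
    div_nonneg ENNReal.toReal_nonneg (hη0 k).le
  -- The crossing fields are fixed before `u`, so the constant depends on `S` only; the summand 1
  -- makes positivity immediate.
  refine ⟨1 + ∑ k, A k / ∫ y in unitCell, η k y,
    add_pos_of_pos_of_nonneg one_pos (Finset.sum_nonneg fun k _ => hC0 k), fun u hu hc => ?_⟩
  obtain ⟨z, ψ, h, hline⟩ := hS.exists_splitting hu hc
  have hz (z' : C3) (ψ' : E3 → ℂ) (h' : IsCirculationSplitting S u z' ψ') (k : Fin 3) :
      z' k * ((∫ y in unitCell, η k y : ℝ) : ℂ) = ∫ y in unitCell, (η k y : ℂ) * u y k :=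
    h'.mul_integral_eq hS hu (hηS k) (hηm k) (hηdiv k)
  refine ⟨z, ψ, h, fun z' ψ' h' => ?_, fun f hf hdiv hf0 => h.integral_eq hS hu hf hdiv hf0,
    hline, ?_⟩
  · have hzz : z' = z := by
      ext k
      -- Every splitting gives the same weighted mean of `u`, and the positive mean of the crossing
      -- field can be cancelled.
      have hne : ((∫ y in unitCell, η k y : ℝ) : ℂ) ≠ 0 := Complex.ofReal_ne_zero.2 (hη0 k).ne'
      exact mul_right_cancel₀ hne ((hz z' ψ' h' k).trans (hz z ψ h k).symm)
    subst hzz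
    exact ⟨rfl, (h.exists_hasGrad hS hu).1.exists_sub_const hS.isOpen_cellComplement
      hS.simplyConnected.isPathConnected.isConnected.isPreconnected (h'.exists_hasGrad hS hu).1⟩
  · set N := (eLpNorm u 2 (volume.restrict unitCell)).toReal with hN
    have hN0 : 0 ≤ N := ENNReal.toReal_nonneg
    have hk (k : Fin 3) : ‖z k‖ ≤ A k / (∫ y in unitCell, η k y) * N := by
      have h1 := congrArg norm (hz z ψ h k)
      rw [norm_mul, Complex.norm_real, Real.norm_of_nonneg (hη0 k).le] at h1
      have h2 := norm_integral_mul_le (hηL k) (memLp_coord hu.memLp_unitCell k)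
      rw [← h1] at h2
      have h3 : (eLpNorm (fun y => u y k) 2 (volume.restrict unitCell)).toReal ≤ N :=
        ENNReal.toReal_mono hu.memLp_unitCell.2.ne
          (eLpNorm_mono fun y => PiLp.norm_apply_le (u y) k)
      rw [div_mul_eq_mul_div, le_div_iff₀ (hη0 k)]
      exact h2.trans (mul_le_mul_of_nonneg_left h3 ENNReal.toReal_nonneg)
    calc ‖z‖ ≤ ∑ k, ‖z k‖ := norm_le_sum_norm z
      _ ≤ ∑ k, A k / (∫ y in unitCell, η k y) * N := Finset.sum_le_sum fun k _ => hk k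
      _ = (∑ k, A k / ∫ y in unitCell, η k y) * N := by rw [Finset.sum_mul]
      _ ≤ _ := mul_le_mul_of_nonneg_right (by linarith) hN0
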